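/- Let $N\ge 1$, $n=\lfloor N/2\rfloor$, and index the rows and columns of $N\times N$ matrices by $\{-n,\dots,n\}$ if $N=2n+1$ and by $\{-n,\dots,-1,1,\dots,n\}$ if $N=2n$. Consider the orthogonal case ($N$ arbitrary, upper signs, $\theta_{ij}=1$) or the symplectic case ($N=2n$, lower signs, $\theta_{ij}=\operatorname{sgn} i\cdot\operatorname{sgn} j$), and the matrix transposition with $(e_{ij})^t=\theta_{ij}e_{-j,-i}$. The Yangian $\mathrm Y(N)$ is the unital associative $\mathbb C$-algebra with generators $t_{ij}^{(r)}$, $r\ge1$, and relations $$[t^{(r+1)}_{ij}, t^{(s)}_{kl}]-[t^{(r)}_{ij}, t^{(s+1)}_{kl}]=t^{(r)}_{kj} t^{(s)}_{il}-t^{(s)}_{kj} t^{(r)}_{il},\qquad r,s\ge 0,\quad t^{(0)}_{ij}=\delta_{ij}.$$ The twisted Yangian $\mathrm Y^{\pm}(N)$ is the unital associative $\mathbb C$-algebra with generators $s_{ij}^{(r)}$, $r\ge 1$, whose defining relations, written with $s_{ij}(u)=\delta_{ij}+\sum_{r\ge1}s_{ij}^{(r)}u^{-r}$, are $$\begin{aligned}(u^2-v^2)[s_{ij}(u),s_{kl}(v)]={}&(u+v)\big(s_{kj}(u)s_{il}(v)-s_{kj}(v)s_{il}(u)\big)\\&-(u-v)\big(\theta_{k,-j}s_{i,-k}(u)s_{-j,l}(v)-\theta_{i,-l}s_{k,-i}(v)s_{-l,j}(u)\big)\\&+\theta_{i,-j}\big(s_{k,-i}(u)s_{-j,l}(v)-s_{k,-i}(v)s_{-j,l}(u)\big)\end{aligned}$$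 and $\theta_{ij}s_{-j,-i}(-u)=s_{ij}(u)\pm\dfrac{s_{ij}(u)-s_{ij}(-u)}{2u}$. Let $T(u)=(t_{ij}(u))$, where $t_{ij}(u)=\sum_{r\ge0}t_{ij}^{(r)}u^{-r}$, and $S(u)=(s_{ij}(u))$. For a matrix $M$ and $1\le a\le N$ let $M_a$ be $M$ acting in the $a$-th copy of $\operatorname{End}\mathbb C^N$ in $(\operatorname{End}\mathbb C^N)^{\otimes N}$; let $Q=\sum_{i,j}e_{ij}^t\otimes e_{ji}$, $R^t(u)=1-Qu^{-1}$, $u_a=u-a+1$, and for $a<b$ let $R^t_{ab}=R^t_{ba}=1+Q_{ab}\,(u_a+u_b)^{-1}$, where $Q_{ab}$ is $Q$ acting in the $a$-th and $b$-th copies. Put $$\langle S_{p_1},\dots,S_{p_N}\rangle=S_{p_1}(u_{p_1})\big(R^t_{p_1p_2}\cdots R^t_{p_1p_N}\big)S_{p_2}(u_{p_2})\big(R^t_{p_2p_3}\cdots R^t_{p_2p_N}\big)\cdots S_{p_N}(u_{p_N}),$$ and let $A_N$ be the antisymmetrizer, $A_N(e_{i_1}\otimes\cdots\otimes e_{i_N})=\sum_{\sigma\in\mathfrak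 S_N}\operatorname{sgn}\sigma\; e_{i_{\sigma(1)}}\otimes\cdots\otimes e_{i_{\sigma(N)}}$. All expressions are expanded as formal series in $u^{-1}$. **Theorem.** There are unique series $\operatorname{qdet}T(u)\in 1+u^{-1}\mathrm Y(N)[[u^{-1}]]$ and $\operatorname{sdet}S(u)\in 1+u^{-1}\mathrm Y^\pm(N)[[u^{-1}]]$ (the quantum determinant and the Sklyanin determinant) such that $$A_N\,T_1(u)\cdots T_N(u-N+1)=T_N(u-N+1)\cdots T_1(u)\,A_N=A_N\operatorname{qdet}T(u),$$ $$A_N\langle S_1,\dots,S_N\rangle=\langle S_N,\dots,S_1\rangle A_N=A_N\operatorname{sdet}S(u),$$ and there is a unique algebra homomorphism $\mathrm Y^\pm(N)\to\mathrm Y(N)$ with $S(u)\mapsto T(u)\,T^t(-u)$. Regarding series over $\mathrm Y^\pm(N)$ as series over $\mathrm Y(N)$ through this homomorphism, we have $$\operatorname{sdet}S(u)=\gamma_n(u)\,\operatorname{qdet}T(u)\,\operatorname{qdet}T(-u+N-1),$$ where $\gamma_n(u)=1$ in the orthogonal case and $\gamma_n(u)=\dfrac{2u+1}{2u-2n+1}$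 in the symplectic case. -/

import Mathlib

noncomputable section

namespace TwYang

/-! ### Index sets and the two classical cases -/

/-- The set `{-n, …, n}` if `N = 2n + 1`, and `{-n, …, -1, 1, …, n}` if `N = 2n`. -/
def idxSet (N : ℕ) : Finset ℤ :=
  (Finset.Icc (-((N / 2 : ℕ) : ℤ)) ((N / 2 : ℕ) : ℤ)).filter fun i => Even N → i ≠ 0

/-- The type of the row and column indices of `N × N` matrices. -/
abbrev Idx (N : ℕ) : Type := {i : ℤ // i ∈ idxSet N}

instance (N : ℕ) : Neg (Idx N) where
  neg i := ⟨-i.1, by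
    have h := i.2
    simp only [idxSet, Finset.mem_filter, Finset.mem_Icc] at h ⊢
    refine ⟨⟨by omega, by omega⟩, fun hN => ?_⟩
    have := h.2 hN
    omega⟩

/-- The orthogonal case (upper signs) and the symplectic case (lower signs). -/
inductive Kind : Type
  | orthogonal
  | symplectic

/-- The double sign `±`: `+1` in the orthogonal case and `-1` in the symplectic case. -/
def Kind.pm : Kind → ℂ
  | .orthogonal => 1
  | .symplectic => -1

/-- `θ_{ij}`: `1` in the orthogonal case, `sgn i · sgn j` in the symplectic case. -/
def θ {N : ℕ} : Kind → Idx N → Idx N → ℤ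
  | .orthogonal, _, _ => 1
  | .symplectic, i, j => i.1.sign * j.1.sign

/-- The transposition with `(e_{ij})^t = θ_{ij} e_{-j,-i}` on matrices with entries in `A`. -/
def twT {N : ℕ} (c : Kind) {A : Type*} [AddGroup A] (M : Matrix (Idx N) (Idx N) A) :
    Matrix (Idx N) (Idx N) A :=
  Matrix.of fun i j => θ c (-j) (-i) • M (-j) (-i)

/-! ### The Yangian and the twisted Yangian -/

/-- The free associative algebra on symbols `x_{ij}^{(1)}, x_{ij}^{(2)}, …`; the generator
`(i, j, r)` stands for `x_{ij}^{(r + 1)}`. -/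
abbrev FreeAlg (N : ℕ) : Type := FreeAlgebra ℂ (Idx N × Idx N × ℕ)

/-- `x_{ij}^{(r)}` for `r ≥ 0`, where `x_{ij}^{(0)} = δ_{ij}`. -/
def gen {N : ℕ} (i j : Idx N) : ℕ → FreeAlg N
  | 0 => if i = j then 1 else 0
  | r + 1 => FreeAlgebra.ι ℂ (i, j, r)

/-- The coefficient of `u^{-r}` in `x_{ij}(u) = δ_{ij} + x_{ij}^{(1)} u^{-1} + ⋯` for any integer
`r`: it is zero for negative `r`. -/
def genZ {N : ℕ} (i j : Idx N) (r : ℤ) : FreeAlg N :=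
  if r < 0 then 0 else gen i j r.toNat

/-- The defining relations of the Yangian `Y(N)`. -/
inductive YangianRel (N : ℕ) : FreeAlg N → FreeAlg N → Prop
  | rtt (i j k l : Idx N) (r s : ℕ) : YangianRel N
      (⁅gen i j (r + 1), gen k l s⁆ - ⁅gen i j r, gen k l (s + 1)⁆)
      (gen k j r * gen i l s - gen k j s * gen i l r)

/-- The Yangian `Y(N)` for `gl_N`, with generators indexed by `{-n, …, n}`. -/
abbrev Yangian (N : ℕ) : Type := RingQuot (YangianRel N)

/-- The defining relations of the twisted Yangian. `quat` is the equality of the coefficients of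
`u^{-r} v^{-s}`, for all integers `r` and `s`, in

  `(u² - v²) [s_{ij}(u), s_{kl}(v)] = (u + v) (s_{kj}(u) s_{il}(v) - s_{kj}(v) s_{il}(u))`
  `  - (u - v) (θ_{k,-j} s_{i,-k}(u) s_{-j,l}(v) - θ_{i,-l} s_{k,-i}(v) s_{-l,j}(u))`
  `  + θ_{i,-j} (s_{k,-i}(u) s_{-j,l}(v) - s_{k,-i}(v) s_{-j,l}(u))`,

and `symm` is the equality of the coefficients of `u^{-r}` in

  `θ_{ij} s_{-j,-i}(-u) = s_{ij}(u) ± (s_{ij}(u) - s_{ij}(-u)) / (2u)`. -/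
inductive TwistedRel (c : Kind) (N : ℕ) : FreeAlg N → FreeAlg N → Prop
  | quat (i j k l : Idx N) (r s : ℤ) : TwistedRel c N
      (⁅genZ i j (r + 2), genZ k l s⁆ - ⁅genZ i j r, genZ k l (s + 2)⁆)
      ((genZ k j (r + 1) * genZ i l s - genZ k j s * genZ i l (r + 1))
        + (genZ k j r * genZ i l (s + 1) - genZ k j (s + 1) * genZ i l r)
        - (θ c k (-j) • (genZ i (-k) (r + 1) * genZ (-j) l s)
            - θ c i (-l) • (genZ k (-i) s * genZ (-l) j (r + 1)))
        + (θ c k (-j) • (genZ i (-k) r * genZ (-j) l (s + 1))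
            - θ c i (-l) • (genZ k (-i) (s + 1) * genZ (-l) j r))
        + θ c i (-j) • (genZ k (-i) r * genZ (-j) l s - genZ k (-i) s * genZ (-j) l r))
  | symm (i j : Idx N) (r : ℤ) : TwistedRel c N
      (θ c i j • ((-1 : ℂ) ^ r • genZ (-j) (-i) r))
      (genZ i j r
        + (c.pm / 2) • (genZ i j (r - 1) - (-1 : ℂ) ^ (r - 1) • genZ i j (r - 1)))

/-- The twisted Yangian: `Y⁺(N)` in the orthogonal case, `Y⁻(N)` (for even `N`) in the
symplectic case. -/
abbrev TwistedYangian (c : Kind) (N : ℕ) : Type := RingQuot (TwistedRel c N)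

/-! ### Formal series in `u⁻¹`

A series in `A[[u⁻¹]]` is a `PowerSeries A`, the variable `X` being `u⁻¹`. -/

/-- The matrix `T(u)` of generating series of the Yangian. -/
def Tmat (N : ℕ) : Matrix (Idx N) (Idx N) (PowerSeries (Yangian N)) :=
  Matrix.of fun i j => PowerSeries.mk fun r => RingQuot.mkAlgHom ℂ (YangianRel N) (gen i j r)

/-- The matrix `S(u)` of generating series of the twisted Yangian. -/
def Smat (c : Kind) (N : ℕ) : Matrix (Idx N) (Idx N) (PowerSeries (TwistedYangian c N)) :=
  Matrix.of fun i j => PowerSeries.mk fun r => RingQuot.mkAlgHom ℂ (TwistedRel c N) (gen i j r)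

/-- The expansion of `(a u + b)⁻¹` in powers of `u⁻¹`, for `a ≠ 0`. -/
def linInv (a b : ℂ) : PowerSeries ℂ :=
  PowerSeries.X * (PowerSeries.C a + PowerSeries.C b * PowerSeries.X)⁻¹

/-- `f(a u + b)` as a series in `u⁻¹`, for `a ≠ 0`: the sum over `r` of `f_r (a u + b)^{-r}`. The
series `(a u + b)^{-r}` starts with `u^{-r}`, so only `r ≤ m` contribute to `u^{-m}`. -/
def atLin {A : Type*} [Ring A] [Algebra ℂ A] (a b : ℂ) (f : PowerSeries A) : PowerSeries A :=
  PowerSeries.mk fun m => ∑ r ∈ Finset.range (m + 1),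
    PowerSeries.coeff m (linInv a b ^ r) • PowerSeries.coeff r f

/-- A series with complex coefficients, regarded as a series with coefficients in `A`. -/
def scalarSeries (A : Type*) [Ring A] [Algebra ℂ A] : PowerSeries ℂ →+* PowerSeries A :=
  PowerSeries.map (algebraMap ℂ A)

/-! ### The algebra `A[[u⁻¹]] ⊗ (End ℂ^N)^{⊗m}`

It is realized as the algebra of matrices over `A[[u⁻¹]]` whose rows and columns are indexed by
the standard basis `e_{i_1} ⊗ ⋯ ⊗ e_{i_m}` of `(ℂ^N)^{⊗m}`, i.e. by functions `Fin m → Idx N`.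
The copies of `End ℂ^N` are numbered from `0`. -/

/-- `M_a`: the matrix `M` acting in the `a`-th copy. -/
def onCopy {N m : ℕ} {B : Type*} [Zero B] (a : Fin m) (M : Matrix (Idx N) (Idx N) B) :
    Matrix (Fin m → Idx N) (Fin m → Idx N) B :=
  Matrix.of fun x y => if ∀ d, d ≠ a → x d = y d then M (x a) (y a) else 0

/-- `C_{ab}`: the element `C` of `End ℂ^N ⊗ End ℂ^N` acting in the `a`-th and `b`-th copies. -/
def onCopies {N m : ℕ} {B : Type*} [Zero B] (a b : Fin m)
    (C : Matrix (Idx N × Idx N) (Idx N × Idx N) B) :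
    Matrix (Fin m → Idx N) (Fin m → Idx N) B :=
  Matrix.of fun x y =>
    if ∀ d, d ≠ a → d ≠ b → x d = y d then C (x a, x b) (y a, y b) else 0

/-- `Q = ∑_{i,j} (e_{ij})^t ⊗ e_{ji}`. -/
def Qmat (c : Kind) (N : ℕ) : Matrix (Idx N × Idx N) (Idx N × Idx N) ℂ :=
  ∑ i : Idx N, ∑ j : Idx N,
    Matrix.kronecker (twT c (Matrix.single i j (1 : ℂ))) (Matrix.single j i (1 : ℂ))

/-- The antisymmetrizer
`A_m (e_{i_1} ⊗ ⋯ ⊗ e_{i_m}) = ∑_σ sgn σ · e_{i_{σ(1)}} ⊗ ⋯ ⊗ e_{i_{σ(m)}}`. -/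
def antisym (N m : ℕ) (B : Type*) [Ring B] : Matrix (Fin m → Idx N) (Fin m → Idx N) B :=
  Matrix.of fun x y => ∑ σ : Equiv.Perm (Fin m),
    if x = y ∘ σ then ((Equiv.Perm.sign σ : ℤ) : B) else 0

section Determinants

variable {N : ℕ} {A : Type*} [Ring A] [Algebra ℂ A]

/-- `M_a(u_a)` with `u_a = u - a + 1`; since copies are numbered from `0`, this is `u - a`. -/
def shifted {m : ℕ} (M : Matrix (Idx N) (Idx N) (PowerSeries A)) (a : Fin m) :
    Matrix (Fin m → Idx N) (Fin m → Idx N) (PowerSeries A) :=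
  onCopy a (M.map (atLin 1 (-((a : ℕ) : ℂ))))

/-- `R^t_{ab} = R^t_{ba} = R^t_{ab}(-u_a - u_b)` for `a < b`, where `R^t(u) = 1 - Q u⁻¹` and
`-u_a - u_b = -2u + a + b`, the copies being numbered from `0`. -/
def Rt (c : Kind) {m : ℕ} (a b : Fin m) :
    Matrix (Fin m → Idx N) (Fin m → Idx N) (PowerSeries A) :=
  1 - onCopies (min a b) (max a b) ((Qmat c N).map fun z =>
    scalarSeries A (PowerSeries.C z * linInv (-2) (((a : ℕ) : ℂ) + ((b : ℕ) : ℂ))))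

/-- `⟨S_{p_1}, …, S_{p_m}⟩ = S_{p_1} (R^t_{p_1p_2} ⋯ R^t_{p_1p_m}) S_{p_2}
(R^t_{p_2p_3} ⋯ R^t_{p_2p_m}) ⋯ S_{p_m}`, where `S_a = S_a(u_a)`. -/
def bracket (c : Kind) {m : ℕ} (S : Matrix (Idx N) (Idx N) (PowerSeries A)) :
    List (Fin m) → Matrix (Fin m → Idx N) (Fin m → Idx N) (PowerSeries A)
  | [] => 1
  | p :: ps => shifted S p * (ps.map (Rt c p)).prod * bracket c S ps

/-- `q` is the quantum determinant of `T(u)`: `q = 1 + d_1 u⁻¹ + ⋯` and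
`A_N T_1(u) ⋯ T_N(u - N + 1) = T_N(u - N + 1) ⋯ T_1(u) A_N = A_N q`. -/
def IsQdet (T : Matrix (Idx N) (Idx N) (PowerSeries A)) (q : PowerSeries A) : Prop :=
  PowerSeries.constantCoeff q = 1 ∧
  antisym N N (PowerSeries A) * ((List.finRange N).map (shifted T)).prod
      = antisym N N (PowerSeries A) * Matrix.scalar (Fin N → Idx N) q ∧
  ((List.finRange N).reverse.map (shifted T)).prod * antisym N N (PowerSeries A)
      = antisym N N (PowerSeries A) * Matrix.scalar (Fin N → Idx N) q

/-- `d` is the Sklyanin determinant of `S(u)`: `d = 1 + c_1 u⁻¹ + ⋯` and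
`A_N ⟨S_1, …, S_N⟩ = ⟨S_N, …, S_1⟩ A_N = A_N d`. -/
def IsSdet (c : Kind) (S : Matrix (Idx N) (Idx N) (PowerSeries A)) (d : PowerSeries A) : Prop :=
  PowerSeries.constantCoeff d = 1 ∧
  antisym N N (PowerSeries A) * bracket c S (List.finRange N)
      = antisym N N (PowerSeries A) * Matrix.scalar (Fin N → Idx N) d ∧
  bracket c S (List.finRange N).reverse * antisym N N (PowerSeries A)
      = antisym N N (PowerSeries A) * Matrix.scalar (Fin N → Idx N) d

end Determinants

/-- `φ` is the homomorphism `S(u) ↦ T(u) T^t(-u)` from the twisted Yangian to the Yangian. -/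
def IsEmb {c : Kind} {N : ℕ} (φ : TwistedYangian c N →ₐ[ℂ] Yangian N) : Prop :=
  (Smat c N).map (PowerSeries.map (φ : TwistedYangian c N →+* Yangian N))
    = Tmat N * twT c ((Tmat N).map (atLin (-1) 0))

/-- `γ_n(u)` as a series in `u⁻¹`, with `n = ⌊N/2⌋`: it is `1` in the orthogonal case and
`(2u + 1) / (2u - 2n + 1) = (2 + u⁻¹) / (2 + (1 - 2n) u⁻¹)` in the symplectic case. -/
def γ (N : ℕ) : Kind → PowerSeries ℂ
  | .orthogonal => 1
  | .symplectic => (PowerSeries.C 2 + PowerSeries.X) *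
      (PowerSeries.C 2 + PowerSeries.C (1 - 2 * ((N / 2 : ℕ) : ℂ)) * PowerSeries.X)⁻¹

end TwYang

end

/-!
Every matrix `T(u)` over a series ring satisfying the RTT relation, and every `S(u)` satisfying the
quaternary relation, has neighbouring factors exchanged by `R(u_a - u_b)`. At `u_a - u_b = 1` this
is `1 - P`, so `A_m` times the ordered product is antisymmetric in adjacent copies, hence in all of
them; since the antisymmetric tensors are a line when `m = N`, it is `A_N` times a scalar series.
Moving from the ordered to the reversed product through intertwiners that act on `A_N` by nonzero
scalars shows that both give the same series.

For `S(u) = T(u) T^t(-u)`, pulling each `T^t_a` to the right past the `R^t_{ab}` and `T_b` rewrites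
`⟨S_1, …, S_N⟩` as `T_1 ⋯ T_N · (∏ R^t_{ab}) · T^t_1 ⋯ T^t_N`. The antisymmetrizer turns the three
parts into `qdet T(u)`, a scalar `γ_n(u)` and, by transposition and reversal of the copies,
`qdet T(-u + N - 1)`. In the orthogonal case `A_N Q = 0`, so `γ_n = 1`. In the symplectic case
`A_N ∏ R^t_{ab}` is computed by adding two copies at a time and comparing entries at a tensor whose
remaining indices form pairs `{i, -i}`.

Relations between series in two variables are passed to and from one-variable series by the
specializations `v = u / a`: a coefficient of fixed total degree is a polynomial in `a`, hence is
determined by infinitely many values of `a`.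
-/

noncomputable section

namespace TwYang

open Finset Matrix PowerSeries

/-! ### Substitution in series with noncommuting coefficients -/

/-- The structure of a `K⟦X⟧`-algebra on `A⟦X⟧`, which Mathlib only provides for commutative `A`.
It is what lets one divide by series with central coefficients. -/
abbrev seriesAlgebra (K A : Type*) [CommRing K] [Ring A] [Algebra K A] : Algebra K⟦X⟧ A⟦X⟧ :=
  (PowerSeries.map (algebraMap K A)).toAlgebra' fun c f => by
    ext m
    rw [coeff_mul, coeff_mul, ← Nat.sum_antidiagonal_swap]
    refine sum_congr rfl fun x _ => ?_
    simp only [coeff_map, Prod.fst_swap, Prod.snd_swap]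
    exact Algebra.commutes _ _

attribute [local instance] seriesAlgebra

section Substitution

variable {K A : Type*} [CommRing K] [Ring A] [Algebra K A]

theorem series_smul_def (c : K⟦X⟧) (f : A⟦X⟧) : c • f = PowerSeries.map (algebraMap K A) c * f :=
  rfl

theorem X_series_smul (f : A⟦X⟧) : (X : K⟦X⟧) • f = X * f := by
  rw [series_smul_def, map_X]

theorem C_series_smul (z : K) (f : A⟦X⟧) : (PowerSeries.C z : K⟦X⟧) • f = z • f := by
  ext m
  rw [series_smul_def, map_C, coeff_C_mul, coeff_smul, Algebra.smul_def]

/-- The series `f(p)`, for a series `p` without constant term: then only the powers `p ^ r` with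
`r ≤ m` contribute to the `m`-th coefficient. -/
def evalAt (p : K⟦X⟧) : A⟦X⟧ →ₗ[K] A⟦X⟧ where
  toFun f := PowerSeries.mk fun m => ∑ r ∈ range (m + 1), coeff m (p ^ r) • coeff r f
  map_add' f g := by ext m; simp [smul_add, sum_add_distrib]
  map_smul' z f := by
    ext m
    simp only [coeff_mk, coeff_smul, RingHom.id_apply, smul_sum]
    exact sum_congr rfl fun r _ => smul_comm _ _ _

/-- The series `∑ F_{rs} p^r q^s`, for series `p` and `q` without constant term. -/
def biSeries (p q : K⟦X⟧) : (ℕ → ℕ → A) →ₗ[K] A⟦X⟧ where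
  toFun F := PowerSeries.mk fun m =>
    ∑ r ∈ range (m + 1), ∑ s ∈ range (m + 1), coeff m (p ^ r * q ^ s) • F r s
  map_add' F G := by ext m; simp [smul_add, sum_add_distrib]
  map_smul' z F := by
    ext m
    simp only [coeff_mk, coeff_smul, Pi.smul_apply, RingHom.id_apply, smul_sum]
    exact sum_congr rfl fun r _ => sum_congr rfl fun s _ => smul_comm _ _ _

theorem coeff_evalAt_eq_sum (p : K⟦X⟧) (f : A⟦X⟧) (m : ℕ) :
    coeff m (evalAt p f) = ∑ r ∈ range (m + 1), coeff m (p ^ r) • coeff r f := by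
  simp only [evalAt, LinearMap.coe_mk, AddHom.coe_mk, coeff_mk]

theorem coeff_biSeries (p q : K⟦X⟧) (F : ℕ → ℕ → A) (m : ℕ) :
    coeff m (biSeries p q F)
      = ∑ r ∈ range (m + 1), ∑ s ∈ range (m + 1), coeff m (p ^ r * q ^ s) • F r s := by
  simp only [biSeries, LinearMap.coe_mk, AddHom.coe_mk, coeff_mk]

theorem coeff_pow_eq_zero {p : K⟦X⟧} (hp : constantCoeff p = 0) {r m : ℕ} (h : m < r) :
    coeff m (p ^ r) = 0 :=
  X_pow_dvd_iff.1 (pow_dvd_pow_of_dvd (X_dvd_iff.2 hp) r) m h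

theorem coeff_evalAt {p : K⟦X⟧} (hp : constantCoeff p = 0) (f : A⟦X⟧) {m k : ℕ} (hk : m < k) :
    coeff m (evalAt p f) = ∑ r ∈ range k, coeff m (p ^ r) • coeff r f := by
  rw [coeff_evalAt_eq_sum]
  refine sum_subset (range_mono hk) fun r _ hr => ?_
  rw [coeff_pow_eq_zero hp (by simpa using hr), zero_smul]

theorem coeff_evalAt_mul_evalAt {p q : K⟦X⟧} (hp : constantCoeff p = 0)
    (hq : constantCoeff q = 0) (f g : A⟦X⟧) (m : ℕ) :
    coeff m (evalAt p f * evalAt q g) = ∑ r ∈ range (m + 1), ∑ s ∈ range (m + 1),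
      coeff m (p ^ r * q ^ s) • (coeff r f * coeff s g) := by
  have expand : ∀ x ∈ antidiagonal m, coeff x.1 (evalAt p f) * coeff x.2 (evalAt q g)
      = ∑ r ∈ range (m + 1), ∑ s ∈ range (m + 1),
        (coeff x.1 (p ^ r) * coeff x.2 (q ^ s)) • (coeff r f * coeff s g) := fun x hx => by
    rw [coeff_evalAt hp f (Nat.lt_succ_of_le (HasAntidiagonal.antidiagonal.fst_le hx)),
      coeff_evalAt hq g (Nat.lt_succ_of_le (HasAntidiagonal.antidiagonal.snd_le hx)), sum_mul_sum]
    simp_rw [smul_mul_smul_comm]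
  rw [coeff_mul, sum_congr rfl expand, sum_comm]
  refine sum_congr rfl fun r _ => ?_
  rw [sum_comm]
  refine sum_congr rfl fun s _ => ?_
  rw [← sum_smul, ← coeff_mul]

theorem sum_range_antidiagonal {M : Type*} [AddCommMonoid M] (n : ℕ) (F : ℕ × ℕ → M) :
    ∑ k ∈ range n, ∑ x ∈ antidiagonal k, F x
      = ∑ x ∈ range n ×ˢ range n with x.1 + x.2 < n, F x := by
  refine Eq.trans ?_ (sum_fiberwise_of_maps_to (t := range n) (g := fun x => x.1 + x.2)
    (fun x hx => mem_range.2 (mem_filter.1 hx).2) F)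
  refine sum_congr rfl fun k hk => sum_congr ?_ fun _ _ => rfl
  ext x
  simp only [HasAntidiagonal.mem_antidiagonal, mem_filter, mem_product, mem_range] at hk ⊢
  omega

theorem evalAt_mul {p : K⟦X⟧} (hp : constantCoeff p = 0) (f g : A⟦X⟧) :
    evalAt p (f * g) = evalAt p f * evalAt p g := by
  ext m
  calc coeff m (evalAt p (f * g))
      = ∑ k ∈ range (m + 1), ∑ x ∈ antidiagonal k,
          coeff m (p ^ (x.1 + x.2)) • (coeff x.1 f * coeff x.2 g) := by
        rw [coeff_evalAt hp _ m.lt_succ_self]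
        refine sum_congr rfl fun k _ => ?_
        rw [coeff_mul, smul_sum]
        exact sum_congr rfl fun x hx => by rw [HasAntidiagonal.mem_antidiagonal.1 hx]
    _ = ∑ x ∈ range (m + 1) ×ˢ range (m + 1) with x.1 + x.2 < m + 1,
          coeff m (p ^ (x.1 + x.2)) • (coeff x.1 f * coeff x.2 g) :=
        sum_range_antidiagonal (m + 1)
          fun x => coeff m (p ^ (x.1 + x.2)) • (coeff x.1 f * coeff x.2 g)
    _ = ∑ x ∈ range (m + 1) ×ˢ range (m + 1),
          coeff m (p ^ (x.1 + x.2)) • (coeff x.1 f * coeff x.2 g) := by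
        refine sum_filter_of_ne fun x _ hx => ?_
        by_contra hlt
        exact hx (by rw [coeff_pow_eq_zero hp (by omega), zero_smul])
    _ = coeff m (evalAt p f * evalAt p g) := by
        rw [coeff_evalAt_mul_evalAt hp hp, sum_product]
        simp_rw [pow_add]

theorem evalAt_C (p : K⟦X⟧) (z : A) : evalAt p (PowerSeries.C z) = PowerSeries.C z := by
  ext m
  rw [coeff_evalAt_eq_sum, sum_eq_single 0 (fun r _ hr => ?_) (by simp)]
  rotate_left
  · simp [coeff_C, hr]
  · by_cases h : m = 0 <;> simp [coeff_C, coeff_one, h]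

theorem evalAt_X {p : K⟦X⟧} (hp : constantCoeff p = 0) :
    evalAt p (X : A⟦X⟧) = PowerSeries.map (algebraMap K A) p := by
  ext m
  rw [coeff_evalAt hp _ (show m < m + 2 by omega), sum_eq_single 1]
  · simp [Algebra.smul_def]
  · intro r _ hr; simp [coeff_X, hr]
  · intro h; simp at h

/-- Substitution of a series without constant term, as an algebra homomorphism. -/
def evalHom (A : Type*) [Ring A] [Algebra K A] {p : K⟦X⟧} (hp : constantCoeff p = 0) :
    A⟦X⟧ →ₐ[K] A⟦X⟧ :=
  AlgHom.ofLinearMap (evalAt p) (by simpa using evalAt_C p (1 : A)) (evalAt_mul hp)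

theorem evalAt_X_mul {p : K⟦X⟧} (hp : constantCoeff p = 0) (f : A⟦X⟧) :
    evalAt p (X * f) = p • evalAt p f := by
  rw [evalAt_mul hp, evalAt_X hp, series_smul_def]

theorem evalAt_X_pow_mul {p : K⟦X⟧} (hp : constantCoeff p = 0) (n : ℕ) (f : A⟦X⟧) :
    evalAt p (X ^ n * f) = p ^ n • evalAt p f := by
  induction n with
  | zero => simp
  | succ n ih => rw [pow_succ', mul_assoc, evalAt_X_mul hp, ih, smul_smul, pow_succ']

theorem constantCoeff_evalAt (p : K⟦X⟧) (f : A⟦X⟧) :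
    constantCoeff (evalAt p f) = constantCoeff f := by
  rw [← coeff_zero_eq_constantCoeff_apply, coeff_evalAt_eq_sum]
  simp

theorem evalAt_evalAt {p q : K⟦X⟧} (hp : constantCoeff p = 0) (hq : constantCoeff q = 0)
    (f : A⟦X⟧) : evalAt p (evalAt q f) = evalAt (evalAt p q) f := by
  have hpq : constantCoeff (evalAt p q) = 0 := by rw [constantCoeff_evalAt, hq]
  have evalAt_pow (s : ℕ) : evalAt p (q ^ s) = evalAt p q ^ s := map_pow (evalHom K hp) q s
  ext m
  calc coeff m (evalAt p (evalAt q f))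
      = ∑ r ∈ range (m + 1), ∑ s ∈ range (m + 1),
          (coeff m (p ^ r) * coeff r (q ^ s)) • coeff s f := by
        rw [coeff_evalAt hp _ m.lt_succ_self]
        refine sum_congr rfl fun r hr => ?_
        rw [coeff_evalAt hq _ (mem_range.1 hr), smul_sum]
        simp_rw [smul_smul]
    _ = ∑ s ∈ range (m + 1), coeff m (evalAt p (q ^ s)) • coeff s f := by
        rw [sum_comm]
        simp_rw [coeff_evalAt hp _ m.lt_succ_self, smul_eq_mul, sum_smul]
    _ = coeff m (evalAt (evalAt p q) f) := by
        simp_rw [coeff_evalAt hpq _ m.lt_succ_self, evalAt_pow]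

theorem evalAt_X_left (f : A⟦X⟧) : evalAt (X : K⟦X⟧) f = f := by
  ext m
  rw [coeff_evalAt_eq_sum, sum_eq_single m (fun r _ hr => by simp [coeff_X_pow, hr.symm]) (by simp)]
  simp

theorem map_evalAt {A' : Type*} [Ring A'] [Algebra K A'] (φ : A →ₐ[K] A') (p : K⟦X⟧) (f : A⟦X⟧) :
    PowerSeries.map (φ : A →+* A') (evalAt p f) = evalAt p (PowerSeries.map (φ : A →+* A') f) := by
  ext m
  simp [coeff_evalAt_eq_sum, map_sum]

/-- The coefficients of `f(u) g(v)` as a double series in `u⁻¹` and `v⁻¹`. -/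
def mulUV (f g : A⟦X⟧) : ℕ → ℕ → A := fun r s => coeff r f * coeff s g

/-- The coefficients of `f(v) g(u)` as a double series in `u⁻¹` and `v⁻¹`. -/
def mulVU (f g : A⟦X⟧) : ℕ → ℕ → A := fun r s => coeff s f * coeff r g

theorem biSeries_mulUV {p q : K⟦X⟧} (hp : constantCoeff p = 0) (hq : constantCoeff q = 0)
    (f g : A⟦X⟧) : biSeries p q (mulUV f g) = evalAt p f * evalAt q g := by
  ext m
  rw [coeff_biSeries, coeff_evalAt_mul_evalAt hp hq]
  rfl

theorem biSeries_mulVU {p q : K⟦X⟧} (hp : constantCoeff p = 0) (hq : constantCoeff q = 0)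
    (f g : A⟦X⟧) : biSeries p q (mulVU f g) = evalAt q f * evalAt p g := by
  ext m
  rw [coeff_biSeries, coeff_evalAt_mul_evalAt hq hp, sum_comm]
  simp_rw [mulVU, mul_comm]

end Substitution

section Cancellation

variable {K A : Type*} [Field K] [Ring A] [Algebra K A]

theorem X_pow_series_smul_injective (n : ℕ) :
    Function.Injective fun f : A⟦X⟧ => (X ^ n : K⟦X⟧) • f := by
  have X_injective : Function.Injective fun f : A⟦X⟧ => (X : K⟦X⟧) • f := fun f g h => by
    ext k
    simpa only [X_series_smul, coeff_succ_X_mul] using congrArg (coeff (k + 1)) h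
  induction n with
  | zero => exact fun f g h => by simpa using h
  | succ n ih => exact fun f g h => ih (X_injective (by simpa only [pow_succ', mul_smul] using h))

theorem series_smul_cancel {c : K⟦X⟧} (hc : c ≠ 0) {f g : A⟦X⟧} (h : c • f = c • g) : f = g := by
  rw [← X_pow_order_mul_divXPowOrder (f := c), ← Unit_of_divided_by_X_pow_order_nonzero hc,
    mul_smul, mul_smul] at h
  have unit_smul := X_pow_series_smul_injective _ h
  have := congrArg ((Unit_of_divided_by_X_pow_order c)⁻¹.1 • ·) unit_smul
  simpa only [smul_smul, Units.inv_mul, one_smul] using this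

theorem coeff_biSeries_X_C_mul_X (a : K) (F : ℕ → ℕ → A) (m : ℕ) :
    coeff m (biSeries X (PowerSeries.C a * X) F) = ∑ s ∈ range (m + 1), a ^ s • F (m - s) s := by
  have monomial (r s : ℕ) : (X : K⟦X⟧) ^ r * (PowerSeries.C a * X) ^ s
      = PowerSeries.C (a ^ s) * X ^ (r + s) := by
    rw [mul_pow, mul_left_comm, ← pow_add, map_pow]
  rw [coeff_biSeries, sum_comm]
  refine sum_congr rfl fun s hs => ?_
  have hs : s ≤ m := Nat.lt_succ_iff.1 (mem_range.1 hs)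
  rw [sum_eq_single (m - s)]
  · rw [monomial, Nat.sub_add_cancel hs, coeff_C_mul, coeff_X_pow_self, mul_one]
  · intro r _ hr
    rw [monomial, coeff_C_mul, coeff_X_pow, if_neg (by omega), mul_zero, zero_smul]
  · intro h
    exact absurd (mem_range.2 (by omega)) h

theorem eq_zero_of_sum_pow_smul_eq_zero {M : Type*} [AddCommGroup M] [Module K M] {t : Set K}
    (ht : t.Infinite) {n : ℕ} {x : ℕ → M} (h : ∀ a ∈ t, ∑ s ∈ range n, a ^ s • x s = 0)
    {s : ℕ} (hs : s < n) : x s = 0 := by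
  rw [← Module.forall_dual_apply_eq_zero_iff K]
  intro f
  set P : Polynomial K := ∑ s ∈ range n, Polynomial.monomial s (f (x s)) with hP
  have isRoot : ∀ a ∈ t, P.IsRoot a := fun a ha => by
    simpa [Polynomial.IsRoot, hP, Polynomial.eval_finsetSum, mul_comm] using congrArg f (h a ha)
  have hP0 : P = 0 := Polynomial.eq_zero_of_infinite_isRoot P (ht.mono isRoot)
  simpa [hP, Polynomial.finsetSum_coeff, Polynomial.coeff_monomial, hs]
    using congrArg (Polynomial.coeff · s) hP0

-- The two variables are separated by the specializations `v = u / a`.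
theorem eq_zero_of_biSeries_eq_zero {t : Set K} (ht : t.Infinite) {F : ℕ → ℕ → A}
    (h : ∀ a ∈ t, biSeries X (PowerSeries.C a * X) F = 0) (r s : ℕ) : F r s = 0 := by
  have hsum : ∀ a ∈ t, ∑ s' ∈ range (r + s + 1), a ^ s' • F (r + s - s') s' = 0 := fun a ha => by
    rw [← coeff_biSeries_X_C_mul_X, h a ha, map_zero]
  simpa using eq_zero_of_sum_pow_smul_eq_zero ht hsum (show s < r + s + 1 by omega)

end Cancellation

section LinearFractions

variable {A : Type*} [Ring A] [Algebra ℂ A]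

theorem atLin_eq_evalAt (a b : ℂ) (f : A⟦X⟧) : atLin a b f = evalAt (linInv a b) f := rfl

theorem constantCoeff_linInv (a b : ℂ) : constantCoeff (linInv a b) = 0 := by
  simp [linInv]

theorem linear_mul_linInv {a : ℂ} (ha : a ≠ 0) (b : ℂ) :
    (PowerSeries.C a + PowerSeries.C b * X) * linInv a b = X := by
  rw [linInv, mul_left_comm, PowerSeries.mul_inv_cancel _ (by simpa using ha), mul_one]

theorem linear_ne_zero {a : ℂ} (ha : a ≠ 0) (b : ℂ) :
    (PowerSeries.C a + PowerSeries.C b * X : ℂ⟦X⟧) ≠ 0 := fun h =>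
  ha (by simpa using congrArg constantCoeff h)

theorem linInv_ne_zero {a : ℂ} (ha : a ≠ 0) (b : ℂ) : linInv a b ≠ 0 := fun h =>
  X_ne_zero ((linear_mul_linInv ha b).symm.trans (by rw [h, mul_zero]))

theorem eq_linInv {a : ℂ} (ha : a ≠ 0) {b : ℂ} {f : ℂ⟦X⟧}
    (h : (PowerSeries.C a + PowerSeries.C b * X) * f = X) : f = linInv a b :=
  mul_left_cancel₀ (linear_ne_zero ha b) (h.trans (linear_mul_linInv ha b).symm)

theorem evalAt_linInv {a b a' b' : ℂ} (ha : a ≠ 0) (ha' : a' ≠ 0) :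
    evalAt (linInv a' b') (linInv a b) = linInv (a * a') (a * b' + b) := by
  have hp := constantCoeff_linInv a' b'
  apply eq_linInv (mul_ne_zero ha ha')
  have outer : (PowerSeries.C a + PowerSeries.C b * linInv a' b')
      * evalAt (linInv a' b') (linInv a b) = linInv a' b' := by
    simpa only [evalAt_mul hp, map_add, evalAt_C, evalAt_X hp, Algebra.algebraMap_self,
      PowerSeries.map_id, RingHom.id_apply, id_eq]
      using congrArg (evalAt (linInv a' b')) (linear_mul_linInv ha b)
  have inner := linear_mul_linInv ha' b'
  simp only [map_mul, map_add]
  linear_combination (PowerSeries.C a' + PowerSeries.C b' * X) * outer + inner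
    - (PowerSeries.C b * evalAt (linInv a' b') (linInv a b)) * inner

theorem atLin_atLin {a b a' b' : ℂ} (ha : a ≠ 0) (ha' : a' ≠ 0) (f : A⟦X⟧) :
    atLin a' b' (atLin a b f) = atLin (a * a') (a * b' + b) f := by
  simp only [atLin_eq_evalAt]
  rw [evalAt_evalAt (constantCoeff_linInv _ _) (constantCoeff_linInv _ _), evalAt_linInv ha ha']

theorem linInv_neg_one_zero : linInv (-1) 0 = -X :=
  (eq_linInv (neg_ne_zero.2 one_ne_zero) (by simp)).symm

theorem neg_linInv_one_neg (b : ℂ) : -linInv 1 (-b) = linInv (-1) b := by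
  apply eq_linInv (by norm_num)
  have := linear_mul_linInv one_ne_zero (-b)
  rw [map_neg] at this ⊢
  linear_combination this

theorem linInv_sub {a a' : ℂ} (ha : a ≠ 0) (ha' : a' ≠ 0) (b b' : ℂ) :
    X * (linInv a b - linInv a' b')
      = (PowerSeries.C (a' - a) + PowerSeries.C (b' - b) * X) * (linInv a b * linInv a' b') := by
  have h := linear_mul_linInv ha b
  have h' := linear_mul_linInv ha' b'
  rw [map_sub, map_sub]
  linear_combination linInv a' b' * h - linInv a b * h'

theorem linInv_add {a a' : ℂ} (ha : a ≠ 0) (ha' : a' ≠ 0) (b b' : ℂ) :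
    X * (linInv a b + linInv a' b')
      = (PowerSeries.C (a' + a) + PowerSeries.C (b' + b) * X) * (linInv a b * linInv a' b') := by
  have h := linear_mul_linInv ha b
  have h' := linear_mul_linInv ha' b'
  rw [map_add, map_add]
  linear_combination -linInv a' b' * h - linInv a b * h'

theorem inv_mul_linInv_sub {a : ℂ} (ha : a ≠ 0) {b b' : ℂ} (hb : b' - b ≠ 0) :
    PowerSeries.C (b' - b)⁻¹ * (linInv a b - linInv a b') = linInv a b * linInv a b' := by
  have h := linInv_sub ha ha b b'
  have C_inv : PowerSeries.C (b' - b)⁻¹ * PowerSeries.C (b' - b) = (1 : ℂ⟦X⟧) := by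
    rw [← map_mul, inv_mul_cancel₀ hb, map_one]
  apply mul_left_cancel₀ (X_ne_zero (R := ℂ))
  rw [sub_self, map_zero] at h
  linear_combination PowerSeries.C (b' - b)⁻¹ * h + X * linInv a b * linInv a b' * C_inv

theorem linInv_neg_two_mul_sub (i j : ℂ) :
    linInv (-2) (i + j) * (linInv 1 (-j) - linInv (-1) i) = linInv (-1) i * linInv 1 (-j) := by
  have h := linInv_sub (a := 1) (a' := -1) one_ne_zero (by norm_num) (-j) i
  have double := linear_mul_linInv (a := -2) (by norm_num) (i + j)
  rw [show (-1 - 1 : ℂ) = -2 by norm_num, sub_neg_eq_add] at h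
  apply mul_left_cancel₀ (X_ne_zero (R := ℂ))
  linear_combination linInv (-2) (i + j) * h + linInv (-1) i * linInv 1 (-j) * double

theorem neg_linInv_neg_two_mul_add (i j : ℂ) :
    -linInv (-2) (i + j) * (linInv 1 (-i) + linInv 1 (-j)) = linInv 1 (-i) * linInv 1 (-j) := by
  have h := linInv_add (a := 1) (a' := 1) one_ne_zero one_ne_zero (-i) (-j)
  have double := linear_mul_linInv (a := -2) (by norm_num) (i + j)
  have leading : PowerSeries.C (1 + 1 : ℂ) = -PowerSeries.C (-2) := by rw [← map_neg]; norm_num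
  have constant : PowerSeries.C (-j + -i) = -PowerSeries.C (i + j) := by rw [← map_neg]; ring_nf
  rw [leading, constant] at h
  apply mul_left_cancel₀ (X_ne_zero (R := ℂ))
  linear_combination -linInv (-2) (i + j) * h + linInv 1 (-i) * linInv 1 (-j) * double

end LinearFractions

/-! ### The defining relations in terms of series -/

section Relations

variable {N : ℕ} {K B : Type*} [CommRing K] [Ring B] [Algebra K B]

/-- The relation `[T_{ij}, T'_{kl}] = α (T_{kj} T'_{il} - T'_{kj} T_{il})`. For `T = T(u)`,
`T' = T(v)` and `α = (u - v)⁻¹` it is the defining relation of the Yangian. -/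
def RTT (T T' : Matrix (Idx N) (Idx N) B) (α : K) : Prop :=
  ∀ i j k l, T i j * T' k l - T' k l * T i j = α • (T k j * T' i l - T' k j * T i l)

/-- The quaternary relation of the twisted Yangian divided by `u² - v²`, with `S = S(u)`,
`S' = S(v)`, `α = (u - v)⁻¹` and `β = (u + v)⁻¹`. -/
def Reflection (c : Kind) (S S' : Matrix (Idx N) (Idx N) B) (α β : K) : Prop :=
  ∀ i j k l, S i j * S' k l - S' k l * S i j
    = α • (S k j * S' i l - S' k j * S i l)
      - β • (θ c k (-j) • (S i (-k) * S' (-j) l) - θ c i (-l) • (S' k (-i) * S (-l) j))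
      + (α * β) • (θ c i (-j) • (S k (-i) * S' (-j) l - S' k (-i) * S (-j) l))

end Relations

section Coefficients

variable {N : ℕ} {A : Type*} [Ring A]

/-- The coefficient of `u⁻ʳ` for any integer `r`: it is zero for negative `r`. -/
def coeffZ (f : A⟦X⟧) (r : ℤ) : A := if r < 0 then 0 else coeff r.toNat f

theorem coeffZ_of_neg (f : A⟦X⟧) {r : ℤ} (hr : r < 0) : coeffZ f r = 0 := if_pos hr

theorem coeffZ_natCast (f : A⟦X⟧) (r : ℕ) : coeffZ f r = coeff r f := by
  simp [coeffZ]

theorem coeff_X_pow_mul_eq_coeffZ (f : A⟦X⟧) (a r : ℕ) :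
    coeff r (X ^ a * f) = coeffZ f ((r : ℤ) - a) := by
  rw [coeff_X_pow_mul']
  split_ifs with h
  · rw [← Nat.cast_sub h, coeffZ_natCast]
  · rw [coeffZ_of_neg f (by omega)]

/-- The coefficients of `u⁻ᵃ v⁻ᵇ (f(u) g(v) - f'(v) g'(u))` as a double series in `u⁻¹` and
`v⁻¹`. -/
def crossCoeff (a b : ℕ) (f g f' g' : A⟦X⟧) : ℕ → ℕ → A :=
  mulUV (X ^ a * f) (X ^ b * g) - mulVU (X ^ b * f') (X ^ a * g')

theorem crossCoeff_apply (a b : ℕ) (f g f' g' : A⟦X⟧) (r s : ℕ) :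
    crossCoeff a b f g f' g' r s
      = coeffZ f ((r : ℤ) - a) * coeffZ g ((s : ℤ) - b)
        - coeffZ f' ((s : ℤ) - b) * coeffZ g' ((r : ℤ) - a) := by
  simp only [crossCoeff, mulUV, mulVU, Pi.sub_apply, coeff_X_pow_mul_eq_coeffZ]

theorem biSeries_crossCoeff {K : Type*} [CommRing K] [Algebra K A] {p q : K⟦X⟧}
    (hp : constantCoeff p = 0) (hq : constantCoeff q = 0) (a b : ℕ) (f g f' g' : A⟦X⟧) :
    biSeries p q (crossCoeff a b f g f' g')
      = (p ^ a * q ^ b) • (evalAt p f * evalAt q g - evalAt q f' * evalAt p g') := by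
  rw [crossCoeff, map_sub, biSeries_mulUV hp hq, biSeries_mulVU hp hq]
  simp only [evalAt_X_pow_mul hp, evalAt_X_pow_mul hq, smul_mul_smul_comm, smul_sub,
    mul_comm (q ^ b)]

/-- The coefficients of the difference of the two sides of
`(u - v) [t_{ij}(u), t_{kl}(v)] = t_{kj}(u) t_{il}(v) - t_{kj}(v) t_{il}(u)`, multiplied by
`u⁻¹ v⁻¹` so that only nonnegative powers of `u⁻¹` and `v⁻¹` occur. -/
def rttDefect (T : Matrix (Idx N) (Idx N) A⟦X⟧) (i j k l : Idx N) : ℕ → ℕ → A :=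
  crossCoeff 0 1 (T i j) (T k l) (T k l) (T i j) - crossCoeff 1 0 (T i j) (T k l) (T k l) (T i j)
    - crossCoeff 1 1 (T k j) (T i l) (T k j) (T i l)

/-- The coefficients of the difference of the two sides of the quaternary relation, multiplied by
`u⁻² v⁻²` so that only nonnegative powers of `u⁻¹` and `v⁻¹` occur. -/
def quatDefect (c : Kind) (S : Matrix (Idx N) (Idx N) A⟦X⟧) (i j k l : Idx N) : ℕ → ℕ → A :=
  crossCoeff 0 2 (S i j) (S k l) (S k l) (S i j) - crossCoeff 2 0 (S i j) (S k l) (S k l) (S i j)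
  - (crossCoeff 1 2 (S k j) (S i l) (S k j) (S i l) + crossCoeff 2 1 (S k j) (S i l) (S k j) (S i l)
    - crossCoeff 1 2 (θ c k (-j) • S i (-k)) (S (-j) l) (θ c i (-l) • S k (-i)) (S (-l) j)
    + crossCoeff 2 1 (θ c k (-j) • S i (-k)) (S (-j) l) (θ c i (-l) • S k (-i)) (S (-l) j)
    + crossCoeff 2 2 (θ c i (-j) • S k (-i)) (S (-j) l) (θ c i (-j) • S k (-i)) (S (-j) l))

/-- The quaternary relation for the series `S i j`, stated coefficient by coefficient as in the
definition of the twisted Yangian. -/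
def QuaternaryCoeffs (c : Kind) (S : Matrix (Idx N) (Idx N) A⟦X⟧) : Prop :=
  ∀ (i j k l : Idx N) (r s : ℤ),
    ⁅coeffZ (S i j) (r + 2), coeffZ (S k l) s⁆ - ⁅coeffZ (S i j) r, coeffZ (S k l) (s + 2)⁆
    = (coeffZ (S k j) (r + 1) * coeffZ (S i l) s - coeffZ (S k j) s * coeffZ (S i l) (r + 1))
      + (coeffZ (S k j) r * coeffZ (S i l) (s + 1) - coeffZ (S k j) (s + 1) * coeffZ (S i l) r)
      - (θ c k (-j) • (coeffZ (S i (-k)) (r + 1) * coeffZ (S (-j) l) s)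
          - θ c i (-l) • (coeffZ (S k (-i)) s * coeffZ (S (-l) j) (r + 1)))
      + (θ c k (-j) • (coeffZ (S i (-k)) r * coeffZ (S (-j) l) (s + 1))
          - θ c i (-l) • (coeffZ (S k (-i)) (s + 1) * coeffZ (S (-l) j) r))
      + θ c i (-j) • (coeffZ (S k (-i)) r * coeffZ (S (-j) l) s
          - coeffZ (S k (-i)) s * coeffZ (S (-j) l) r)

theorem coeffZ_zsmul (z : ℤ) (f : A⟦X⟧) (r : ℤ) : coeffZ (z • f) r = z • coeffZ f r := by
  unfold coeffZ
  split_ifs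
  · rw [smul_zero]
  · exact map_zsmul _ z f

theorem quaternaryCoeffs_iff (c : Kind) (S : Matrix (Idx N) (Idx N) A⟦X⟧) :
    QuaternaryCoeffs c S ↔ ∀ i j k l, quatDefect c S i j k l = 0 := by
  have natCast_sub (m : ℤ) : m - 2 + 2 = m ∧ m - 2 + 1 = m - 1 := by omega
  constructor
  · intro h i j k l
    ext r s
    have hrs := sub_eq_zero.2 (h i j k l ((r : ℤ) - 2) ((s : ℤ) - 2))
    simp only [natCast_sub, Ring.lie_def, smul_sub] at hrs
    simp only [quatDefect, Pi.sub_apply, Pi.add_apply, Pi.zero_apply,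
      crossCoeff_apply, coeffZ_zsmul, smul_mul_assoc, Nat.cast_zero, sub_zero, Nat.cast_one,
      Nat.cast_ofNat]
    exact hrs
  · intro h i j k l r s
    by_cases hr : r + 2 < 0
    · simp [Ring.lie_def, coeffZ_of_neg, hr, show r + 1 < 0 by omega, show r < 0 by omega]
    by_cases hs : s + 2 < 0
    · simp [Ring.lie_def, coeffZ_of_neg, hs, show s + 1 < 0 by omega, show s < 0 by omega]
    obtain ⟨r', hr'⟩ := Int.eq_ofNat_of_zero_le (not_lt.1 hr)
    obtain ⟨s', hs'⟩ := Int.eq_ofNat_of_zero_le (not_lt.1 hs)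
    obtain rfl : r = r' - 2 := by omega
    obtain rfl : s = s' - 2 := by omega
    have hrs := congrFun₂ (h i j k l) r' s'
    simp only [quatDefect, Pi.sub_apply, Pi.add_apply, Pi.zero_apply,
      crossCoeff_apply, coeffZ_zsmul, smul_mul_assoc, Nat.cast_zero, sub_zero, Nat.cast_one,
      Nat.cast_ofNat] at hrs
    rw [← sub_eq_zero]
    simp only [natCast_sub, Ring.lie_def, smul_sub]
    exact hrs

end Coefficients

section ModuleIdentities

variable {R M : Type*} [CommRing R] [AddCommGroup M] [Module R M] {p q α β : R}

theorem smul_rtt_combination (hα : α * (q - p) = p * q) (x y : M) :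
    α • ((p ^ 0 * q ^ 1) • x - (p ^ 1 * q ^ 0) • x - (p ^ 1 * q ^ 1) • y)
      = (p * q) • (x - α • y) := by
  linear_combination (norm := module) hα • x

theorem smul_quat_combination (hα : α * (q - p) = p * q) (hβ : β * (p + q) = p * q)
    (x y z w : M) :
    (α * β) • ((p ^ 0 * q ^ 2) • x - (p ^ 2 * q ^ 0) • x
        - ((p ^ 1 * q ^ 2) • y + (p ^ 2 * q ^ 1) • y - (p ^ 1 * q ^ 2) • z + (p ^ 2 * q ^ 1) • z
          + (p ^ 2 * q ^ 2) • w))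
      = (p * q) ^ 2 • (x - (α • y - β • z + (α * β) • w)) := by
  have commutator : α * β * (q ^ 2 - p ^ 2) = (p * q) ^ 2 := by
    linear_combination (β * (p + q)) * hα + p * q * hβ
  have direct : α * β * (p * q ^ 2 + p ^ 2 * q) = (p * q) ^ 2 * α := by
    linear_combination (α * p * q) * hβ
  have twisted : α * β * (p * q ^ 2 - p ^ 2 * q) = (p * q) ^ 2 * β := by
    linear_combination (β * p * q) * hα
  linear_combination (norm := module) commutator • x - direct • y + twisted • z

end ModuleIdentities

section Specialization

variable {N : ℕ} {K A : Type*} [CommRing K] [Ring A] [Algebra K A]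

theorem smul_biSeries_rttDefect (T : Matrix (Idx N) (Idx N) A⟦X⟧) (i j k l : Idx N)
    {p q α : K⟦X⟧} (hp : constantCoeff p = 0) (hq : constantCoeff q = 0)
    (hα : α * (q - p) = p * q) :
    α • biSeries p q (rttDefect T i j k l) = (p * q) •
      ((evalAt p (T i j) * evalAt q (T k l) - evalAt q (T k l) * evalAt p (T i j))
        - α • (evalAt p (T k j) * evalAt q (T i l) - evalAt q (T k j) * evalAt p (T i l))) := by
  simp only [rttDefect, map_sub, biSeries_crossCoeff hp hq]
  exact smul_rtt_combination hα _ _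

theorem smul_biSeries_quatDefect (c : Kind) (S : Matrix (Idx N) (Idx N) A⟦X⟧) (i j k l : Idx N)
    {p q α β : K⟦X⟧} (hp : constantCoeff p = 0) (hq : constantCoeff q = 0)
    (hα : α * (q - p) = p * q) (hβ : β * (p + q) = p * q) :
    (α * β) • biSeries p q (quatDefect c S i j k l) = (p * q) ^ 2 •
      ((evalAt p (S i j) * evalAt q (S k l) - evalAt q (S k l) * evalAt p (S i j))
        - (α • (evalAt p (S k j) * evalAt q (S i l) - evalAt q (S k j) * evalAt p (S i l))
          - β • (θ c k (-j) • (evalAt p (S i (-k)) * evalAt q (S (-j) l))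
            - θ c i (-l) • (evalAt q (S k (-i)) * evalAt p (S (-l) j)))
          + (α * β) • (θ c i (-j) • (evalAt p (S k (-i)) * evalAt q (S (-j) l)
            - evalAt q (S k (-i)) * evalAt p (S (-j) l))))) := by
  simp only [quatDefect, map_sub, map_add, map_zsmul, biSeries_crossCoeff hp hq, smul_mul_assoc]
  rw [← smul_sub (θ c i (-j))]
  exact smul_quat_combination hα hβ _ _ _ _

end Specialization

section RelationsOfCoefficients

variable {N : ℕ} {K A : Type*} [Field K] [Ring A] [Algebra K A] {p q α β : K⟦X⟧}

theorem rtt_of_rttDefect_eq_zero {T : Matrix (Idx N) (Idx N) A⟦X⟧}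
    (hT : ∀ i j k l, rttDefect T i j k l = 0) (hp : constantCoeff p = 0)
    (hq : constantCoeff q = 0) (hp0 : p ≠ 0) (hq0 : q ≠ 0) (hα : α * (q - p) = p * q) :
    RTT (T.map (evalAt p)) (T.map (evalAt q)) α := by
  intro i j k l
  have h := smul_biSeries_rttDefect T i j k l hp hq hα
  rw [hT, map_zero, smul_zero] at h
  exact sub_eq_zero.1 (series_smul_cancel (mul_ne_zero hp0 hq0) ((smul_zero _).trans h)).symm

theorem reflection_of_quaternaryCoeffs {c : Kind} {S : Matrix (Idx N) (Idx N) A⟦X⟧}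
    (hS : QuaternaryCoeffs c S) (hp : constantCoeff p = 0) (hq : constantCoeff q = 0)
    (hp0 : p ≠ 0) (hq0 : q ≠ 0) (hα : α * (q - p) = p * q) (hβ : β * (p + q) = p * q) :
    Reflection c (S.map (evalAt p)) (S.map (evalAt q)) α β := by
  intro i j k l
  have h := smul_biSeries_quatDefect c S i j k l hp hq hα hβ
  rw [(quaternaryCoeffs_iff c S).1 hS, map_zero, smul_zero] at h
  exact sub_eq_zero.1 (series_smul_cancel (pow_ne_zero 2 (mul_ne_zero hp0 hq0))
    ((smul_zero _).trans h)).symm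

-- The identities for `(u - v)⁻¹` and `(u + v)⁻¹` at `v = u / a`.
theorem C_div_sub_one_mul {a : K} (ha : a ≠ 1) :
    PowerSeries.C (a / (a - 1)) * X * (PowerSeries.C a * X - X) = X * (PowerSeries.C a * X) := by
  have h : PowerSeries.C (a / (a - 1)) * (PowerSeries.C a - 1) = PowerSeries.C a := by
    rw [← map_one PowerSeries.C, ← map_sub, ← map_mul, div_mul_cancel₀ _ (sub_ne_zero.2 ha)]
  linear_combination X ^ 2 * h

theorem C_div_add_one_mul {a : K} (ha : a ≠ -1) :
    PowerSeries.C (a / (a + 1)) * X * (X + PowerSeries.C a * X) = X * (PowerSeries.C a * X) := by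
  have h : PowerSeries.C (a / (a + 1)) * (PowerSeries.C a + 1) = PowerSeries.C a := by
    rw [← map_one PowerSeries.C, ← map_add, ← map_mul,
      div_mul_cancel₀ _ fun h => ha (eq_neg_of_add_eq_zero_left h)]
  linear_combination X ^ 2 * h

theorem quaternaryCoeffs_of_reflection [Infinite K] {c : Kind} {S : Matrix (Idx N) (Idx N) A⟦X⟧}
    (hS : ∀ a : K, a ≠ 0 → a ≠ 1 → a ≠ -1 → Reflection c S
      (S.map (evalAt (PowerSeries.C a * X))) (PowerSeries.C (a / (a - 1)) * X)
      (PowerSeries.C (a / (a + 1)) * X)) : QuaternaryCoeffs c S := by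
  refine (quaternaryCoeffs_iff c S).2 fun i j k l => funext₂ fun r s => ?_
  refine eq_zero_of_biSeries_eq_zero
    (Set.toFinite ({0, 1, -1} : Set K)).infinite_compl (fun a ha => ?_) r s
  simp only [Set.mem_compl_iff, Set.mem_insert_iff, Set.mem_singleton_iff, not_or] at ha
  obtain ⟨ha0, ha1, ha_neg⟩ := ha
  have C_div_mul_X_ne_zero {b : K} (hb : b ≠ 0) : (PowerSeries.C (a / b) * X : K⟦X⟧) ≠ 0 :=
    mul_ne_zero (by simpa using ⟨ha0, hb⟩) X_ne_zero
  have h := smul_biSeries_quatDefect c S i j k l (by simp) (by simp) (C_div_sub_one_mul ha1)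
    (C_div_add_one_mul ha_neg)
  have hrefl := hS a ha0 ha1 ha_neg i j k l
  simp only [Matrix.map_apply] at hrefl
  simp only [evalAt_X_left] at h
  rw [hrefl, sub_self, smul_zero] at h
  exact series_smul_cancel (mul_ne_zero (C_div_mul_X_ne_zero (sub_ne_zero.2 ha1))
    (C_div_mul_X_ne_zero fun h => ha_neg (eq_neg_of_add_eq_zero_left h)))
    (h.trans (smul_zero _).symm)

end RelationsOfCoefficients

section GeneratingSeries

variable {N : ℕ}

theorem coeffZ_Smat (c : Kind) (i j : Idx N) (r : ℤ) :
    coeffZ (Smat c N i j) r = RingQuot.mkAlgHom ℂ (TwistedRel c N) (genZ i j r) := by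
  simp only [coeffZ, Smat, Matrix.of_apply, coeff_mk, genZ]
  split_ifs
  · rw [map_zero]
  · rfl

theorem quaternaryCoeffs_Smat (c : Kind) : QuaternaryCoeffs c (Smat c N) := fun i j k l r s => by
  have h := RingQuot.mkAlgHom_rel ℂ (TwistedRel.quat (c := c) i j k l r s)
  simpa only [map_add, map_sub, map_mul, map_zsmul, Ring.lie_def, ← coeffZ_Smat] using h

theorem coeff_zero_Tmat_commute (i j : Idx N) (x : Yangian N) :
    Commute (coeff 0 (Tmat N i j)) x := by
  simp only [Tmat, Matrix.of_apply, coeff_mk, gen]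
  split_ifs
  · rw [map_one]; exact Commute.one_left x
  · rw [map_zero]; exact Commute.zero_left x

theorem rttDefect_Tmat (i j k l : Idx N) : rttDefect (Tmat N) i j k l = 0 := by
  ext r s
  rcases r with _ | r
  · simpa [rttDefect, crossCoeff, mulUV, mulVU, sub_eq_zero]
      using (coeff_zero_Tmat_commute i j _).eq
  rcases s with _ | s
  · simpa [rttDefect, crossCoeff, mulUV, mulVU, sub_eq_zero]
      using (coeff_zero_Tmat_commute k l _).eq
  have h := RingQuot.mkAlgHom_rel ℂ (YangianRel.rtt i j k l r s)
  simp only [Ring.lie_def, map_sub, map_mul] at h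
  simpa [rttDefect, crossCoeff, mulUV, mulVU, Tmat, coeff_succ_X_mul] using sub_eq_zero.2 h

end GeneratingSeries

/-! ### Operators on tensor copies -/

instance (N : ℕ) : InvolutiveNeg (Idx N) :=
  { (inferInstance : Neg (Idx N)) with neg_neg := fun i => Subtype.ext (neg_neg i.1) }

/-- The signs with `θ_{ij} = ε_i ε_j`. -/
def eps {N : ℕ} (c : Kind) (i : Idx N) : ℤ :=
  match c with
  | .orthogonal => 1
  | .symplectic => i.1.sign

/-- The double sign as an integer. -/
def Kind.sgn : Kind → ℤ
  | .orthogonal => 1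
  | .symplectic => -1

theorem θ_eq {N : ℕ} (c : Kind) (i j : Idx N) : θ c i j = eps c i * eps c j := by
  cases c <;> simp [θ, eps]

theorem eps_neg {N : ℕ} (c : Kind) (i : Idx N) : eps c (-i) = c.sgn * eps c i := by
  cases c
  · rfl
  · change (-i.1).sign = -1 * i.1.sign
    simp

theorem Kind.sgn_mul_self (c : Kind) : c.sgn * c.sgn = 1 := by cases c <;> rfl

theorem eps_mul_self {N : ℕ} (c : Kind) (hc : c = .symplectic → Even N) (i : Idx N) :
    eps c i * eps c i = 1 := by
  cases c
  · rfl
  · have h := i.2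
    simp only [idxSet, Finset.mem_filter] at h
    change i.1.sign * i.1.sign = 1
    rcases lt_or_gt_of_ne (h.2 (hc rfl)) with hi | hi
    · rw [Int.sign_eq_neg_one_of_neg hi]; rfl
    · rw [Int.sign_eq_one_of_pos hi]; rfl

section TwoCopies

variable {N : ℕ} {B : Type*} [Ring B]

/-- `M ⊗ 1`. -/
def fstCopy (M : Matrix (Idx N) (Idx N) B) : Matrix (Idx N × Idx N) (Idx N × Idx N) B :=
  Matrix.of fun x y => if x.2 = y.2 then M x.1 y.1 else 0

/-- `1 ⊗ M`. -/
def sndCopy (M : Matrix (Idx N) (Idx N) B) : Matrix (Idx N × Idx N) (Idx N × Idx N) B :=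
  Matrix.of fun x y => if x.1 = y.1 then M x.2 y.2 else 0

/-- The permutation operator on two copies. -/
def flipMat (N : ℕ) (B : Type*) [Ring B] : Matrix (Idx N × Idx N) (Idx N × Idx N) B :=
  Matrix.of fun x y => if x.swap = y then 1 else 0

/-- The operator `Q` over a general ring. -/
def qMat (c : Kind) (N : ℕ) (B : Type*) [Ring B] :
    Matrix (Idx N × Idx N) (Idx N × Idx N) B :=
  Matrix.of fun x y => if x.1 = -x.2 ∧ y.1 = -y.2 then (eps c x.2 * eps c y.2) • (1 : B) else 0

theorem fstCopy_one : fstCopy (1 : Matrix (Idx N) (Idx N) B) = 1 := by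
  ext x y
  simp only [fstCopy, Matrix.of_apply, Matrix.one_apply, Prod.ext_iff, ← ite_and, and_comm]

theorem sndCopy_one : sndCopy (1 : Matrix (Idx N) (Idx N) B) = 1 := by
  ext x y
  simp only [sndCopy, Matrix.of_apply, Matrix.one_apply, Prod.ext_iff, ite_and]

theorem fstCopy_mul_apply (M : Matrix (Idx N) (Idx N) B)
    (L : Matrix (Idx N × Idx N) (Idx N × Idx N) B) (i k : Idx N) (y : Idx N × Idx N) :
    (fstCopy M * L) (i, k) y = ∑ z, M i z * L (z, k) y := by
  simp [Matrix.mul_apply, fstCopy, Fintype.sum_prod_type]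

theorem sndCopy_mul_apply (M : Matrix (Idx N) (Idx N) B)
    (L : Matrix (Idx N × Idx N) (Idx N × Idx N) B) (i k : Idx N) (y : Idx N × Idx N) :
    (sndCopy M * L) (i, k) y = ∑ z, M k z * L (i, z) y := by
  simp [Matrix.mul_apply, sndCopy, Fintype.sum_prod_type]

theorem flipMat_mul_apply (L : Matrix (Idx N × Idx N) (Idx N × Idx N) B)
    (x y : Idx N × Idx N) : (flipMat N B * L) x y = L x.swap y := by
  simp [Matrix.mul_apply, flipMat]

theorem mul_flipMat_apply (L : Matrix (Idx N × Idx N) (Idx N × Idx N) B)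
    (x y : Idx N × Idx N) : (L * flipMat N B) x y = L x y.swap := by
  have : ∀ z : Idx N × Idx N, (z.swap = y) = (z = y.swap) := fun z =>
    propext ⟨fun h => by rw [← h]; rfl, fun h => by rw [h]; rfl⟩
  simp [Matrix.mul_apply, flipMat, this]

theorem fstCopy_mul_sndCopy_apply (M M' : Matrix (Idx N) (Idx N) B) (i k j l : Idx N) :
    (fstCopy M * sndCopy M') (i, k) (j, l) = M i j * M' k l := by
  simp [fstCopy_mul_apply, sndCopy]

theorem sndCopy_mul_fstCopy_apply (M M' : Matrix (Idx N) (Idx N) B) (i k j l : Idx N) :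
    (sndCopy M' * fstCopy M) (i, k) (j, l) = M' k l * M i j := by
  simp [sndCopy_mul_apply, fstCopy]

theorem qMat_mul_apply (c : Kind) (L : Matrix (Idx N × Idx N) (Idx N × Idx N) B)
    (i k : Idx N) (y : Idx N × Idx N) : (qMat c N B * L) (i, k) y
      = if i = -k then ∑ n, (eps c k * eps c n) • L (-n, n) y else 0 := by
  rw [Matrix.mul_apply, Fintype.sum_prod_type, sum_comm]
  split_ifs with h
  · refine sum_congr rfl fun n _ => ?_
    rw [sum_eq_single (-n)]
    · simp [qMat, h]
    · intro z _ hz; simp [qMat, hz]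
    · simp
  · simp [qMat, h]

theorem fstCopy_mul_qMat_mul_sndCopy_apply (c : Kind) (M M' : Matrix (Idx N) (Idx N) B)
    (i k j l : Idx N) : (fstCopy M * (qMat c N B * sndCopy M')) (i, k) (j, l)
      = (eps c k * eps c (-j)) • (M i (-k) * M' (-j) l) := by
  simp only [fstCopy_mul_apply, qMat_mul_apply, mul_ite, mul_zero, sum_ite_eq', mem_univ, if_true]
  rw [sum_eq_single (-j)]
  · simp only [sndCopy, Matrix.of_apply, neg_neg, if_true, mul_smul_comm]
  · intro n _ hn
    simp only [sndCopy, Matrix.of_apply]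
    rw [if_neg fun h => hn (by rw [← h, neg_neg]), smul_zero]
  · simp

theorem sndCopy_mul_qMat_mul_fstCopy_apply (c : Kind) (M M' : Matrix (Idx N) (Idx N) B)
    (i k j l : Idx N) : (sndCopy M' * (qMat c N B * fstCopy M)) (i, k) (j, l)
      = (eps c (-i) * eps c l) • (M' k (-i) * M (-l) j) := by
  simp only [sndCopy_mul_apply, qMat_mul_apply, mul_ite, mul_zero]
  rw [sum_eq_single (-i)]
  · rw [if_pos (neg_neg i).symm, sum_eq_single l]
    · simp only [fstCopy, Matrix.of_apply, if_true, mul_smul_comm]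
    · intro n _ hn
      simp only [fstCopy, Matrix.of_apply]
      rw [if_neg hn, smul_zero]
    · simp
  · intro z _ hz
    rw [if_neg fun h => hz (by rw [h, neg_neg])]
  · simp

end TwoCopies

section Copies

variable {N m : ℕ} {B : Type*} [Ring B]

theorem onCopy_eq_submatrix {N m : ℕ} {B : Type*} [Zero B] (a : Fin m)
    (M : Matrix (Idx N) (Idx N) B) :
    onCopy a M = (blockDiagonal fun _ => M).submatrix (Equiv.funSplitAt a (Idx N))
      (Equiv.funSplitAt a (Idx N)) := by
  ext x y
  simp only [onCopy, Matrix.of_apply, submatrix_apply, blockDiagonal_apply, Equiv.funSplitAt_apply,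
    funext_iff, Subtype.forall]

theorem onCopy_mul (a : Fin m) (M M' : Matrix (Idx N) (Idx N) B) :
    onCopy a (M * M') = onCopy a M * onCopy a M' := by
  simp only [onCopy_eq_submatrix, submatrix_mul_equiv, ← blockDiagonal_mul]

theorem onCopy_one (a : Fin m) : onCopy a (1 : Matrix (Idx N) (Idx N) B) = 1 := by
  rw [onCopy_eq_submatrix]
  exact (congrArg (fun M => submatrix M _ _) blockDiagonal_one).trans (submatrix_one_equiv _)

/-- A family indexed by the copies, split into its values at `a` and `b` and the remaining ones. -/
def splitAtPair {a b : Fin m} (hab : a ≠ b) (β : Type*) :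
    (Fin m → β) ≃ (β × β) × ({d : Fin m // d ≠ a ∧ d ≠ b} → β) where
  toFun x := ((x a, x b), fun d => x d)
  invFun u d := if ha : d = a then u.1.1 else if hb : d = b then u.1.2 else u.2 ⟨d, ha, hb⟩
  left_inv x := by
    ext d
    dsimp only
    split_ifs with ha hb
    · rw [ha]
    · rw [hb]
    · rfl
  right_inv u := by
    ext d
    · simp
    · simp [hab.symm]
    · simp [d.2.1, d.2.2]

theorem onCopies_eq_submatrix {N m : ℕ} {B : Type*} [Zero B] {a b : Fin m} (hab : a ≠ b)
    (C : Matrix (Idx N × Idx N) (Idx N × Idx N) B) :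
    onCopies a b C = (blockDiagonal fun _ => C).submatrix (splitAtPair hab (Idx N))
      (splitAtPair hab (Idx N)) := by
  ext x y
  simp only [onCopies, Matrix.of_apply, submatrix_apply, blockDiagonal_apply, splitAtPair,
    Equiv.coe_fn_mk, funext_iff, Subtype.forall, and_imp]

theorem onCopies_mul {a b : Fin m} (hab : a ≠ b)
    (C D : Matrix (Idx N × Idx N) (Idx N × Idx N) B) :
    onCopies a b (C * D) = onCopies a b C * onCopies a b D := by
  simp only [onCopies_eq_submatrix hab, submatrix_mul_equiv, ← blockDiagonal_mul]

theorem onCopies_one {a b : Fin m} (hab : a ≠ b) :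
    onCopies a b (1 : Matrix (Idx N × Idx N) (Idx N × Idx N) B) = 1 := by
  rw [onCopies_eq_submatrix hab]
  exact (congrArg (fun M => submatrix M _ _) blockDiagonal_one).trans (submatrix_one_equiv _)

theorem onCopies_add (a b : Fin m) (C D : Matrix (Idx N × Idx N) (Idx N × Idx N) B) :
    onCopies a b (C + D) = onCopies a b C + onCopies a b D := by
  ext x y
  simp only [onCopies, Matrix.of_apply, Matrix.add_apply]
  split_ifs <;> simp

theorem onCopies_sub (a b : Fin m) (C D : Matrix (Idx N × Idx N) (Idx N × Idx N) B) :
    onCopies a b (C - D) = onCopies a b C - onCopies a b D := by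
  ext x y
  simp only [onCopies, Matrix.of_apply, Matrix.sub_apply]
  split_ifs <;> simp

theorem onCopies_smul {K : Type*} [CommRing K] [Algebra K B] (a b : Fin m) (z : K)
    (C : Matrix (Idx N × Idx N) (Idx N × Idx N) B) :
    onCopies a b (z • C) = z • onCopies a b C := by
  ext x y
  simp only [onCopies, Matrix.of_apply, Matrix.smul_apply]
  split_ifs <;> simp

theorem onCopy_eq_fstCopy {a b : Fin m} (hab : a ≠ b) (M : Matrix (Idx N) (Idx N) B) :
    onCopy a M = onCopies a b (fstCopy M) := by
  ext x y
  simp only [onCopy, onCopies, fstCopy, Matrix.of_apply]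
  by_cases h : x b = y b
  · simp only [h, if_true]
    congr 1
    refine propext ⟨fun H d hda _ => H d hda, fun H d hda => ?_⟩
    by_cases hdb : d = b
    · rw [hdb, h]
    · exact H d hda hdb
  · rw [if_neg fun H => h (H b hab.symm)]
    simp [h]

theorem onCopy_eq_sndCopy {a b : Fin m} (hab : a ≠ b) (M : Matrix (Idx N) (Idx N) B) :
    onCopy b M = onCopies a b (sndCopy M) := by
  ext x y
  simp only [onCopy, onCopies, sndCopy, Matrix.of_apply]
  by_cases h : x a = y a
  · simp only [h, if_true]
    congr 1
    refine propext ⟨fun H d _ hdb => H d hdb, fun H d hdb => ?_⟩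
    by_cases hda : d = a
    · rw [hda, h]
    · exact H d hda hdb
  · rw [if_neg fun H => h (H a hab)]
    simp [h]

/-- The operator permuting the tensor factors. -/
def permMat (N : ℕ) {m : ℕ} (B : Type*) [Ring B] (σ : Equiv.Perm (Fin m)) :
    Matrix (Fin m → Idx N) (Fin m → Idx N) B :=
  Matrix.of fun x y => if x = y ∘ σ then 1 else 0

theorem permMat_mul_apply (σ : Equiv.Perm (Fin m))
    (M : Matrix (Fin m → Idx N) (Fin m → Idx N) B) (x y : Fin m → Idx N) :
    (permMat N B σ * M) x y = M (x ∘ σ.symm) y := by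
  have : ∀ z : Fin m → Idx N, (x = z ∘ σ) = (x ∘ σ.symm = z) := fun z =>
    propext ⟨fun h => by rw [h]; ext; simp, fun h => by rw [← h]; ext; simp⟩
  simp [Matrix.mul_apply, permMat, this]

theorem mul_permMat_apply (σ : Equiv.Perm (Fin m))
    (M : Matrix (Fin m → Idx N) (Fin m → Idx N) B) (x y : Fin m → Idx N) :
    (M * permMat N B σ) x y = M x (y ∘ σ) := by
  simp [Matrix.mul_apply, permMat]

theorem permMat_mul_onCopies (σ : Equiv.Perm (Fin m)) (a b : Fin m)
    (C : Matrix (Idx N × Idx N) (Idx N × Idx N) B) :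
    permMat N B σ * onCopies (σ a) (σ b) C = onCopies a b C * permMat N B σ := by
  ext x y
  rw [permMat_mul_apply, mul_permMat_apply]
  simp only [onCopies, Matrix.of_apply, Function.comp_apply, Equiv.symm_apply_apply]
  congr 1
  refine propext ⟨fun h d hda hdb => ?_, fun h d hda hdb => ?_⟩
  · simpa using h (σ d) (by simpa using hda) (by simpa using hdb)
  · simpa using h (σ.symm d) (fun h => hda (by simp [← h])) (fun h => hdb (by simp [← h]))

theorem permMat_mul_onCopy (σ : Equiv.Perm (Fin m)) (a : Fin m)
    (M : Matrix (Idx N) (Idx N) B) :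
    permMat N B σ * onCopy (σ a) M = onCopy a M * permMat N B σ := by
  ext x y
  rw [permMat_mul_apply, mul_permMat_apply]
  simp only [onCopy, Matrix.of_apply, Function.comp_apply, Equiv.symm_apply_apply]
  congr 1
  refine propext ⟨fun h d hda => ?_, fun h d hda => ?_⟩
  · simpa using h (σ d) (by simpa using hda)
  · simpa using h (σ.symm d) (fun h => hda (by simp [← h]))

theorem permMat_swap {a b : Fin m} (hab : a ≠ b) :
    permMat N B (Equiv.swap a b) = onCopies a b (flipMat N B) := by
  ext x y
  simp only [permMat, onCopies, flipMat, Matrix.of_apply, Prod.swap_prod_mk, Prod.mk.injEq]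
  rw [← ite_and]
  congr 1
  refine propext ⟨fun h => ?_, fun h => funext fun d => ?_⟩
  · subst h
    refine ⟨fun d hda hdb => ?_, ?_, ?_⟩ <;> simp [Equiv.swap_apply_of_ne_of_ne, *]
  · by_cases hda : d = a
    · subst hda; simp [h.2.2]
    · by_cases hdb : d = b
      · subst hdb; simp [h.2.1]
      · simp [Equiv.swap_apply_of_ne_of_ne hda hdb, h.1 d hda hdb]

/-- `M` acts only on the copies in `s`. -/
def ActsOn (s : Set (Fin m)) (M : Matrix (Fin m → Idx N) (Fin m → Idx N) B) : Prop :=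
  (∀ x y, (∃ d, d ∉ s ∧ x d ≠ y d) → M x y = 0) ∧
  ∀ x y x' y', (∀ d ∈ s, x d = x' d ∧ y d = y' d) → (∀ d ∉ s, x d = y d ∧ x' d = y' d) →
    M x y = M x' y'

theorem ActsOn.mul_apply {s t : Set (Fin m)}
    {M L : Matrix (Fin m → Idx N) (Fin m → Idx N) B}
    (hM : ActsOn s M) (hL : ActsOn t L) (hst : Disjoint s t) (x y : Fin m → Idx N)
    [DecidablePred (· ∈ s)] :
    (M * L) x y = M x (s.piecewise y x) * L (s.piecewise y x) y := by
  rw [Matrix.mul_apply]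
  refine sum_eq_single _ (fun z _ hz => ?_) (by simp)
  by_contra hne
  apply hz
  funext d
  have hMz : M x z ≠ 0 := fun h => hne (by rw [h, zero_mul])
  have hLz : L z y ≠ 0 := fun h => hne (by rw [h, mul_zero])
  by_cases hd : d ∈ s
  · rw [Set.piecewise_eq_of_mem _ _ _ hd]
    by_contra h
    exact hLz (hL.1 _ _ ⟨d, Set.disjoint_left.1 hst hd, h⟩)
  · rw [Set.piecewise_eq_of_notMem _ _ _ hd]
    by_contra h
    exact hMz (hM.1 _ _ ⟨d, hd, Ne.symm h⟩)

theorem ActsOn.commute {s t : Set (Fin m)} {M L : Matrix (Fin m → Idx N) (Fin m → Idx N) B}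
    (hM : ActsOn s M) (hL : ActsOn t L) (hst : Disjoint s t)
    (h : ∀ x y x' y', Commute (M x y) (L x' y')) : Commute M L := by
  classical
  ext x y
  rw [hM.mul_apply hL hst, hL.mul_apply hM hst.symm, (h _ _ _ _).eq]
  by_cases hxy : ∀ d, d ∉ s → d ∉ t → x d = y d
  · have hMxy : M x (s.piecewise y x) = M (t.piecewise y x) y := by
      apply hM.2
      · intro d hd
        simp [hd, Set.disjoint_left.1 hst hd]
      · intro d hds
        by_cases hdt : d ∈ t
        · simp [hds, hdt]
        · simp [hds, hdt, hxy d hds hdt]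
    have hLxy : L (s.piecewise y x) y = L x (t.piecewise y x) := by
      apply hL.2
      · intro d hd
        simp [hd, Set.disjoint_right.1 hst hd]
      · intro d hdt
        by_cases hds : d ∈ s
        · simp [hdt, hds]
        · simp [hdt, hds, hxy d hds hdt]
    rw [hMxy, hLxy]
  · push Not at hxy
    obtain ⟨d, hds, hdt, hne⟩ := hxy
    rw [hL.1 (s.piecewise y x) y ⟨d, hdt, by simpa [hds] using hne⟩,
      hM.1 (t.piecewise y x) y ⟨d, hds, by simpa [hdt] using hne⟩, zero_mul, mul_zero]

theorem actsOn_onCopy (a : Fin m) (M : Matrix (Idx N) (Idx N) B) :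
    ActsOn {a} (onCopy a M) := by
  constructor
  · rintro x y ⟨d, hda, hxy⟩
    simp only [onCopy, Matrix.of_apply]
    exact if_neg fun h => hxy (h d hda)
  · intro x y x' y' hon hoff
    have hx : ∀ d, d ≠ a → x d = y d := fun d hd => (hoff d hd).1
    have hx' : ∀ d, d ≠ a → x' d = y' d := fun d hd => (hoff d hd).2
    simp only [onCopy, Matrix.of_apply]
    rw [if_pos hx, if_pos hx', (hon a rfl).1, (hon a rfl).2]

theorem actsOn_onCopies (a b : Fin m) (C : Matrix (Idx N × Idx N) (Idx N × Idx N) B) :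
    ActsOn {a, b} (onCopies a b C) := by
  constructor
  · rintro x y ⟨d, hd, hxy⟩
    simp only [Set.mem_insert_iff, Set.mem_singleton_iff, not_or] at hd
    simp only [onCopies, Matrix.of_apply]
    exact if_neg fun h => hxy (h d hd.1 hd.2)
  · intro x y x' y' hon hoff
    simp only [Set.mem_insert_iff, Set.mem_singleton_iff, not_or] at hoff
    have ha := hon a (by simp)
    have hb := hon b (by simp)
    simp only [onCopies, Matrix.of_apply]
    rw [if_pos fun d hda hdb => (hoff d ⟨hda, hdb⟩).1,
      if_pos fun d hda hdb => (hoff d ⟨hda, hdb⟩).2, ha.1, ha.2, hb.1, hb.2]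

end Copies

/-! ### Quadratic relations on copies -/

theorem yang_baxter_of_relations {K R : Type*} [CommRing K] [Ring R] [Algebra K R] {P Q₁ Q₂ : R}
    (hP₁ : P * Q₁ = Q₂ * P) (hP₂ : P * Q₂ = Q₁ * P) (hQ₁₂ : Q₁ * Q₂ = Q₁ * P)
    (hQ₂₁ : Q₂ * Q₁ = Q₂ * P) {α ρ₁ ρ₂ : K} (h : ρ₁ * ρ₂ = α * (ρ₁ - ρ₂)) :
    (1 - α • P) * ((1 - ρ₁ • Q₁) * (1 - ρ₂ • Q₂))
      = (1 - ρ₂ • Q₂) * (1 - ρ₁ • Q₁) * (1 - α • P) := by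
  have hPQQ : P * (Q₁ * Q₂) = Q₂ * Q₁ * P := by rw [← mul_assoc, hP₁, mul_assoc, hP₂, mul_assoc]
  have expand_left : (1 - α • P) * ((1 - ρ₁ • Q₁) * (1 - ρ₂ • Q₂))
      = 1 - ρ₁ • Q₁ - ρ₂ • Q₂ + (ρ₁ * ρ₂) • (Q₁ * Q₂) - α • P + (α * ρ₁) • (P * Q₁)
        + (α * ρ₂) • (P * Q₂) - (α * (ρ₁ * ρ₂)) • (P * (Q₁ * Q₂)) := by
    simp only [sub_mul, mul_sub, one_mul, mul_one, smul_mul_assoc, mul_smul_comm, smul_smul,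
      smul_sub]
    module
  have expand_right : (1 - ρ₂ • Q₂) * (1 - ρ₁ • Q₁) * (1 - α • P)
      = 1 - ρ₁ • Q₁ - ρ₂ • Q₂ + (ρ₁ * ρ₂) • (Q₂ * Q₁) - α • P + (α * ρ₁) • (Q₁ * P)
        + (α * ρ₂) • (Q₂ * P) - (α * (ρ₁ * ρ₂)) • (Q₂ * Q₁ * P) := by
    simp only [sub_mul, mul_sub, one_mul, mul_one, smul_mul_assoc, mul_smul_comm, smul_smul,
      smul_sub]
    module
  rw [expand_left, expand_right, hPQQ, hP₁, hP₂, hQ₁₂, hQ₂₁, h]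
  module

section TwoCopies

variable {N : ℕ} {B : Type*} [Ring B]

theorem twT_apply (c : Kind) (M : Matrix (Idx N) (Idx N) B) (i j : Idx N) :
    twT c M i j = (eps c (-j) * eps c (-i)) • M (-j) (-i) := by
  rw [twT, Matrix.of_apply, θ_eq]

theorem snd_eq_neg_fst_iff {N : ℕ} {x : Idx N × Idx N} : x.2 = -x.1 ↔ x.1 = -x.2 :=
  eq_comm.trans neg_eq_iff_eq_neg

theorem qMat_swap (c : Kind) (x y : Idx N × Idx N) :
    qMat c N B x.swap y.swap = qMat c N B x y := by
  simp only [qMat, Matrix.of_apply, Prod.fst_swap, Prod.snd_swap, snd_eq_neg_fst_iff]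
  split_ifs with h
  · rw [h.1, h.2, eps_neg, eps_neg]
    congr 1
    linear_combination (eps c x.2 * eps c y.2) * c.sgn_mul_self
  · rfl

theorem flipMat_mul_qMat (c : Kind) : flipMat N B * qMat c N B = c.sgn • qMat c N B := by
  ext x y
  rw [flipMat_mul_apply, Matrix.smul_apply]
  simp only [qMat, Matrix.of_apply, Prod.fst_swap, Prod.snd_swap, snd_eq_neg_fst_iff]
  split_ifs with h
  · rw [h.1, eps_neg, smul_smul, mul_assoc]
  · simp

theorem qMat_mul_flipMat (c : Kind) : qMat c N B * flipMat N B = c.sgn • qMat c N B := by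
  ext x y
  have h := congrFun (congrFun (flipMat_mul_qMat (N := N) (B := B) c) x) y
  rw [flipMat_mul_apply] at h
  rw [mul_flipMat_apply, ← qMat_swap, Prod.swap_swap, h]

variable {K : Type*} [CommRing K] [Algebra K B]

theorem rtt_two {T T' : Matrix (Idx N) (Idx N) B} {α : K} (h : RTT T T' α) :
    (1 - α • flipMat N B) * (fstCopy T * sndCopy T')
      = sndCopy T' * fstCopy T * (1 - α • flipMat N B) := by
  simp only [sub_mul, mul_sub, one_mul, mul_one, smul_mul_assoc, mul_smul_comm]
  ext ⟨i, k⟩ ⟨j, l⟩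
  simp only [Matrix.sub_apply, Matrix.smul_apply, flipMat_mul_apply, mul_flipMat_apply,
    Prod.swap_prod_mk, fstCopy_mul_sndCopy_apply, sndCopy_mul_fstCopy_apply]
  have := h i j k l
  rw [smul_sub] at this
  rw [sub_eq_sub_iff_sub_eq_sub, this]

theorem rtt_two_twT (c : Kind) (hc : c = .symplectic → Even N)
    {T T' : Matrix (Idx N) (Idx N) B} {α : K} (h : RTT T T' α) :
    fstCopy (twT c T) * ((1 - α • qMat c N B) * sndCopy T')
      = sndCopy T' * ((1 - α • qMat c N B) * fstCopy (twT c T)) := by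
  simp only [sub_mul, mul_sub, one_mul, smul_mul_assoc, mul_smul_comm]
  ext ⟨i, k⟩ ⟨j, l⟩
  simp only [Matrix.sub_apply, Matrix.smul_apply, fstCopy_mul_sndCopy_apply,
    sndCopy_mul_fstCopy_apply, fstCopy_mul_qMat_mul_sndCopy_apply,
    sndCopy_mul_qMat_mul_fstCopy_apply, twT_apply, neg_neg]
  have hT := h (-j) (-i) k l
  have sign_cancel_k : eps c k * eps c (-j) * (eps c k * eps c (-i)) = eps c (-j) * eps c (-i) := by
    linear_combination (eps c (-j) * eps c (-i)) * eps_mul_self c hc k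
  have sign_cancel_l : eps c (-i) * eps c l * (eps c (-j) * eps c l) = eps c (-j) * eps c (-i) := by
    linear_combination (eps c (-j) * eps c (-i)) * eps_mul_self c hc l
  simp only [smul_mul_assoc, mul_smul_comm, smul_smul, sign_cancel_k, sign_cancel_l]
  rw [sub_eq_sub_iff_sub_eq_sub, ← smul_sub, hT, ← smul_sub, ← smul_sub]
  exact smul_comm _ _ _

theorem rtt_twT (c : Kind) {T T' : Matrix (Idx N) (Idx N) B} {α : K} (h : RTT T T' α) :
    RTT (twT c T') (twT c T) α := by
  intro i j k l
  have hT := h (-l) (-k) (-j) (-i)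
  have sign_comm : eps c (-j) * eps c (-k) * (eps c (-l) * eps c (-i))
      = eps c (-j) * eps c (-i) * (eps c (-l) * eps c (-k)) := by ring
  simp only [twT_apply, smul_mul_assoc, mul_smul_comm, smul_smul]
  rw [mul_comm (eps c (-l) * eps c (-k)), mul_comm (eps c (-l) * eps c (-i)), sign_comm, ← smul_sub,
    ← smul_sub, smul_comm, ← neg_sub, hT, ← smul_neg, neg_sub]

theorem flip_reflection_apply (c : Kind) (S S' : Matrix (Idx N) (Idx N) B) (α β : K)
    (i k j l : Idx N) :
    ((1 - α • flipMat N B) * (fstCopy S * ((1 + β • qMat c N B) * sndCopy S'))) (i, k) (j, l)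
      = S i j * S' k l - α • (S k j * S' i l) + β • (eps c k * eps c (-j)) • (S i (-k) * S' (-j) l)
        - (α * β) • (eps c i * eps c (-j)) • (S k (-i) * S' (-j) l) := by
  have expand : (1 - α • flipMat N B) * (fstCopy S * ((1 + β • qMat c N B) * sndCopy S'))
      = fstCopy S * sndCopy S' - α • (flipMat N B * (fstCopy S * sndCopy S'))
        + β • (fstCopy S * (qMat c N B * sndCopy S'))
        - (α * β) • (flipMat N B * (fstCopy S * (qMat c N B * sndCopy S'))) := by
    simp only [sub_mul, add_mul, mul_add, one_mul, smul_mul_assoc, mul_smul_comm]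
    module
  simp only [expand, Matrix.sub_apply, Matrix.add_apply, Matrix.smul_apply, flipMat_mul_apply,
    Prod.swap_prod_mk, fstCopy_mul_sndCopy_apply, fstCopy_mul_qMat_mul_sndCopy_apply]

theorem reflection_flip_apply (c : Kind) (S S' : Matrix (Idx N) (Idx N) B) (α β : K)
    (i k j l : Idx N) :
    (sndCopy S' * ((1 + β • qMat c N B) * fstCopy S) * (1 - α • flipMat N B)) (i, k) (j, l)
      = S' k l * S i j - α • (S' k j * S i l) + β • (eps c i * eps c (-l)) • (S' k (-i) * S (-l) j)
        - (α * β) • (eps c i * eps c (-j)) • (S' k (-i) * S (-j) l) := by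
  have expand : sndCopy S' * ((1 + β • qMat c N B) * fstCopy S) * (1 - α • flipMat N B)
      = sndCopy S' * fstCopy S - α • (sndCopy S' * fstCopy S * flipMat N B)
        + β • (sndCopy S' * (qMat c N B * fstCopy S))
        - (α * β) • (sndCopy S' * (qMat c N B * fstCopy S) * flipMat N B) := by
    simp only [mul_sub, add_mul, mul_add, one_mul, mul_one, smul_mul_assoc, mul_smul_comm,
      smul_smul, smul_add]
    module
  have sign_comm (i l : Idx N) : eps c (-i) * eps c l = eps c i * eps c (-l) := by
    rw [eps_neg, eps_neg]; ring
  simp only [expand, Matrix.sub_apply, Matrix.add_apply, Matrix.smul_apply, mul_flipMat_apply,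
    Prod.swap_prod_mk, sndCopy_mul_fstCopy_apply, sndCopy_mul_qMat_mul_fstCopy_apply, sign_comm]

theorem reflection_two_iff (c : Kind) {S S' : Matrix (Idx N) (Idx N) B} {α β : K} :
    (1 - α • flipMat N B) * (fstCopy S * ((1 + β • qMat c N B) * sndCopy S'))
      = sndCopy S' * ((1 + β • qMat c N B) * fstCopy S) * (1 - α • flipMat N B)
    ↔ Reflection c S S' α β := by
  simp only [← Matrix.ext_iff, Prod.forall, flip_reflection_apply, reflection_flip_apply,
    Reflection, θ_eq]
  rw [forall_congr' fun i => forall_comm]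
  refine forall₄_congr fun i j k l => ?_
  rw [← sub_eq_zero, ← sub_eq_zero (a := S i j * S' k l - S' k l * S i j)]
  apply Eq.congr _ rfl
  module

end TwoCopies

section Copies

variable {N m : ℕ} {B : Type*} [Ring B]

theorem onCopies_qMat_comm (c : Kind) (a b : Fin m) :
    onCopies b a (qMat c N B) = onCopies a b (qMat c N B) := by
  ext x y
  simp only [onCopies, Matrix.of_apply]
  rw [← qMat_swap]
  simp only [Prod.swap_prod_mk]
  congr 1
  exact propext ⟨fun h d hb ha => h d ha hb, fun h d hb ha => h d ha hb⟩

theorem permMat_swap_mul_onCopies_qMat (c : Kind) {a b r : Fin m} (har : a ≠ r) (hbr : b ≠ r) :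
    permMat N B (Equiv.swap a b) * onCopies a r (qMat c N B)
      = onCopies b r (qMat c N B) * permMat N B (Equiv.swap a b) := by
  have := permMat_mul_onCopies (B := B) (Equiv.swap a b) b r (qMat c N B)
  rwa [Equiv.swap_apply_right, Equiv.swap_apply_of_ne_of_ne har.symm hbr.symm] at this

theorem mul_onCopies_qMat_apply (c : Kind) {a b : Fin m} (hab : a ≠ b)
    (M : Matrix (Fin m → Idx N) (Fin m → Idx N) B) (x y : Fin m → Idx N) :
    (M * onCopies a b (qMat c N B)) x y = if y a = -y b then
      ∑ n, (eps c n * eps c (y b)) • M x (Function.update (Function.update y a (-n)) b n)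
      else 0 := by
  set modify : Idx N → Fin m → Idx N :=
    fun n => Function.update (Function.update y a (-n)) b n with modify_def
  rw [Matrix.mul_apply]
  split_ifs with hy
  · refine (sum_of_injOn modify (fun n _ n' _ h => ?_) (fun _ _ => mem_coe.2 (mem_univ _))
      (fun z _ hz => ?_) fun n _ => ?_).symm
    · simpa [modify_def] using congrFun h b
    · simp only [onCopies, qMat, Matrix.of_apply]
      rw [← ite_and, if_neg, mul_zero]
      rintro ⟨hzy, hz', -⟩
      refine hz ⟨z b, mem_coe.2 (mem_univ _), funext fun d => ?_⟩
      rcases eq_or_ne d b with rfl | hdb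
      · simp [modify_def]
      rcases eq_or_ne d a with rfl | hda
      · simp [modify_def, hab, hz']
      · simp [modify_def, hda, hdb, hzy d hda hdb]
    · have agree : ∀ d, d ≠ a → d ≠ b → modify n d = y d := fun d hda hdb => by
        simp [modify_def, hda, hdb]
      simp only [onCopies, qMat, Matrix.of_apply]
      rw [if_pos agree, if_pos ⟨by simp [modify_def, hab], hy⟩, mul_smul_comm, mul_one]
      simp [modify_def]
  · simp [onCopies, qMat, hy]

theorem onCopies_qMat_mul_onCopies_qMat (c : Kind) (hc : c = .symplectic → Even N)
    {a b r : Fin m} (hab : a ≠ b) (har : a ≠ r) (hbr : b ≠ r) :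
    onCopies a r (qMat c N B) * onCopies b r (qMat c N B)
      = onCopies a r (qMat c N B) * permMat N B (Equiv.swap a b) := by
  ext x y
  set modify : Idx N → Fin m → Idx N :=
    fun n => Function.update (Function.update y b (-n)) r n with modify_def
  have modify_a (n : Idx N) : modify n a = y a := by simp [modify_def, hab, har]
  have modify_r (n : Idx N) : modify n r = n := by simp [modify_def]
  have agree_iff : (∀ d, d ≠ a → d ≠ r → x d = modify (-y a) d) ↔
      ∀ d, d ≠ a → d ≠ r → x d = y (Equiv.swap a b d) := by
    refine forall₃_congr fun d hda hdr => ?_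
    rcases eq_or_ne d b with rfl | hdb
    · simp [modify_def, hdr]
    · simp [modify_def, hdr, hdb, Equiv.swap_apply_of_ne_of_ne hda hdb]
  have sign (i j k : Idx N) : eps c i * eps c j * (eps c k * eps c i) = eps c k * eps c j := by
    linear_combination (eps c k * eps c j) * eps_mul_self c hc i
  have expand : (onCopies a r (qMat c N B) * onCopies b r (qMat c N B)) x y = if y b = -y r then
      ∑ n, (eps c n * eps c (y r)) • onCopies a r (qMat c N B) x (modify n) else 0 :=
    mul_onCopies_qMat_apply c hbr _ x y
  rw [mul_permMat_apply, expand]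
  split_ifs with hy
  · rw [sum_eq_single (-y a) (fun n _ hn => ?_) (by simp)]
    · simp only [onCopies, qMat, Matrix.of_apply, Function.comp_apply,
        Equiv.swap_apply_left, Equiv.swap_apply_of_ne_of_ne har.symm hbr.symm, hy, modify_a,
        modify_r, agree_iff, neg_neg, and_true, smul_ite, smul_zero, smul_smul, sign]
    · have hn' : ¬ y a = -n := fun h => hn (by rw [h, neg_neg])
      simp only [onCopies, qMat, Matrix.of_apply, modify_a, modify_r, hn', and_false, if_false,
        ite_self, smul_zero]
  · simp [onCopies, qMat, hy, Equiv.swap_apply_of_ne_of_ne har.symm hbr.symm]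

variable {K : Type*} [CommRing K] [Algebra K B]

theorem yang_baxter (c : Kind) (hc : c = .symplectic → Even N) {a b r : Fin m} (hab : a ≠ b)
    (har : a ≠ r) (hbr : b ≠ r) {α ρ₁ ρ₂ : K} (h : ρ₁ * ρ₂ = α * (ρ₁ - ρ₂)) :
    (1 - α • permMat N B (Equiv.swap a b))
        * ((1 - ρ₁ • onCopies a r (qMat c N B)) * (1 - ρ₂ • onCopies b r (qMat c N B)))
      = (1 - ρ₂ • onCopies b r (qMat c N B)) * (1 - ρ₁ • onCopies a r (qMat c N B))
        * (1 - α • permMat N B (Equiv.swap a b)) := by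
  apply yang_baxter_of_relations _ _ _ _ h
  · exact permMat_swap_mul_onCopies_qMat c har hbr
  · rw [Equiv.swap_comm]; exact permMat_swap_mul_onCopies_qMat c hbr har
  · exact onCopies_qMat_mul_onCopies_qMat c hc hab har hbr
  · rw [Equiv.swap_comm]; exact onCopies_qMat_mul_onCopies_qMat c hc hab.symm hbr har

theorem rtt_copies {a b : Fin m} (hab : a ≠ b) {T T' : Matrix (Idx N) (Idx N) B} {α : K}
    (h : RTT T T' α) :
    (1 - α • permMat N B (Equiv.swap a b)) * (onCopy a T * onCopy b T')
      = onCopy b T' * onCopy a T * (1 - α • permMat N B (Equiv.swap a b)) := by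
  rw [permMat_swap hab, ← onCopies_smul, ← onCopies_one hab, ← onCopies_sub,
    onCopy_eq_fstCopy hab, onCopy_eq_sndCopy hab]
  simp only [← onCopies_mul hab, rtt_two h]

theorem rtt_copies_twT (c : Kind) (hc : c = .symplectic → Even N) {a b : Fin m} (hab : a ≠ b)
    {T T' : Matrix (Idx N) (Idx N) B} {α : K} (h : RTT T T' α) :
    onCopy a (twT c T) * ((1 - α • onCopies a b (qMat c N B)) * onCopy b T')
      = onCopy b T' * ((1 - α • onCopies a b (qMat c N B)) * onCopy a (twT c T)) := by
  rw [← onCopies_smul, ← onCopies_one hab, ← onCopies_sub,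
    onCopy_eq_fstCopy hab, onCopy_eq_sndCopy hab]
  simp only [← onCopies_mul hab, rtt_two_twT c hc h]

theorem reflection_copies (c : Kind) {a b : Fin m} (hab : a ≠ b)
    {S S' : Matrix (Idx N) (Idx N) B} {α β : K} (h : Reflection c S S' α β) :
    (1 - α • permMat N B (Equiv.swap a b))
        * (onCopy a S * ((1 + β • onCopies a b (qMat c N B)) * onCopy b S'))
      = onCopy b S' * ((1 + β • onCopies a b (qMat c N B)) * onCopy a S)
        * (1 - α • permMat N B (Equiv.swap a b)) := by
  rw [permMat_swap hab, ← onCopies_smul, ← onCopies_smul, ← onCopies_one hab, ← onCopies_sub,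
    ← onCopies_add, onCopy_eq_fstCopy hab, onCopy_eq_sndCopy hab]
  simp only [← onCopies_mul hab, (reflection_two_iff c).2 h]

end Copies

/-! ### The antisymmetrizer and exchange relations -/

/-- The increasing enumeration of the index set. -/
def enum (N : ℕ) : Fin N ≃ Idx N where
  toFun i := ⟨(i : ℤ) - (N / 2 : ℕ) + if N % 2 = 0 ∧ N / 2 ≤ (i : ℕ) then 1 else 0, by
    have := i.2
    simp only [idxSet, mem_filter, mem_Icc, Nat.even_iff]
    split_ifs <;> omega⟩
  invFun z := ⟨(z.1 + (N / 2 : ℕ) - if N % 2 = 0 ∧ 0 < z.1 then 1 else 0).toNat, by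
    have h := z.2
    simp only [idxSet, mem_filter, mem_Icc, Nat.even_iff] at h
    split_ifs <;> omega⟩
  left_inv i := by
    have := i.2
    apply Fin.ext
    dsimp only
    split_ifs <;> omega
  right_inv z := by
    have h := z.2
    simp only [idxSet, mem_filter, mem_Icc, Nat.even_iff] at h
    apply Subtype.ext
    dsimp only
    split_ifs <;> omega

theorem enum_rev (N : ℕ) (i : Fin N) : enum N i.rev = -enum N i := by
  have := i.2
  apply Subtype.ext
  change _ = -(enum N i).1
  simp only [enum, Equiv.coe_fn_mk, Fin.val_rev]
  split_ifs <;> omega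

section Antisymmetrizer

variable {N m : ℕ} {B : Type*} [Ring B]

theorem permMat_one : permMat N B (1 : Equiv.Perm (Fin m)) = 1 := by
  ext x y; simp [permMat, Matrix.one_apply]

theorem permMat_mul_permMat (σ τ : Equiv.Perm (Fin m)) :
    permMat N B σ * permMat N B τ = permMat N B (τ * σ) := by
  ext x y
  rw [mul_permMat_apply]
  simp only [permMat, Matrix.of_apply, Function.comp_assoc]
  rfl

theorem permMat_swap_mul_self (a b : Fin m) :
    permMat N B (Equiv.swap a b) * permMat N B (Equiv.swap a b) = 1 := by
  rw [permMat_mul_permMat, Equiv.swap_mul_self, permMat_one]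

theorem antisym_eq_sum :
    antisym N m B = ∑ σ : Equiv.Perm (Fin m), (Equiv.Perm.sign σ : ℤ) • permMat N B σ := by
  ext x y
  simp [antisym, Matrix.sum_apply, permMat]

theorem antisym_mul_permMat (σ : Equiv.Perm (Fin m)) :
    antisym N m B * permMat N B σ = (Equiv.Perm.sign σ : ℤ) • antisym N m B := by
  rw [antisym_eq_sum, sum_mul, smul_sum, ← Equiv.sum_comp (Equiv.mulLeft σ) (fun τ => _ • _)]
  refine sum_congr rfl fun τ _ => ?_
  simp only [Equiv.coe_mulLeft, smul_mul_assoc, permMat_mul_permMat, map_mul, smul_smul,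
    Units.val_mul, ← mul_assoc]
  rw [← Units.val_mul, Int.units_mul_self, Units.val_one, one_mul]

theorem permMat_mul_antisym (σ : Equiv.Perm (Fin m)) :
    permMat N B σ * antisym N m B = (Equiv.Perm.sign σ : ℤ) • antisym N m B := by
  rw [antisym_eq_sum, mul_sum, smul_sum, ← Equiv.sum_comp (Equiv.mulRight σ) (fun τ => _ • _)]
  refine sum_congr rfl fun τ _ => ?_
  simp only [Equiv.coe_mulRight, mul_smul_comm, permMat_mul_permMat, map_mul, smul_smul,
    Units.val_mul]
  rw [mul_left_comm, ← Units.val_mul, Int.units_mul_self, Units.val_one, mul_one]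

theorem antisym_mul_permMat_swap {a b : Fin m} (hab : a ≠ b) :
    antisym N m B * permMat N B (Equiv.swap a b) = -antisym N m B := by
  rw [antisym_mul_permMat, Equiv.Perm.sign_swap hab]; simp

theorem permMat_swap_mul_antisym {a b : Fin m} (hab : a ≠ b) :
    permMat N B (Equiv.swap a b) * antisym N m B = -antisym N m B := by
  rw [permMat_mul_antisym, Equiv.Perm.sign_swap hab]; simp

theorem closure_adjacent_swaps_eq_top (m : ℕ) :
    Submonoid.closure {σ : Equiv.Perm (Fin m) | ∃ a b : Fin m, (b : ℕ) = a + 1 ∧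
      σ = Equiv.swap a b} = ⊤ := by
  cases m with
  | zero => exact Subsingleton.elim _ _
  | succ n =>
    rw [eq_top_iff, ← Equiv.Perm.mclosure_swap_castSucc_succ n]
    apply Submonoid.closure_mono
    rintro _ ⟨i, rfl⟩
    exact ⟨i.castSucc, i.succ, by simp, rfl⟩

/-- The permutations `σ` of the copies with `X P_σ = sgn σ · X`. -/
def signStabilizer (X : Matrix (Fin m → Idx N) (Fin m → Idx N) B) :
    Submonoid (Equiv.Perm (Fin m)) where
  carrier := {σ | X * permMat N B σ = (Equiv.Perm.sign σ : ℤ) • X}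
  one_mem' := by simp [permMat_one]
  mul_mem' {σ τ} hσ hτ := by
    simp only [Set.mem_ofPred_eq] at hσ hτ ⊢
    rw [← permMat_mul_permMat, ← mul_assoc, hτ, smul_mul_assoc, hσ, smul_smul, map_mul,
      Units.val_mul, mul_comm]

theorem swap_mem_signStabilizer {X : Matrix (Fin m → Idx N) (Fin m → Idx N) B} {a b : Fin m}
    (hab : a ≠ b) (h : X * permMat N B (Equiv.swap a b) = -X) :
    Equiv.swap a b ∈ signStabilizer X := by
  change X * permMat N B (Equiv.swap a b) = _
  rw [h, Equiv.Perm.sign_swap hab, Units.val_neg, Units.val_one, neg_one_smul]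

theorem mul_permMat_of_adjacent {X : Matrix (Fin m → Idx N) (Fin m → Idx N) B}
    (h : ∀ a b : Fin m, (b : ℕ) = a + 1 → X * permMat N B (Equiv.swap a b) = -X)
    (σ : Equiv.Perm (Fin m)) : X * permMat N B σ = (Equiv.Perm.sign σ : ℤ) • X := by
  suffices hX : signStabilizer X = ⊤ from show σ ∈ signStabilizer X from hX ▸ Submonoid.mem_top σ
  rw [← top_le_iff, ← closure_adjacent_swaps_eq_top, Submonoid.closure_le]
  rintro _ ⟨a, b, hab, rfl⟩
  exact swap_mem_signStabilizer (by rintro rfl; omega) (h a b hab)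

theorem permMat_mul_of_adjacent {X : Matrix (Fin m → Idx N) (Fin m → Idx N) B}
    (h : ∀ a b : Fin m, (b : ℕ) = a + 1 → permMat N B (Equiv.swap a b) * X = -X)
    (σ : Equiv.Perm (Fin m)) : permMat N B σ * X = (Equiv.Perm.sign σ : ℤ) • X := by
  have hσ : σ ∈ Submonoid.closure {σ : Equiv.Perm (Fin m) | ∃ a b : Fin m, (b : ℕ) = a + 1 ∧
      σ = Equiv.swap a b} := by
    rw [closure_adjacent_swaps_eq_top]; trivial
  induction hσ using Submonoid.closure_induction with
  | mem σ hσ =>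
    obtain ⟨a, b, hab, rfl⟩ := hσ
    rw [h a b hab, Equiv.Perm.sign_swap (by rintro rfl; omega)]
    simp
  | one => simp [permMat_one]
  | mul σ τ _ _ hσ hτ =>
    rw [← permMat_mul_permMat, mul_assoc, hσ, mul_smul_comm, hτ, smul_smul, map_mul,
      Units.val_mul]

/-- `X P_σ = P_σ X = sgn σ · X` for every permutation `σ` of the copies: `X` is antisymmetric in its
row and in its column indices. -/
def Alternating (X : Matrix (Fin m → Idx N) (Fin m → Idx N) B) : Prop :=
  ∀ σ, X * permMat N B σ = (Equiv.Perm.sign σ : ℤ) • X ∧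
    permMat N B σ * X = (Equiv.Perm.sign σ : ℤ) • X

theorem alternating_antisym : Alternating (antisym N m B) := fun σ =>
  ⟨antisym_mul_permMat σ, permMat_mul_antisym σ⟩

theorem apply_comp_right {X : Matrix (Fin m → Idx N) (Fin m → Idx N) B}
    {σ : Equiv.Perm (Fin m)} (h : X * permMat N B σ = (Equiv.Perm.sign σ : ℤ) • X)
    (x y : Fin m → Idx N) : X x (y ∘ σ) = (Equiv.Perm.sign σ : ℤ) • X x y := by
  have := congrFun (congrFun h x) y
  rwa [mul_permMat_apply] at this

theorem apply_comp_left {X : Matrix (Fin m → Idx N) (Fin m → Idx N) B}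
    {σ : Equiv.Perm (Fin m)} (h : permMat N B σ⁻¹ * X = (Equiv.Perm.sign σ⁻¹ : ℤ) • X)
    (x y : Fin m → Idx N) : X (x ∘ σ) y = (Equiv.Perm.sign σ : ℤ) • X x y := by
  have := congrFun (congrFun h x) y
  rw [permMat_mul_apply, Equiv.Perm.sign_inv] at this
  exact this

theorem comp_swap_eq_self {β : Type*} {y : Fin m → β} {a b : Fin m} (hab : y a = y b) :
    y ∘ Equiv.swap a b = y := by
  rw [Equiv.comp_swap_eq_update, hab, Function.update_eq_self, ← hab, Function.update_eq_self]

theorem apply_eq_zero_of_swap_mem_signStabilizer [IsAddTorsionFree B]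
    {X : Matrix (Fin m → Idx N) (Fin m → Idx N) B} {a b : Fin m} (hne : a ≠ b)
    (h : Equiv.swap a b ∈ signStabilizer X) (x : Fin m → Idx N) {y : Fin m → Idx N}
    (hy : y a = y b) : X x y = 0 := by
  have antisymmetry := apply_comp_right h x y
  rw [comp_swap_eq_self hy, Equiv.Perm.sign_swap hne] at antisymmetry
  exact self_eq_neg.1 (by simpa using antisymmetry)

theorem apply_eq_zero_of_not_injective_right [IsAddTorsionFree B]
    {X : Matrix (Fin m → Idx N) (Fin m → Idx N) B}
    (h : ∀ σ, X * permMat N B σ = (Equiv.Perm.sign σ : ℤ) • X) (x : Fin m → Idx N)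
    {y : Fin m → Idx N} (hy : ¬ Function.Injective y) : X x y = 0 := by
  simp only [Function.Injective, not_forall] at hy
  obtain ⟨a, b, hab, hne⟩ := hy
  exact apply_eq_zero_of_swap_mem_signStabilizer hne (h _) x hab

theorem apply_eq_zero_of_not_injective_left [IsAddTorsionFree B]
    {X : Matrix (Fin m → Idx N) (Fin m → Idx N) B}
    (h : ∀ σ, permMat N B σ * X = (Equiv.Perm.sign σ : ℤ) • X) {x : Fin m → Idx N}
    (hx : ¬ Function.Injective x) (y : Fin m → Idx N) : X x y = 0 := by
  simp only [Function.Injective, not_forall] at hx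
  obtain ⟨a, b, hab, hne⟩ := hx
  have antisymmetry := apply_comp_left (h (Equiv.swap a b)⁻¹) x y
  rw [comp_swap_eq_self hab, Equiv.Perm.sign_swap hne] at antisymmetry
  exact self_eq_neg.1 (by simpa using antisymmetry)

theorem antisym_apply_enum : antisym N N B (enum N) (enum N) = 1 := by
  rw [antisym, Matrix.of_apply, sum_eq_single 1]
  · simp
  · intro σ _ hσ
    rw [if_neg]
    intro h
    apply hσ
    ext d
    have := congrFun h d
    simp only [Function.comp_apply, EmbeddingLike.apply_eq_iff_eq] at this
    simp [← this]
  · simp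

theorem exists_eq_enum_comp {x : Fin N → Idx N} (hx : Function.Injective x) :
    ∃ σ : Equiv.Perm (Fin N), x = enum N ∘ σ := by
  have hb : Function.Bijective x :=
    (Fintype.bijective_iff_injective_and_card x).2 ⟨hx, Fintype.card_congr (enum N)⟩
  exact ⟨(Equiv.ofBijective x hb).trans (enum N).symm, by ext; simp⟩

theorem mul_scalar_apply (X : Matrix (Fin m → Idx N) (Fin m → Idx N) B) (q : B)
    (x y : Fin m → Idx N) : (X * Matrix.scalar (Fin m → Idx N) q) x y = X x y * q := by
  rw [Matrix.scalar_apply, Matrix.mul_diagonal]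

theorem Alternating.eq_antisym_mul [IsAddTorsionFree B]
    {X : Matrix (Fin N → Idx N) (Fin N → Idx N) B}
    (h : Alternating X) :
    X = antisym N N B * Matrix.scalar (Fin N → Idx N) (X (enum N) (enum N)) := by
  ext x y
  rw [mul_scalar_apply]
  by_cases hx : Function.Injective x
  · by_cases hy : Function.Injective y
    · obtain ⟨σ, rfl⟩ := exists_eq_enum_comp hx
      obtain ⟨τ, rfl⟩ := exists_eq_enum_comp hy
      have hA := alternating_antisym (N := N) (m := N) (B := B)
      rw [apply_comp_right (h τ).1, apply_comp_left (h σ⁻¹).2,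
        apply_comp_right (hA τ).1, apply_comp_left (hA σ⁻¹).2, antisym_apply_enum,
        smul_mul_assoc, smul_mul_assoc, one_mul]
    · rw [apply_eq_zero_of_not_injective_right (fun σ => (h σ).1) x hy,
        apply_eq_zero_of_not_injective_right antisym_mul_permMat x hy, zero_mul]
  · rw [apply_eq_zero_of_not_injective_left (fun σ => (h σ).2) hx y,
      apply_eq_zero_of_not_injective_left permMat_mul_antisym hx y, zero_mul]

theorem antisym_mul_scalar_injective {q q' : B}
    (h : antisym N N B * Matrix.scalar (Fin N → Idx N) q
      = antisym N N B * Matrix.scalar (Fin N → Idx N) q') : q = q' := by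
  have := congrFun (congrFun h (enum N)) (enum N)
  rwa [mul_scalar_apply, mul_scalar_apply, antisym_apply_enum, one_mul, one_mul] at this

theorem antisym_mul_of_permMat_mul {X : Matrix (Fin m → Idx N) (Fin m → Idx N) B}
    (h : ∀ σ, permMat N B σ * X = (Equiv.Perm.sign σ : ℤ) • X) :
    antisym N m B * X = m.factorial • X := by
  rw [antisym_eq_sum, sum_mul]
  have : ∀ σ ∈ (univ : Finset (Equiv.Perm (Fin m))),
      ((Equiv.Perm.sign σ : ℤ) • permMat N B σ) * X = X := by
    intro σ _
    rw [smul_mul_assoc, h, smul_smul, ← Units.val_mul, Int.units_mul_self, Units.val_one, one_smul]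
  rw [sum_congr rfl this, sum_const, card_univ, Fintype.card_perm, Fintype.card_fin]

theorem mul_antisym_of_mul_permMat {X : Matrix (Fin m → Idx N) (Fin m → Idx N) B}
    (h : ∀ σ, X * permMat N B σ = (Equiv.Perm.sign σ : ℤ) • X) :
    X * antisym N m B = m.factorial • X := by
  rw [antisym_eq_sum, mul_sum]
  have : ∀ σ ∈ (univ : Finset (Equiv.Perm (Fin m))),
      X * ((Equiv.Perm.sign σ : ℤ) • permMat N B σ) = X := by
    intro σ _
    rw [mul_smul_comm, h, smul_smul, ← Units.val_mul, Int.units_mul_self, Units.val_one, one_smul]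
  rw [sum_congr rfl this, sum_const, card_univ, Fintype.card_perm, Fintype.card_fin]

variable [Algebra ℂ B]

/-- `R_{ab}(u_a - u_b) = 1 - P_{ab} (b - a)⁻¹`, the normalized `R`-matrix of Yang at the shifts
`u_a - u_b = b - a`. -/
def rMat (N : ℕ) {m : ℕ} (B : Type*) [Ring B] [Algebra ℂ B] (a b : Fin m) :
    Matrix (Fin m → Idx N) (Fin m → Idx N) B :=
  1 - ((b : ℂ) - (a : ℂ))⁻¹ • permMat N B (Equiv.swap a b)

/-- Conjugation by `R_{ab}` exchanges adjacent entries `a < b` of the list in `F`. Both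
`T_{p_1} ⋯ T_{p_m}` and `⟨S_{p_1}, …, S_{p_m}⟩` have this property as functions of the list `p`. -/
def Exchange (F : List (Fin m) → Matrix (Fin m → Idx N) (Fin m → Idx N) B) : Prop :=
  ∀ (l₁ l₂ : List (Fin m)) (a b : Fin m), a < b → (l₁ ++ a :: b :: l₂).Nodup →
    rMat N B a b * F (l₁ ++ a :: b :: l₂) = F (l₁ ++ b :: a :: l₂) * rMat N B a b

theorem rMat_adjacent {a b : Fin m} (h : (b : ℕ) = a + 1) :
    rMat N B a b = 1 - permMat N B (Equiv.swap a b) := by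
  rw [rMat, h]; simp

variable {F : List (Fin m) → Matrix (Fin m → Idx N) (Fin m → Idx N) B}

theorem Exchange.antisym_mul (hF : Exchange F) {l₁ l₂ : List (Fin m)} {a b : Fin m}
    (h : (b : ℕ) = a + 1) (hl : (l₁ ++ a :: b :: l₂).Nodup) :
    antisym N m B * F (l₁ ++ a :: b :: l₂) * permMat N B (Equiv.swap a b)
      = -(antisym N m B * F (l₁ ++ a :: b :: l₂)) := by
  have hlt : a < b := by rw [Fin.lt_def]; omega
  have exchange := hF l₁ l₂ a b hlt hl
  rw [rMat_adjacent h] at exchange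
  set P := permMat N B (Equiv.swap a b)
  have hPP : P * P = 1 := permMat_swap_mul_self a b
  have hA : antisym N m B * P = -antisym N m B := antisym_mul_permMat_swap hlt.ne
  set G := F (l₁ ++ a :: b :: l₂)
  have hzero : antisym N m B * ((1 - P) * G) * (1 + P) = 0 := by
    rw [exchange, mul_assoc, mul_assoc, mul_add, mul_one, sub_mul, hPP, one_mul]; simp
  have two_smul_eq_zero : (2 : ℂ) • (antisym N m B * G * (1 + P)) = 0 := by
    rw [← hzero, ← mul_assoc, mul_sub, hA, mul_one, two_smul]; noncomm_ring
  have eq_zero := (smul_eq_zero.1 two_smul_eq_zero).resolve_left two_ne_zero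
  rw [mul_add, mul_one] at eq_zero
  exact eq_neg_of_add_eq_zero_right eq_zero

theorem Exchange.mul_antisym (hF : Exchange F) {l₁ l₂ : List (Fin m)} {a b : Fin m}
    (h : (b : ℕ) = a + 1) (hl : (l₁ ++ a :: b :: l₂).Nodup) :
    permMat N B (Equiv.swap a b) * (F (l₁ ++ b :: a :: l₂) * antisym N m B)
      = -(F (l₁ ++ b :: a :: l₂) * antisym N m B) := by
  have hlt : a < b := by rw [Fin.lt_def]; omega
  have exchange := hF l₁ l₂ a b hlt hl
  rw [rMat_adjacent h] at exchange
  set P := permMat N B (Equiv.swap a b)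
  have hPP : P * P = 1 := permMat_swap_mul_self a b
  have hA : P * antisym N m B = -antisym N m B := permMat_swap_mul_antisym hlt.ne
  set G := F (l₁ ++ b :: a :: l₂)
  have hzero : (1 + P) * (G * (1 - P)) * antisym N m B = 0 := by
    rw [← exchange, ← mul_assoc, add_mul, one_mul, mul_sub, hPP, mul_one]; simp
  have two_smul_eq_zero : (2 : ℂ) • ((1 + P) * (G * antisym N m B)) = 0 := by
    rw [← hzero, mul_assoc, mul_assoc, sub_mul, hA, one_mul, two_smul]; noncomm_ring
  have eq_zero := (smul_eq_zero.1 two_smul_eq_zero).resolve_left two_ne_zero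
  rw [add_mul, one_mul] at eq_zero
  exact eq_neg_of_add_eq_zero_right eq_zero

/-- `F l` and `F l'` are intertwined by an operator acting on antisymmetric tensors by a nonzero
scalar. -/
def Intertwined (F : List (Fin m) → Matrix (Fin m → Idx N) (Fin m → Idx N) B)
    (l l' : List (Fin m)) : Prop :=
  ∃ (M : Matrix (Fin m → Idx N) (Fin m → Idx N) B) (z : ℂ), z ≠ 0 ∧ M * F l = F l' * M ∧
    antisym N m B * M = z • antisym N m B ∧ M * antisym N m B = z • antisym N m B

theorem Intertwined.refl (l : List (Fin m)) : Intertwined F l l :=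
  ⟨1, 1, one_ne_zero, by simp, by simp, by simp⟩

theorem Intertwined.trans {l l' l'' : List (Fin m)} (h : Intertwined F l l')
    (h' : Intertwined F l' l'') : Intertwined F l l'' := by
  obtain ⟨M, z, hz, hMF, hAM, hMA⟩ := h
  obtain ⟨M', z', hz', hMF', hAM', hMA'⟩ := h'
  refine ⟨M' * M, z' * z, mul_ne_zero hz' hz, ?_, ?_, ?_⟩
  · rw [mul_assoc, hMF, ← mul_assoc, hMF', mul_assoc]
  · rw [← mul_assoc, hAM', smul_mul_assoc, hAM, smul_smul]
  · rw [mul_assoc, hMA, mul_smul_comm, hMA', smul_smul, mul_comm]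

theorem Intertwined.antisym_mul_mul_antisym {l l' : List (Fin m)} (h : Intertwined F l l') :
    antisym N m B * F l * antisym N m B = antisym N m B * F l' * antisym N m B := by
  obtain ⟨M, z, hz, hMF, hAM, hMA⟩ := h
  have : z • (antisym N m B * F l * antisym N m B)
      = z • (antisym N m B * F l' * antisym N m B) := by
    rw [← smul_mul_assoc, ← smul_mul_assoc, ← hAM, mul_assoc (antisym N m B), hMF,
      ← mul_smul_comm z, ← hMA]
    simp only [mul_assoc]
  exact smul_right_injective _ hz this

theorem Exchange.intertwined (hF : Exchange F) {l₁ l₂ : List (Fin m)} {a b : Fin m}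
    (hab : a < b) (hl : (l₁ ++ a :: b :: l₂).Nodup) :
    Intertwined F (l₁ ++ a :: b :: l₂) (l₁ ++ b :: a :: l₂) := by
  refine ⟨rMat N B a b, 1 + ((b : ℂ) - (a : ℂ))⁻¹, ?_, hF _ _ _ _ hab hl, ?_, ?_⟩
  · have h : ((b : ℂ) - (a : ℂ)) = ((b - a : ℕ) : ℂ) := by
      rw [Nat.cast_sub (Fin.le_def.1 hab.le)]
    have hpos : 0 < (b - a : ℕ) := Nat.sub_pos_of_lt hab
    rw [h]
    generalize (b - a : ℕ) = k at hpos
    have hk : (k : ℂ) ≠ 0 := by exact_mod_cast hpos.ne'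
    have e : 1 + (k : ℂ)⁻¹ = ((k + 1 : ℕ) : ℂ) / k := by push_cast; field_simp
    rw [e]
    exact div_ne_zero (by exact_mod_cast k.succ_ne_zero) hk
  · rw [rMat, mul_sub, mul_one, mul_smul_comm, antisym_mul_permMat_swap hab.ne]; module
  · rw [rMat, sub_mul, one_mul, smul_mul_assoc, permMat_swap_mul_antisym hab.ne]; module

theorem Exchange.intertwined_move (hF : Exchange F) (p : Fin m) (ps l₂ : List (Fin m)) :
    ∀ l₁ : List (Fin m), (∀ q ∈ ps, p < q) → (l₁ ++ p :: (ps ++ l₂)).Nodup →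
      Intertwined F (l₁ ++ p :: (ps ++ l₂)) (l₁ ++ (ps ++ p :: l₂)) := by
  induction ps with
  | nil => intro l₁ _ _; exact Intertwined.refl _
  | cons q ps ih =>
    intro l₁ h hl
    refine (hF.intertwined (h q (by simp)) hl).trans ?_
    have := ih (l₁ ++ [q]) (fun r hr => h r (by simp [hr])) (by
      refine (List.Perm.nodup_iff ?_).1 hl
      simp only [List.append_assoc, List.cons_append, List.nil_append]
      exact List.Perm.append_left _ (List.Perm.swap _ _ _))
    simpa using this

theorem Exchange.intertwined_reverse (hF : Exchange F) (l : List (Fin m)) :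
    ∀ l₂ : List (Fin m), l.Pairwise (· < ·) → (l ++ l₂).Nodup →
      Intertwined F (l ++ l₂) (l.reverse ++ l₂) := by
  induction l with
  | nil => intro l₂ _ _; exact Intertwined.refl _
  | cons p ps ih =>
    intro l₂ h hl
    rw [List.pairwise_cons] at h
    refine (hF.intertwined_move p ps l₂ [] h.1 hl).trans ?_
    have := ih (p :: l₂) h.2 ((List.Perm.nodup_iff List.perm_middle).2 hl)
    simpa using this

theorem exists_take_finRange_eq_append {a b : Fin m} (hab : (b : ℕ) = a + 1) {k : ℕ}
    (hb : (b : ℕ) < k) : ∃ l₁ l₂, (List.finRange m).take k = l₁ ++ a :: b :: l₂ := by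
  set l := (List.finRange m).take k with l_def
  have length_l : (a : ℕ) + 1 < l.length := by
    simp only [l_def, List.length_take, List.length_finRange]
    omega
  have ha : l[(a : ℕ)] = a := by simp [l_def]
  have hb : l[(a : ℕ) + 1] = b := by ext; simp [l_def, hab]
  refine ⟨l.take a, l.drop (a + 2), ?_⟩
  conv_lhs => rw [← List.take_append_drop a l, List.drop_eq_getElem_cons (by omega),
    List.drop_eq_getElem_cons length_l, ha, hb]

theorem Exchange.alternating_antisym_mul (hF : Exchange F) :
    Alternating (antisym N m B * F (List.finRange m)) := by
  refine fun σ => ⟨mul_permMat_of_adjacent (fun a b hab => ?_) σ, ?_⟩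
  · obtain ⟨l₁, l₂, hl⟩ := exists_take_finRange_eq_append hab b.2
    rw [List.take_of_length_le (by simp)] at hl
    rw [hl]
    exact hF.antisym_mul hab (hl ▸ List.nodup_finRange m)
  · rw [← mul_assoc, permMat_mul_antisym, smul_mul_assoc]

theorem Exchange.permMat_mul_mul_antisym (hF : Exchange F) (σ : Equiv.Perm (Fin m)) :
    permMat N B σ * (F (List.finRange m).reverse * antisym N m B)
      = (Equiv.Perm.sign σ : ℤ) • (F (List.finRange m).reverse * antisym N m B) := by
  refine permMat_mul_of_adjacent (fun a b hab => ?_) σ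
  obtain ⟨l₁, l₂, hl⟩ := exists_take_finRange_eq_append hab b.2
  rw [List.take_of_length_le (by simp)] at hl
  have hrev : (List.finRange m).reverse = l₂.reverse ++ b :: a :: l₁.reverse := by simp [hl]
  have hnodup : (l₂.reverse ++ b :: a :: l₁.reverse).Nodup :=
    hrev ▸ List.nodup_reverse.2 (List.nodup_finRange m)
  rw [hrev]
  exact hF.mul_antisym hab
    ((List.Perm.nodup_iff (List.Perm.append_left _ (List.Perm.swap _ _ _))).1 hnodup)

theorem Exchange.antisym_mul_eq_mul_antisym (hF : Exchange F) :
    antisym N m B * F (List.finRange m) = F (List.finRange m).reverse * antisym N m B := by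
  have : IsAddTorsionFree (Matrix (Fin m → Idx N) (Fin m → Idx N) B) := .of_isTorsionFree ℂ _
  have hinter := (hF.intertwined_reverse (List.finRange m) [] (List.pairwise_lt_finRange m)
    (by simpa using List.nodup_finRange m)).antisym_mul_mul_antisym
  rw [List.append_nil, List.append_nil,
    mul_antisym_of_mul_permMat fun σ => (hF.alternating_antisym_mul σ).1, mul_assoc,
    antisym_mul_of_permMat_mul hF.permMat_mul_mul_antisym] at hinter
  exact nsmul_right_injective m.factorial_ne_zero hinter

end Antisymmetrizer

theorem Exchange.exists_det {N : ℕ} {B : Type*} [Ring B] [Algebra ℂ B]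
    {F : List (Fin N) → Matrix (Fin N → Idx N) (Fin N → Idx N) B} (hF : Exchange F) :
    ∃ q : B, antisym N N B * F (List.finRange N)
        = antisym N N B * Matrix.scalar (Fin N → Idx N) q ∧
      F (List.finRange N).reverse * antisym N N B
        = antisym N N B * Matrix.scalar (Fin N → Idx N) q := by
  have : IsAddTorsionFree B := .of_isTorsionFree ℂ _
  have hdet := hF.alternating_antisym_mul.eq_antisym_mul
  exact ⟨_, hdet, hF.antisym_mul_eq_mul_antisym ▸ hdet⟩

/-! ### Words in pair operators -/

section Words

variable {ι M : Type*} [Monoid M]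

/-- `σ_{p_1} (R_{p_1p_2} ⋯ R_{p_1p_m}) σ_{p_2} (R_{p_2p_3} ⋯ R_{p_2p_m}) ⋯ σ_{p_m}` in a monoid, the
shape of the product `⟨S_{p_1}, …, S_{p_m}⟩`. -/
def word (R : ι → ι → M) (σ : ι → M) : List ι → M
  | [] => 1
  | p :: ps => σ p * (ps.map (R p)).prod * word R σ ps

theorem commute_word {R : ι → ι → M} {σ : ι → M} {x : M} (l : List ι)
    (hσ : ∀ p ∈ l, Commute x (σ p))
    (hR : ∀ p ∈ l, ∀ q ∈ l, p ≠ q → Commute x (R p q)) (hl : l.Nodup) :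
    Commute x (word R σ l) := by
  induction l with
  | nil => exact Commute.one_right _
  | cons p ps ih =>
    rw [List.nodup_cons] at hl
    refine ((hσ p (by simp)).mul_right
      (Commute.list_prod_right _ _ (List.forall_mem_map.2 fun q hq => ?_))).mul_right
      (ih (fun q hq => hσ q (by simp [hq]))
        (fun q hq q' hq' h => hR q (by simp [hq]) q' (by simp [hq']) h) hl.2)
    exact hR p (by simp) q (by simp [hq]) (by rintro rfl; exact hl.1 hq)

/-- Families `R_{ab}` which behave like operators acting on the pairs of copies `{a, b}` with scalar
entries: symmetric, and commuting for disjoint pairs. -/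
structure PairOperators (R : ι → ι → M) : Prop where
  symm : ∀ a b, R a b = R b a
  commute : ∀ a b p q, a ≠ p → a ≠ q → b ≠ p → b ≠ q → Commute (R a b) (R p q)

theorem PairOperators.prod_map_mul_prod_map {R : ι → ι → M} (hR : PairOperators R) {a b : ι}
    {l : List ι} (hl : l.Nodup) (hab : a ≠ b) (ha : a ∉ l) (hb : b ∉ l) :
    (l.map (R a)).prod * (l.map (R b)).prod = (l.map fun q => R a q * R b q).prod := by
  induction l with
  | nil => simp
  | cons q l ih =>
    rw [List.nodup_cons] at hl
    simp only [List.mem_cons, not_or] at ha hb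
    simp only [List.map_cons, List.prod_cons]
    rw [← ih hl.2 ha.2 hb.2]
    have hcomm : Commute (R b q) (l.map (R a)).prod := by
      refine Commute.list_prod_right _ _ (List.forall_mem_map.2 fun r hr => ?_)
      refine hR.commute _ _ _ _ hab.symm ?_ (fun h => ha.1 h.symm) ?_
      · rintro rfl; exact hb.2 hr
      · rintro rfl; exact hl.1 hr
    rw [mul_assoc, mul_assoc, ← mul_assoc _ (R b q), ← hcomm.eq]
    simp only [mul_assoc]

theorem mul_prod_map_eq_prod_map_mul {r : M} {f g : ι → M} (l : List ι)
    (h : ∀ q ∈ l, r * f q = g q * r) : r * (l.map f).prod = (l.map g).prod * r := by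
  induction l with
  | nil => simp
  | cons q l ih =>
    simp only [List.map_cons, List.prod_cons]
    rw [← mul_assoc, h q (by simp), mul_assoc, ih fun p hp => h p (by simp [hp]), mul_assoc]

theorem mul_prod_map_exchange {r : M} {f : ι → M} {a b : ι} {l₁ l₂ : List ι}
    (hcomm : ∀ q ∈ l₁ ++ l₂, Commute r (f q)) (hab : r * (f a * f b) = f b * f a * r) :
    r * ((l₁ ++ a :: b :: l₂).map f).prod = ((l₁ ++ b :: a :: l₂).map f).prod * r := by
  simp only [List.forall_mem_append] at hcomm
  simp only [List.map_append, List.map_cons, List.prod_append, List.prod_cons]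
  calc r * ((l₁.map f).prod * (f a * (f b * (l₂.map f).prod)))
      = (l₁.map f).prod * (r * (f a * f b)) * (l₂.map f).prod := by
        rw [← mul_assoc r, mul_prod_map_eq_prod_map_mul l₁ hcomm.1]; simp only [mul_assoc]
    _ = (l₁.map f).prod * (f b * f a) * (r * (l₂.map f).prod) := by
        rw [hab]; simp only [mul_assoc]
    _ = _ := by rw [mul_prod_map_eq_prod_map_mul l₂ hcomm.2]; simp only [mul_assoc]

theorem ne_of_mem_append_of_nodup {a b : ι} {l₁ l₂ : List ι} (hl : (l₁ ++ a :: b :: l₂).Nodup) :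
    ∀ q ∈ l₁ ++ l₂, q ≠ a ∧ q ≠ b := by
  simp only [List.nodup_append, List.nodup_cons, List.mem_cons, List.mem_append] at hl ⊢
  grind

/-- `r` has the commutation relations of the `R`-matrix `R_{ab}(u_a - u_b)` with the letters `σ` and
the pair operators `R`: the reflection equation and the Yang–Baxter equation. -/
structure Exchanges (R : ι → ι → M) (σ : ι → M) (a b : ι) (r : M) : Prop where
  commute_letter : ∀ p, p ≠ a → p ≠ b → Commute r (σ p)
  commute_pair : ∀ p q, p ≠ a → p ≠ b → q ≠ a → q ≠ b → p ≠ q → Commute r (R p q)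
  reflection : r * (σ a * (R a b * σ b)) = σ b * (R a b * σ a) * r
  yang_baxter : ∀ q, q ≠ a → q ≠ b → r * (R a q * R b q) = R b q * R a q * r

theorem word_cons_cons {R : ι → ι → M} {σ : ι → M}
    (hσR : ∀ p a b, p ≠ a → p ≠ b → Commute (σ p) (R a b)) {a b : ι} {l : List ι} (hab : a ≠ b)
    (hb : b ∉ l) : word R σ (a :: b :: l) = (σ a * (R a b * σ b))
      * (((l.map (R a)).prod * (l.map (R b)).prod) * word R σ l) := by
  have hcomm : Commute (σ b) (l.map (R a)).prod :=
    Commute.list_prod_right _ _ (List.forall_mem_map.2 fun q hq =>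
      hσR b a q hab.symm (by rintro rfl; exact hb hq))
  calc word R σ (a :: b :: l)
      = σ a * R a b * ((l.map (R a)).prod * σ b) * (l.map (R b)).prod * word R σ l := by
        simp only [word, List.map_cons, List.prod_cons, mul_assoc]
    _ = _ := by rw [← hcomm.eq]; simp only [mul_assoc]

theorem Exchanges.mul_word_cons_cons {R : ι → ι → M} {σ : ι → M} {r : M} {a b : ι}
    (hr : Exchanges R σ a b r) (hR : PairOperators R)
    (hσR : ∀ p a b, p ≠ a → p ≠ b → Commute (σ p) (R a b)) {l : List ι}
    (hl : (a :: b :: l).Nodup) :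
    r * word R σ (a :: b :: l) = word R σ (b :: a :: l) * r := by
  have hne : ∀ q ∈ l, q ≠ a ∧ q ≠ b := ne_of_mem_append_of_nodup (l₁ := []) hl
  simp only [List.nodup_cons, List.mem_cons, not_or] at hl
  obtain ⟨⟨hab, ha⟩, hb, hl⟩ := hl
  have hword : Commute r (word R σ l) :=
    commute_word l (fun p hp => hr.commute_letter p (hne p hp).1 (hne p hp).2)
      (fun p hp q hq => hr.commute_pair p q (hne p hp).1 (hne p hp).2 (hne q hq).1 (hne q hq).2) hl
  have hpairs : r * ((l.map (R a)).prod * (l.map (R b)).prod)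
      = (l.map (R b)).prod * (l.map (R a)).prod * r := by
    rw [hR.prod_map_mul_prod_map hl hab ha hb, hR.prod_map_mul_prod_map hl (Ne.symm hab) hb ha]
    exact mul_prod_map_eq_prod_map_mul l fun q hq => hr.yang_baxter q (hne q hq).1 (hne q hq).2
  rw [word_cons_cons hσR hab hb, word_cons_cons hσR (Ne.symm hab) ha, ← mul_assoc, hr.reflection,
    mul_assoc, ← mul_assoc r, hpairs, mul_assoc _ r, hword.eq, hR.symm b a]
  simp only [mul_assoc]

theorem Exchanges.mul_word {R : ι → ι → M} {σ : ι → M} {r : M} {a b : ι}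
    (hr : Exchanges R σ a b r) (hR : PairOperators R)
    (hσR : ∀ p a b, p ≠ a → p ≠ b → Commute (σ p) (R a b)) {l₁ l₂ : List ι}
    (hl : (l₁ ++ a :: b :: l₂).Nodup) :
    r * word R σ (l₁ ++ a :: b :: l₂) = word R σ (l₁ ++ b :: a :: l₂) * r := by
  induction l₁ with
  | nil => exact hr.mul_word_cons_cons hR hσR hl
  | cons p l₁ ih =>
    rw [List.cons_append, List.nodup_cons] at hl
    obtain ⟨hp, hl⟩ := hl
    simp only [List.mem_append, List.mem_cons, not_or] at hp
    obtain ⟨hp1, hpa, hpb, hp2⟩ := hp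
    have hpairs : r * ((l₁ ++ a :: b :: l₂).map (R p)).prod
        = ((l₁ ++ b :: a :: l₂).map (R p)).prod * r := by
      refine mul_prod_map_exchange (fun q hq => ?_) ?_
      · obtain ⟨hqa, hqb⟩ := ne_of_mem_append_of_nodup hl q hq
        refine hr.commute_pair p q hpa hpb hqa hqb ?_
        rintro rfl
        exact (List.mem_append.1 hq).elim hp1 hp2
      · rw [hR.symm p a, hR.symm p b, hr.yang_baxter p hpa hpb]
    simp only [List.cons_append, word]
    rw [← mul_assoc, ← mul_assoc, (hr.commute_letter p hpa hpb).eq, mul_assoc (σ p), hpairs,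
      ← mul_assoc, mul_assoc _ r, ih hl, mul_assoc _ _ r]

theorem mul_prod_mul_prod_comm {R : ι → ι → M} {t : ι → M} {x : M} {p : ι}
    (ht : ∀ p a b, p ≠ a → p ≠ b → Commute (t p) (R a b))
    (hx : ∀ q, p ≠ q → x * (R p q * t q) = t q * (R p q * x)) {l : List ι}
    (hl : l.Nodup) (hp : p ∉ l) :
    x * (l.map (R p)).prod * (l.map t).prod = (l.map t).prod * (l.map (R p)).prod * x := by
  induction l with
  | nil => simp
  | cons q l ih =>
    rw [List.nodup_cons] at hl
    simp only [List.mem_cons, not_or] at hp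
    simp only [List.map_cons, List.prod_cons]
    have commute_t : Commute (t q) (l.map (R p)).prod :=
      Commute.list_prod_right _ _ (List.forall_mem_map.2 fun s hs =>
        ht q p s (Ne.symm hp.1) (by rintro rfl; exact hl.1 hs))
    have commute_R : Commute (R p q) (l.map t).prod :=
      Commute.list_prod_right _ _ (List.forall_mem_map.2 fun s hs =>
        (ht s p q (by rintro rfl; exact hp.2 hs) (by rintro rfl; exact hl.1 hs)).symm)
    calc x * (R p q * (l.map (R p)).prod) * (t q * (l.map t).prod)
        = x * R p q * ((l.map (R p)).prod * t q) * (l.map t).prod := by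
          simp only [mul_assoc]
      _ = (x * (R p q * t q)) * (l.map (R p)).prod * (l.map t).prod := by
          rw [← commute_t.eq]; simp only [mul_assoc]
      _ = t q * R p q * (x * (l.map (R p)).prod * (l.map t).prod) := by
          rw [hx q hp.1]; simp only [mul_assoc]
      _ = t q * (R p q * (l.map t).prod) * (l.map (R p)).prod * x := by
          rw [ih hl.2 hp.2]; simp only [mul_assoc]
      _ = _ := by rw [commute_R.eq]; simp only [mul_assoc]

theorem word_mul {R : ι → ι → M} {t t' : ι → M}
    (ht : ∀ p a b, p ≠ a → p ≠ b → Commute (t p) (R a b))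
    (ht' : ∀ p a b, p ≠ a → p ≠ b → Commute (t' p) (R a b))
    (h : ∀ p q, p ≠ q → t' p * (R p q * t q) = t q * (R p q * t' p)) {l : List ι}
    (hl : l.Nodup) : word R (fun p => t p * t' p) l
      = (l.map t).prod * word R (fun _ => 1) l * (l.map t').prod := by
  induction l with
  | nil => simp [word]
  | cons p ps ih =>
    rw [List.nodup_cons] at hl
    have hcomm : Commute (t' p) (word R (fun _ => (1 : M)) ps) := by
      refine commute_word ps (fun _ _ => Commute.one_right _) (fun a ha b hb _ => ?_) hl.2
      exact ht' p a b (by rintro rfl; exact hl.1 ha) (by rintro rfl; exact hl.1 hb)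
    simp only [word, List.map_cons, List.prod_cons, one_mul]
    calc t p * t' p * (ps.map (R p)).prod * word R (fun p => t p * t' p) ps
        = t p * (t' p * (ps.map (R p)).prod * (ps.map t).prod) * word R (fun _ => 1) ps
          * (ps.map t').prod := by rw [ih hl.2]; simp only [mul_assoc]
      _ = t p * (ps.map t).prod * (ps.map (R p)).prod * (t' p * word R (fun _ => 1) ps)
          * (ps.map t').prod := by
          rw [mul_prod_mul_prod_comm ht (h p) hl.2 hl.1]; simp only [mul_assoc]
      _ = _ := by rw [hcomm.eq]; simp only [mul_assoc]

theorem PairOperators.word_concat {R : ι → ι → M} (hR : PairOperators R) {l : List ι} {p : ι}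
    (hl : (l ++ [p]).Nodup) : word R (fun _ => 1) (l ++ [p])
      = word R (fun _ => 1) l * (l.map fun q => R q p).prod := by
  induction l with
  | nil => simp [word]
  | cons q l ih =>
    rw [List.cons_append, List.nodup_cons] at hl
    have hq := hl.1
    simp only [List.mem_append, List.mem_singleton, not_or] at hq
    have hp : p ∉ l := fun h => (List.nodup_append.1 hl.2).2.2 p h p (by simp) rfl
    simp only [List.cons_append, word, one_mul, List.map_append, List.prod_append, List.map_cons,
      List.map_nil, List.prod_cons, List.prod_nil, mul_one]
    have hcomm : Commute (R q p) (word R (fun _ => (1 : M)) l) := by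
      refine commute_word l (fun _ _ => Commute.one_right _) (fun a ha b hb _ => ?_)
        (List.nodup_append.1 hl.2).1
      exact hR.commute _ _ _ _ (by rintro rfl; exact hq.1 ha) (by rintro rfl; exact hq.1 hb)
        (by rintro rfl; exact hp ha) (by rintro rfl; exact hp hb)
    rw [ih hl.2, mul_assoc, ← mul_assoc (R q p), hcomm.eq]
    simp only [mul_assoc]

end Words

section CommuteCopies

variable {N m : ℕ} {B : Type*} [Ring B]

theorem qMat_commute (c : Kind) (x y : Idx N × Idx N) (b : B) : Commute b (qMat c N B x y) := by
  simp only [qMat, Matrix.of_apply]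
  split_ifs
  · exact (Commute.one_right b).smul_right _
  · exact Commute.zero_right b

theorem onCopies_qMat_commute (c : Kind) (p q : Fin m) (x y : Fin m → Idx N) (b : B) :
    Commute b (onCopies p q (qMat c N B) x y) := by
  simp only [onCopies, Matrix.of_apply]
  split_ifs
  · exact qMat_commute _ _ _ _
  · exact Commute.zero_right b

theorem commute_permMat_swap_onCopy {a b p : Fin m} (hpa : p ≠ a) (hpb : p ≠ b)
    (M : Matrix (Idx N) (Idx N) B) :
    Commute (permMat N B (Equiv.swap a b)) (onCopy p M) := by
  have := permMat_mul_onCopy (Equiv.swap a b) p M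
  rwa [Equiv.swap_apply_of_ne_of_ne hpa hpb] at this

theorem commute_permMat_swap_onCopies {a b p q : Fin m} (hpa : p ≠ a) (hpb : p ≠ b)
    (hqa : q ≠ a) (hqb : q ≠ b) (C : Matrix (Idx N × Idx N) (Idx N × Idx N) B) :
    Commute (permMat N B (Equiv.swap a b)) (onCopies p q C) := by
  have := permMat_mul_onCopies (Equiv.swap a b) p q C
  rwa [Equiv.swap_apply_of_ne_of_ne hpa hpb, Equiv.swap_apply_of_ne_of_ne hqa hqb] at this

theorem commute_one_sub_smul {K R : Type*} [CommRing K] [Ring R] [Algebra K R] {x y : R}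
    (h : Commute x y) (z : K) : Commute x (1 - z • y) :=
  (Commute.one_right _).sub_right (h.smul_right z)

theorem exchange_prod [Algebra ℂ B] (t : Fin m → Matrix (Idx N) (Idx N) B)
    (ht : ∀ a b : Fin m, a < b → RTT (t a) (t b) (((b : ℂ) - (a : ℂ))⁻¹)) :
    Exchange fun l => (l.map fun a => onCopy a (t a)).prod := by
  intro l₁ l₂ a b hab hl
  refine mul_prod_map_exchange (fun q hq => ?_) (rtt_copies hab.ne (ht a b hab))
  obtain ⟨hqa, hqb⟩ := ne_of_mem_append_of_nodup hl q hq
  exact (commute_one_sub_smul (commute_permMat_swap_onCopy hqa hqb _).symm _).symm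

end CommuteCopies

/-! ### Existence and uniqueness of the determinants -/

section Brackets

variable {N m : ℕ} {A : Type*} [Ring A] [Algebra ℂ A]

theorem Qmat_eq_qMat (c : Kind) (N : ℕ) : Qmat c N = qMat c N ℂ := by
  ext ⟨i, k⟩ ⟨j, l⟩
  have h (a b : Idx N) : (Matrix.kronecker (twT c (Matrix.single a b (1 : ℂ)))
      (Matrix.single b a (1 : ℂ))) (i, k) (j, l)
      = if b = k ∧ a = l then twT c (Matrix.single a b (1 : ℂ)) i j else 0 := by
    change _ * Matrix.single b a (1 : ℂ) k l = _
    rw [Matrix.single_apply, mul_ite, mul_one, mul_zero]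
  have hjl : l = -j ↔ j = -l := snd_eq_neg_fst_iff (x := (j, l))
  have hik : k = -i ↔ i = -k := snd_eq_neg_fst_iff (x := (i, k))
  simp only [Qmat, Matrix.sum_apply, h]
  rw [sum_eq_single l (by intro b _ hb; simp [hb]) (by simp),
    sum_eq_single k (by intro b _ hb; simp [hb]) (by simp), if_pos ⟨rfl, rfl⟩, twT_apply,
    Matrix.single_apply, qMat, Matrix.of_apply]
  simp only [hjl, hik, and_comm]
  split_ifs with h
  · rw [h.1, h.2, neg_neg, neg_neg, mul_comm]
  · simp

theorem Rt_comm (c : Kind) (a b : Fin m) :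
    (Rt c a b : Matrix (Fin m → Idx N) (Fin m → Idx N) A⟦X⟧) = Rt c b a := by
  rw [Rt, Rt, min_comm, max_comm, add_comm ((a : ℕ) : ℂ)]

theorem Rt_eq_one_sub_smul (c : Kind) (a b : Fin m) :
    (Rt c a b : Matrix (Fin m → Idx N) (Fin m → Idx N) A⟦X⟧)
      = 1 - linInv (-2) ((a : ℕ) + (b : ℕ)) • onCopies a b (qMat c N A⟦X⟧) := by
  wlog hab : a ≤ b generalizing a b
  · rw [Rt_comm, this b a (le_of_not_ge hab), onCopies_qMat_comm, add_comm ((a : ℕ) : ℂ)]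
  rw [Rt, min_eq_left hab, max_eq_right hab, ← onCopies_smul, Qmat_eq_qMat]
  congr 2
  ext x y : 2
  simp only [Matrix.map_apply, Matrix.smul_apply, qMat, Matrix.of_apply]
  split_ifs
  · rw [series_smul_def, map_mul, mul_smul_comm, mul_one, zsmul_one, map_intCast, map_intCast,
      zsmul_eq_mul]
    rfl
  · simp

theorem ActsOn.commute_Rt (c : Kind) {a b : Fin m}
    {M : Matrix (Fin m → Idx N) (Fin m → Idx N) A⟦X⟧} {s : Set (Fin m)} (hM : ActsOn s M)
    (ha : a ∉ s) (hb : b ∉ s) : Commute M (Rt c a b) := by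
  rw [Rt_eq_one_sub_smul]
  apply commute_one_sub_smul
  refine hM.commute (actsOn_onCopies a b _) ?_ fun _ _ _ _ => onCopies_qMat_commute _ _ _ _ _ _
  simp [ha, hb]

theorem pairOperators_Rt (c : Kind) :
    PairOperators (Rt c : Fin m → Fin m → Matrix (Fin m → Idx N) (Fin m → Idx N) A⟦X⟧) where
  symm := Rt_comm c
  commute a b p q hap haq hbp hbq := by
    rw [Rt_eq_one_sub_smul (a := a)]
    refine (commute_one_sub_smul (Commute.symm ?_) _).symm
    exact (actsOn_onCopies a b _).commute_Rt c (by simp [hap.symm, hbp.symm])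
      (by simp [haq.symm, hbq.symm])

theorem commute_onCopy_Rt (c : Kind) {p a b : Fin m} (ha : p ≠ a) (hb : p ≠ b)
    (M : Matrix (Idx N) (Idx N) A⟦X⟧) : Commute (onCopy p M) (Rt c a b) :=
  (actsOn_onCopy p M).commute_Rt c (by simp [ha.symm]) (by simp [hb.symm])

theorem rMat_eq (a b : Fin m) : rMat N A⟦X⟧ a b
    = 1 - PowerSeries.C ((b : ℂ) - (a : ℂ))⁻¹ • permMat N A⟦X⟧ (Equiv.swap a b) :=
  congrArg (1 - ·) (Matrix.ext fun _ _ => (C_series_smul _ _).symm)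

theorem commute_rMat_onCopy {a b p : Fin m} (ha : p ≠ a) (hb : p ≠ b)
    (M : Matrix (Idx N) (Idx N) A⟦X⟧) : Commute (rMat N A⟦X⟧ a b) (onCopy p M) :=
  (commute_one_sub_smul (commute_permMat_swap_onCopy ha hb _).symm _).symm

theorem commute_rMat_Rt (c : Kind) {a b p q : Fin m} (hpa : p ≠ a) (hpb : p ≠ b)
    (hqa : q ≠ a) (hqb : q ≠ b) : Commute (rMat N A⟦X⟧ a b) (Rt c p q) := by
  rw [Rt_eq_one_sub_smul]
  refine commute_one_sub_smul (Commute.symm (commute_one_sub_smul ?_ _)) _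
  exact (commute_permMat_swap_onCopies hpa hpb hqa hqb _).symm

theorem cast_sub_ne_zero {a b : Fin m} (h : a ≠ b) : ((b : ℕ) : ℂ) - ((a : ℕ) : ℂ) ≠ 0 :=
  sub_ne_zero.2 fun e => h (Fin.ext (Nat.cast_injective e).symm)

theorem rMat_mul_Rt_mul_Rt (c : Kind) (hc : c = .symplectic → Even N) {a b q : Fin m}
    (hab : a ≠ b) (ha : q ≠ a) (hb : q ≠ b) :
    rMat N A⟦X⟧ a b * (Rt c a q * Rt c b q) = Rt c b q * Rt c a q * rMat N A⟦X⟧ a b := by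
  rw [Rt_eq_one_sub_smul, Rt_eq_one_sub_smul, rMat_eq]
  apply yang_baxter c hc hab ha.symm hb.symm
  rw [← inv_mul_linInv_sub (by norm_num) (by simpa using cast_sub_ne_zero hab),
    add_sub_add_right_eq_sub]

theorem exchange_word (c : Kind) (hc : c = .symplectic → Even N)
    (σ : Fin m → Matrix (Idx N) (Idx N) A⟦X⟧)
    (hσ : ∀ a b : Fin m, a < b → Reflection c (σ a) (σ b)
      (PowerSeries.C ((b : ℂ) - (a : ℂ))⁻¹) (-linInv (-2) ((a : ℕ) + (b : ℕ)))) :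
    Exchange (word (Rt c) fun a => onCopy a (σ a)) := by
  intro l₁ l₂ a b hab hl
  have hr : Exchanges (Rt c) (fun a => onCopy a (σ a)) a b (rMat N A⟦X⟧ a b) :=
    { commute_letter := fun p hpa hpb => commute_rMat_onCopy hpa hpb _
      commute_pair := fun p q hpa hpb hqa hqb _ => commute_rMat_Rt c hpa hpb hqa hqb
      reflection := by
        have := reflection_copies c hab.ne (hσ a b hab)
        rwa [neg_smul, ← sub_eq_add_neg, ← Rt_eq_one_sub_smul, ← rMat_eq] at this
      yang_baxter := fun q hqa hqb => rMat_mul_Rt_mul_Rt c hc hab.ne hqa hqb }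
  exact hr.mul_word (pairOperators_Rt c) (fun p a b ha hb => commute_onCopy_Rt c ha hb _) hl

theorem bracket_eq_word (c : Kind) (S : Matrix (Idx N) (Idx N) A⟦X⟧) (l : List (Fin m)) :
    bracket c S l = word (Rt c) (shifted S) l := by
  induction l with
  | nil => rfl
  | cons p ps ih => rw [bracket, word, ih]

theorem inv_sub_mul_linInv_sub {x y : ℂ} (hxy : y - x ≠ 0) :
    PowerSeries.C (y - x)⁻¹ * (linInv 1 (-y) - linInv 1 (-x)) = linInv 1 (-x) * linInv 1 (-y) := by
  have h := inv_mul_linInv_sub one_ne_zero (b := -y) (b' := -x) (by rwa [neg_sub_neg])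
  rwa [neg_sub_neg, mul_comm (linInv 1 (-y))] at h

theorem exchange_bracket {c : Kind} (hc : c = .symplectic → Even N)
    {S : Matrix (Idx N) (Idx N) A⟦X⟧} (hS : QuaternaryCoeffs c S) :
    Exchange (bracket (m := m) c S) := by
  have hword : bracket (m := m) c S = word (Rt c) (shifted S) :=
    funext fun l => bracket_eq_word c S l
  rw [hword]
  exact exchange_word c hc (fun a => S.map (atLin 1 (-((a : ℕ) : ℂ)))) fun a b hab =>
    reflection_of_quaternaryCoeffs hS (constantCoeff_linInv _ _) (constantCoeff_linInv _ _)
      (linInv_ne_zero one_ne_zero _) (linInv_ne_zero one_ne_zero _)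
      (inv_sub_mul_linInv_sub (cast_sub_ne_zero hab.ne)) (neg_linInv_neg_two_mul_add _ _)

theorem exchange_prod_shifted {T : Matrix (Idx N) (Idx N) A⟦X⟧}
    (hT : ∀ i j k l, rttDefect T i j k l = 0) :
    Exchange fun l : List (Fin m) => (l.map (shifted T)).prod := by
  refine exchange_prod (fun a => T.map (atLin 1 (-((a : ℕ) : ℂ)))) fun a b hab i j k l => ?_
  rw [← C_series_smul]
  exact rtt_of_rttDefect_eq_zero hT (constantCoeff_linInv _ _) (constantCoeff_linInv _ _)
    (linInv_ne_zero one_ne_zero _) (linInv_ne_zero one_ne_zero _)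
    (inv_sub_mul_linInv_sub (cast_sub_ne_zero hab.ne)) i j k l

theorem reflection_one (c : Kind) (α β : ℂ⟦X⟧) :
    Reflection c (1 : Matrix (Idx N) (Idx N) A⟦X⟧) 1 α β := by
  rw [← reflection_two_iff, fstCopy_one, sndCopy_one, mul_one, one_mul]
  simp only [sub_mul, mul_add, mul_sub, add_mul, one_mul, mul_one, smul_mul_assoc, mul_smul_comm,
    flipMat_mul_qMat, qMat_mul_flipMat, smul_add, smul_sub]
  rw [smul_comm β α]
  abel

theorem exchange_word_one (c : Kind) (hc : c = .symplectic → Even N) :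
    Exchange (word (Rt c) fun _ =>
      (1 : Matrix (Fin m → Idx N) (Fin m → Idx N) A⟦X⟧)) := by
  simpa only [onCopy_one] using
    exchange_word (A := A) c hc (fun _ => 1) fun _ _ _ => reflection_one c _ _

end Brackets

section Maps

variable {N m : ℕ}

theorem map_word {ι M M' : Type*} [Monoid M] [Monoid M'] (f : M →* M') (R : ι → ι → M)
    (σ : ι → M) (l : List ι) :
    f (word R σ l) = word (fun a b => f (R a b)) (fun a => f (σ a)) l := by
  induction l with
  | nil => exact map_one f
  | cons p ps ih =>
    rw [word, word, map_mul, map_mul, ih, map_list_prod, List.map_map]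
    rfl

theorem word_one {ι M : Type*} [Monoid M] (l : List ι) :
    word (fun _ _ : ι => (1 : M)) (fun _ => 1) l = 1 := by
  induction l with
  | nil => rfl
  | cons p ps ih => simp [word, ih]

section RingHom

variable {B B' : Type*} [Ring B] [Ring B'] (f : B →+* B')

theorem map_antisym : (antisym N m B).map f = antisym N m B' := by
  ext x y
  simp only [antisym, Matrix.map_apply, Matrix.of_apply, map_sum, apply_ite f, map_intCast,
    map_zero]

theorem map_onCopy (a : Fin m) (M : Matrix (Idx N) (Idx N) B) :
    (onCopy a M).map f = onCopy a (M.map f) := by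
  ext x y
  simp only [onCopy, Matrix.map_apply, Matrix.of_apply, apply_ite f, map_zero]

theorem map_mul_scalar {ι : Type*} [Fintype ι] [DecidableEq ι] (M : Matrix ι ι B) (q : B) :
    (M * Matrix.scalar ι q).map f = M.map f * Matrix.scalar ι (f q) := by
  rw [Matrix.map_mul]
  simp [Matrix.scalar_apply, Matrix.diagonal_map]

end RingHom

theorem constantCoeff_eq_one_of_antisym_mul {B : Type*} [Ring B]
    {G : Matrix (Fin N → Idx N) (Fin N → Idx N) B⟦X⟧}
    {q : B⟦X⟧} (hG : G.map constantCoeff = 1)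
    (h : antisym N N B⟦X⟧ * G = antisym N N B⟦X⟧ * Matrix.scalar (Fin N → Idx N) q) :
    constantCoeff q = 1 := by
  have hmap := congrArg (fun M => M.map constantCoeff) h
  beta_reduce at hmap
  rw [map_mul_scalar, Matrix.map_mul, map_antisym, hG, mul_one] at hmap
  exact antisym_mul_scalar_injective (hmap.symm.trans (by simp))

variable {A : Type*} [Ring A] [Algebra ℂ A]

theorem map_constantCoeff_Rt (c : Kind) (a b : Fin m) :
    (Rt c a b : Matrix (Fin m → Idx N) (Fin m → Idx N) A⟦X⟧).map constantCoeff = 1 := by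
  have hQ : (linInv (-2) ((a : ℕ) + (b : ℕ)) • onCopies a b (qMat c N A⟦X⟧)).map constantCoeff
      = 0 := by
    ext x y
    rw [Matrix.map_apply, Matrix.smul_apply, series_smul_def, map_mul,
      ← coeff_zero_eq_constantCoeff_apply, coeff_map, coeff_zero_eq_constantCoeff_apply,
      constantCoeff_linInv, map_zero, zero_mul, Matrix.zero_apply]
  rw [Rt_eq_one_sub_smul, Matrix.map_sub _ (map_sub _), hQ, sub_zero,
    Matrix.map_one _ (map_zero _) (map_one _)]

theorem map_constantCoeff_shifted (a : Fin m) {M : Matrix (Idx N) (Idx N) A⟦X⟧}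
    (hM : M.map constantCoeff = 1) : (shifted M a).map constantCoeff = 1 := by
  have hatLin : (M.map (atLin 1 (-((a : ℕ) : ℂ)))).map constantCoeff = 1 := by
    rw [← hM]
    ext i j
    simp only [Matrix.map_apply, atLin_eq_evalAt, constantCoeff_evalAt]
  rw [shifted, map_onCopy, hatLin, onCopy_one]

theorem map_constantCoeff_Tmat : (Tmat N).map constantCoeff = 1 := by
  ext i j
  rw [Matrix.map_apply, Tmat, Matrix.of_apply, ← coeff_zero_eq_constantCoeff_apply, coeff_mk, gen,
    Matrix.one_apply, apply_ite (RingQuot.mkAlgHom ℂ (YangianRel N)), map_one, map_zero]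

theorem map_constantCoeff_Smat (c : Kind) : (Smat c N).map constantCoeff = 1 := by
  ext i j
  rw [Matrix.map_apply, Smat, Matrix.of_apply, ← coeff_zero_eq_constantCoeff_apply, coeff_mk, gen,
    Matrix.one_apply, apply_ite (RingQuot.mkAlgHom ℂ (TwistedRel c N)), map_one, map_zero]

theorem exists_isQdet {T : Matrix (Idx N) (Idx N) A⟦X⟧}
    (hT : ∀ i j k l, rttDefect T i j k l = 0) (hT1 : T.map constantCoeff = 1) :
    ∃ q, IsQdet T q := by
  obtain ⟨q, hleft, hright⟩ := (exchange_prod_shifted (m := N) hT).exists_det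
  refine ⟨q, constantCoeff_eq_one_of_antisym_mul ?_ hleft, hleft, hright⟩
  refine (map_list_prod (constantCoeff (R := A)).mapMatrix _).trans ?_
  rw [List.map_map]
  exact List.prod_eq_one (List.forall_mem_map.2 fun a _ => map_constantCoeff_shifted a hT1)

theorem exists_isSdet {c : Kind} (hc : c = .symplectic → Even N)
    {S : Matrix (Idx N) (Idx N) A⟦X⟧} (hS : QuaternaryCoeffs c S)
    (hS1 : S.map constantCoeff = 1) : ∃ d, IsSdet c S d := by
  obtain ⟨d, hleft, hright⟩ := (exchange_bracket hc hS).exists_det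
  refine ⟨d, constantCoeff_eq_one_of_antisym_mul ?_ hleft, hleft, hright⟩
  rw [bracket_eq_word]
  refine (map_word (constantCoeff (R := A)).mapMatrix.toMonoidHom (Rt c)
    (shifted (m := N) S) (List.finRange N)).trans ?_
  rw [← word_one (M := Matrix (Fin N → Idx N) (Fin N → Idx N) A) (List.finRange N)]
  congr 1
  · exact funext₂ fun a b => map_constantCoeff_Rt c a b
  · exact funext fun a => map_constantCoeff_shifted a hS1

theorem isQdet_unique {T : Matrix (Idx N) (Idx N) A⟦X⟧} {q q' : A⟦X⟧} (h : IsQdet T q)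
    (h' : IsQdet T q') : q = q' :=
  antisym_mul_scalar_injective (h.2.1.symm.trans h'.2.1)

theorem isSdet_unique {c : Kind} {S : Matrix (Idx N) (Idx N) A⟦X⟧} {d d' : A⟦X⟧}
    (h : IsSdet c S d) (h' : IsSdet c S d') : d = d' :=
  antisym_mul_scalar_injective (h.2.1.symm.trans h'.2.1)

end Maps

/-! ### The homomorphism to the Yangian -/

section TwoCopies

variable {N : ℕ} {B : Type*} [Ring B]

theorem fstCopy_mul (M M' : Matrix (Idx N) (Idx N) B) :
    fstCopy (M * M') = fstCopy M * fstCopy M' := by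
  ext ⟨i, k⟩ ⟨j, l⟩
  rw [fstCopy_mul_apply]
  simp only [fstCopy, Matrix.of_apply, Matrix.mul_apply]
  split_ifs <;> simp

theorem sndCopy_mul (M M' : Matrix (Idx N) (Idx N) B) :
    sndCopy (M * M') = sndCopy M * sndCopy M' := by
  ext ⟨i, k⟩ ⟨j, l⟩
  rw [sndCopy_mul_apply]
  simp only [sndCopy, Matrix.of_apply, Matrix.mul_apply]
  split_ifs <;> simp

theorem flipMat_mul_flipMat : flipMat N B * flipMat N B = 1 := by
  ext x y
  rw [flipMat_mul_apply, flipMat, Matrix.of_apply, Prod.swap_swap, Matrix.one_apply]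

theorem flipMat_mul_fstCopy (M : Matrix (Idx N) (Idx N) B) :
    flipMat N B * fstCopy M = sndCopy M * flipMat N B := by
  ext x y
  rw [flipMat_mul_apply, mul_flipMat_apply]
  rfl

theorem flipMat_mul_sndCopy (M : Matrix (Idx N) (Idx N) B) :
    flipMat N B * sndCopy M = fstCopy M * flipMat N B := by
  ext x y
  rw [flipMat_mul_apply, mul_flipMat_apply]
  rfl

variable {K : Type*} [CommRing K] [Algebra K B]

theorem flipMat_mul_one_sub_smul_qMat (c : Kind) (α : K) :
    flipMat N B * (1 - α • qMat c N B) = (1 - α • qMat c N B) * flipMat N B := by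
  simp only [mul_sub, sub_mul, one_mul, mul_one, smul_mul_assoc, mul_smul_comm,
    flipMat_mul_qMat, qMat_mul_flipMat]

theorem rtt_twT_two (c : Kind) (hc : c = .symplectic → Even N)
    {T T' : Matrix (Idx N) (Idx N) B} {α : K} (h : RTT T T' α) :
    sndCopy (twT c T) * ((1 - α • qMat c N B) * fstCopy T')
      = fstCopy T' * ((1 - α • qMat c N B) * sndCopy (twT c T)) := by
  have hflip := congrArg (flipMat N B * ·) (rtt_two_twT c hc h)
  have hQ := flipMat_mul_one_sub_smul_qMat (N := N) (B := B) c α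
  generalize 1 - α • qMat c N B = k at hflip hQ ⊢
  simp only [← mul_assoc, flipMat_mul_fstCopy, flipMat_mul_sndCopy] at hflip
  simp only [mul_assoc, hQ] at hflip
  simp only [flipMat_mul_fstCopy, flipMat_mul_sndCopy] at hflip
  simpa only [mul_assoc, flipMat_mul_flipMat, mul_one] using
    congrArg (· * flipMat N B) hflip

theorem reflection_of_rtt (c : Kind) (hc : c = .symplectic → Even N)
    {T T' U U' : Matrix (Idx N) (Idx N) B} {α β : K} (hTT' : RTT T T' α)
    (hUT' : RTT U T' (-β)) (hU'T : RTT U' T (-β)) (hU'U : RTT U' U α) :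
    Reflection c (T * twT c U) (T' * twT c U') α β := by
  rw [← reflection_two_iff, fstCopy_mul, sndCopy_mul]
  have hR := rtt_two hTT'
  have hRt := rtt_two_twT c hc hUT'
  have hRt' := rtt_twT_two c hc hU'T
  have hR' := rtt_two (rtt_twT c hU'U)
  rw [neg_smul, sub_neg_eq_add] at hRt hRt'
  have hcomm : (1 - α • flipMat N B) * (1 + β • qMat c N B)
      = (1 + β • qMat c N B) * (1 - α • flipMat N B) := by
    have := flipMat_mul_one_sub_smul_qMat (N := N) (B := B) c (-β)
    rw [neg_smul, sub_neg_eq_add] at this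
    rw [sub_mul, mul_sub, one_mul, mul_one, smul_mul_assoc, mul_smul_comm, this]
  generalize 1 - α • flipMat N B = r at *
  generalize 1 + β • qMat c N B = k at *
  generalize fstCopy T = T₁ at *
  generalize sndCopy T' = T₂ at *
  generalize fstCopy (twT c U) = U₁ at *
  generalize sndCopy (twT c U') = U₂ at *
  calc r * (T₁ * U₁ * (k * (T₂ * U₂))) = r * T₁ * (U₁ * (k * T₂)) * U₂ := by
        simp only [mul_assoc]
    _ = r * (T₁ * T₂) * k * (U₁ * U₂) := by rw [hRt]; simp only [mul_assoc]
    _ = T₂ * T₁ * (r * k) * (U₁ * U₂) := by rw [hR]; simp only [mul_assoc]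
    _ = T₂ * T₁ * k * (r * (U₁ * U₂)) := by rw [hcomm]; simp only [mul_assoc]
    _ = T₂ * (T₁ * (k * U₂)) * U₁ * r := by rw [hR']; simp only [mul_assoc]
    _ = T₂ * U₂ * (k * (T₁ * U₁)) * r := by rw [← hRt']; simp only [mul_assoc]

end TwoCopies

section Symmetry

variable {N : ℕ} {B : Type*} [Ring B]

theorem mul_twT_apply (c : Kind) (T U : Matrix (Idx N) (Idx N) B) (i j : Idx N) :
    (T * twT c U) i j = ∑ a, (eps c (-j) * eps c (-a)) • (T i a * U (-j) (-a)) := by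
  simp only [Matrix.mul_apply, twT_apply, mul_smul_comm]

theorem θ_smul_mul_twT_neg_apply (c : Kind) (hc : c = .symplectic → Even N)
    (T U : Matrix (Idx N) (Idx N) B) (i j : Idx N) :
    θ c i j • (U * twT c T) (-j) (-i)
      = ∑ a, (eps c (-j) * eps c (-a)) • (U (-j) (-a) * T i a) := by
  rw [mul_twT_apply, smul_sum, ← Equiv.sum_comp (Equiv.neg (Idx N))]
  refine sum_congr rfl fun a _ => ?_
  simp only [Equiv.neg_apply, neg_neg, smul_smul, θ_eq]
  congr 1
  rw [eps_neg c j, eps_neg c a]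
  linear_combination (eps c j * eps c a) * eps_mul_self c hc i
    - (eps c j * eps c a) * c.sgn_mul_self

theorem sum_smul_sub_eq_mul_twT_sub (c : Kind) (T U : Matrix (Idx N) (Idx N) B) (i j : Idx N) :
    ∑ a, (eps c (-j) * eps c (-a)) • (U i (-a) * T (-j) a - T i (-a) * U (-j) a)
      = c.sgn • ((U * twT c T) i j - (T * twT c U) i j) := by
  rw [mul_twT_apply, mul_twT_apply, ← sum_sub_distrib, smul_sum,
    ← Equiv.sum_comp (Equiv.neg (Idx N))]
  refine sum_congr rfl fun a _ => ?_
  simp only [Equiv.neg_apply, neg_neg]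
  rw [← smul_sub, smul_smul]
  congr 1
  rw [eps_neg c a]
  linear_combination (-eps c (-j) * eps c a) * c.sgn_mul_self

theorem θ_smul_mul_twT_of_rtt {K : Type*} [CommRing K] [Algebra K B] (c : Kind)
    (hc : c = .symplectic → Even N) {T U : Matrix (Idx N) (Idx N) B} {h : K}
    (hrtt : RTT U T (-h)) (i j : Idx N) :
    θ c i j • (U * twT c T) (-j) (-i) = (T * twT c U) i j
      + ((c.sgn : K) * h) • ((T * twT c U) i j - (U * twT c T) i j) := by
  have hcomm (a : Idx N) : U (-j) (-a) * T i a = T i a * U (-j) (-a)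
      - h • (U i (-a) * T (-j) a - T i (-a) * U (-j) a) := by
    rw [sub_eq_add_neg, ← neg_smul, ← hrtt, add_sub_cancel]
  rw [θ_smul_mul_twT_neg_apply c hc]
  simp only [hcomm, smul_sub (_ : ℤ) (_ * _) (h • _), smul_comm (_ : ℤ) h]
  rw [sum_sub_distrib, ← mul_twT_apply, ← smul_sum, sum_smul_sub_eq_mul_twT_sub,
    ← Int.cast_smul_eq_zsmul K, smul_smul, mul_comm h, sub_eq_add_neg, ← smul_neg, neg_sub]

theorem twT_one (c : Kind) (hc : c = .symplectic → Even N) :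
    twT c (1 : Matrix (Idx N) (Idx N) B) = 1 := by
  ext i j
  rw [twT, Matrix.of_apply, θ_eq, Matrix.one_apply, Matrix.one_apply]
  by_cases h : i = j
  · subst h; rw [if_pos rfl, if_pos rfl, eps_mul_self c hc, one_smul]
  · rw [if_neg h, if_neg fun e => h (neg_injective e).symm, smul_zero]

theorem map_twT {B' : Type*} [Ring B'] (c : Kind) (f : B →+* B') (M : Matrix (Idx N) (Idx N) B) :
    (twT c M).map f = twT c (M.map f) := by
  ext i j
  simp only [Matrix.map_apply, twT, Matrix.of_apply, map_zsmul]

end Symmetry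

section TwistMat

variable {N : ℕ} {A : Type*} [Ring A] [Algebra ℂ A]

/-- The matrix `T(u) T^t(-u)`, which satisfies the relations of the twisted Yangian whenever `T(u)`
satisfies those of the Yangian. -/
def twistMat (c : Kind) (T : Matrix (Idx N) (Idx N) A⟦X⟧) : Matrix (Idx N) (Idx N) A⟦X⟧ :=
  T * twT c (T.map (atLin (-1) 0))

variable {T : Matrix (Idx N) (Idx N) A⟦X⟧}

theorem map_evalAt_mul {p : ℂ⟦X⟧} (hp : constantCoeff p = 0)
    (M M' : Matrix (Idx N) (Idx N) A⟦X⟧) :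
    (M * M').map (evalAt p) = M.map (evalAt p) * M'.map (evalAt p) :=
  Matrix.map_mul (f := evalHom A hp)

theorem map_evalAt_X (M : Matrix (Idx N) (Idx N) A⟦X⟧) : M.map (evalAt (X : ℂ⟦X⟧)) = M :=
  Matrix.ext fun i j => evalAt_X_left (M i j)

theorem twistMat_map_evalAt (c : Kind) {p : ℂ⟦X⟧} (hp : constantCoeff p = 0) :
    (twistMat c T).map (evalAt p) = T.map (evalAt p) * twT c (T.map (evalAt (-p))) := by
  rw [twistMat, map_evalAt_mul hp]
  congr 1
  refine (map_twT c (evalHom A hp : A⟦X⟧ →+* A⟦X⟧) _).trans (congrArg (twT c) ?_)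
  ext i j : 1
  have hneg : evalAt p (linInv (-1) 0) = -p := by
    rw [linInv_neg_one_zero, map_neg, evalAt_X hp, Algebra.algebraMap_self,
      PowerSeries.map_id, id]
  rw [← hneg]
  exact evalAt_evalAt hp (constantCoeff_linInv _ _) (T i j)

theorem map_constantCoeff_twistMat (c : Kind) (hc : c = .symplectic → Even N)
    (hT : T.map constantCoeff = 1) : (twistMat c T).map constantCoeff = 1 := by
  have hneg : (T.map (atLin (-1) 0)).map constantCoeff = 1 := by
    rw [← hT]
    ext i j
    simp only [Matrix.map_apply, atLin_eq_evalAt, constantCoeff_evalAt]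
  rw [twistMat, Matrix.map_mul, hT, one_mul, map_twT, hneg, twT_one c hc]

theorem reflection_twistMat (c : Kind) (hc : c = .symplectic → Even N)
    (hT : ∀ i j k l, rttDefect T i j k l = 0) {p q α β : ℂ⟦X⟧}
    (hp : constantCoeff p = 0) (hq : constantCoeff q = 0) (hp0 : p ≠ 0) (hq0 : q ≠ 0)
    (hα : α * (q - p) = p * q) (hβ : β * (p + q) = p * q) :
    Reflection c ((twistMat c T).map (evalAt p)) ((twistMat c T).map (evalAt q)) α β := by
  have hp' : constantCoeff (-p) = 0 := by rw [map_neg, hp, neg_zero]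
  have hq' : constantCoeff (-q) = 0 := by rw [map_neg, hq, neg_zero]
  have hp0' := neg_ne_zero.2 hp0
  have hq0' := neg_ne_zero.2 hq0
  rw [twistMat_map_evalAt c hp, twistMat_map_evalAt c hq]
  exact reflection_of_rtt c hc (rtt_of_rttDefect_eq_zero hT hp hq hp0 hq0 hα)
    (rtt_of_rttDefect_eq_zero hT hp' hq hp0' hq0 (by linear_combination -hβ))
    (rtt_of_rttDefect_eq_zero hT hq' hp hq0' hp0 (by linear_combination -hβ))
    (rtt_of_rttDefect_eq_zero hT hq' hp' hq0' hp0' (by linear_combination hα))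

theorem quaternaryCoeffs_twistMat (c : Kind) (hc : c = .symplectic → Even N)
    (hT : ∀ i j k l, rttDefect T i j k l = 0) : QuaternaryCoeffs c (twistMat c T) := by
  refine quaternaryCoeffs_of_reflection (K := ℂ) fun a ha ha_one ha_neg => ?_
  have h := reflection_twistMat c hc hT (p := X) (q := PowerSeries.C a * X) (by simp) (by simp)
    X_ne_zero (mul_ne_zero (by simpa using ha) X_ne_zero) (C_div_sub_one_mul ha_one)
    (C_div_add_one_mul ha_neg)
  rwa [map_evalAt_X] at h

theorem twistMat_symm (c : Kind) (hc : c = .symplectic → Even N)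
    (hT : ∀ i j k l, rttDefect T i j k l = 0) (i j : Idx N) :
    θ c i j • evalAt (-X : ℂ⟦X⟧) (twistMat c T (-j) (-i))
      = twistMat c T i j + (PowerSeries.C (c.pm / 2) * X : ℂ⟦X⟧) •
        (twistMat c T i j - evalAt (-X : ℂ⟦X⟧) (twistMat c T i j)) := by
  have two_mul_half : PowerSeries.C (1 / 2 : ℂ) * 2 = 1 := by
    rw [← map_ofNat PowerSeries.C, ← map_mul]; norm_num
  have hrtt := rtt_of_rttDefect_eq_zero hT (p := -X) (q := X)
    (α := -(PowerSeries.C (1 / 2 : ℂ) * X)) (by simp) (by simp) (neg_ne_zero.2 X_ne_zero) X_ne_zero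
    (by linear_combination -X ^ 2 * two_mul_half)
  have htwist : twistMat c T = T * twT c (T.map (evalAt (-X : ℂ⟦X⟧))) := by
    rw [twistMat, ← linInv_neg_one_zero]; rfl
  have hneg := twistMat_map_evalAt (T := T) c (p := -X) (by simp)
  rw [neg_neg, map_evalAt_X] at hneg
  rw [map_evalAt_X] at hrtt
  have hsgn : PowerSeries.C (c.pm / 2) = (c.sgn : ℂ⟦X⟧) * PowerSeries.C (1 / 2) := by
    cases c
    · simp [Kind.pm, Kind.sgn]
    · simp only [Kind.pm, Kind.sgn, neg_div, map_neg, Int.cast_neg, Int.cast_one, neg_mul, one_mul]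
  have key := θ_smul_mul_twT_of_rtt c hc hrtt i j
  rw [← hneg, ← htwist] at key
  rw [hsgn, mul_assoc]
  exact key

end TwistMat

section CoeffZ

variable {A : Type*} [Ring A]

theorem coeffZ_add (f g : A⟦X⟧) (r : ℤ) : coeffZ (f + g) r = coeffZ f r + coeffZ g r := by
  unfold coeffZ; split_ifs <;> simp

theorem coeffZ_sub (f g : A⟦X⟧) (r : ℤ) : coeffZ (f - g) r = coeffZ f r - coeffZ g r := by
  unfold coeffZ; split_ifs <;> simp

variable {K : Type*} [Field K] [Algebra K A]

theorem coeffZ_C_mul_X_smul (z : K) (f : A⟦X⟧) (r : ℤ) :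
    coeffZ ((PowerSeries.C z * X : K⟦X⟧) • f) r = z • coeffZ f (r - 1) := by
  rw [mul_smul, C_series_smul, X_series_smul]
  rcases lt_or_ge r 0 with h | h
  · rw [coeffZ_of_neg _ h, coeffZ_of_neg f (by omega), smul_zero]
  · obtain ⟨n, rfl⟩ := Int.eq_ofNat_of_zero_le h
    have := coeff_X_pow_mul_eq_coeffZ f 1 n
    rw [pow_one, Nat.cast_one] at this
    rw [coeffZ_natCast, coeff_smul, this]

theorem coeffZ_evalAt_neg_X (f : A⟦X⟧) (r : ℤ) :
    coeffZ (evalAt (-X : K⟦X⟧) f) r = (-1 : K) ^ r • coeffZ f r := by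
  have coeff_neg_X_pow (n k : ℕ) : coeff n ((-X : K⟦X⟧) ^ k) = if n = k then (-1) ^ k else 0 := by
    rw [neg_pow, ← map_one PowerSeries.C, ← map_neg, ← map_pow, coeff_C_mul, coeff_X_pow, mul_ite,
      mul_one, mul_zero]
  rcases lt_or_ge r 0 with h | h
  · rw [coeffZ_of_neg _ h, coeffZ_of_neg f h, smul_zero]
  · obtain ⟨n, rfl⟩ := Int.eq_ofNat_of_zero_le h
    rw [coeffZ_natCast, coeffZ_natCast, zpow_natCast, coeff_evalAt_eq_sum]
    simp [coeff_neg_X_pow]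

end CoeffZ

section Embedding

variable {N : ℕ}

/-- The homomorphism from the free algebra sending the symbol `s_{ij}^{(r)}` to the coefficient of
`u⁻ʳ` in the `(i, j)` entry of `T(u) T^t(-u)`. -/
def freeEmb (c : Kind) (N : ℕ) : FreeAlg N →ₐ[ℂ] Yangian N :=
  FreeAlgebra.lift ℂ fun x : Idx N × Idx N × ℕ => coeff (x.2.2 + 1) (twistMat c (Tmat N) x.1 x.2.1)

theorem freeEmb_gen (c : Kind) (hc : c = .symplectic → Even N) (i j : Idx N) (r : ℕ) :
    freeEmb c N (gen i j r) = coeff r (twistMat c (Tmat N) i j) := by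
  cases r with
  | zero =>
    have h := congrFun₂ (map_constantCoeff_twistMat c hc (map_constantCoeff_Tmat (N := N))) i j
    rw [Matrix.map_apply] at h
    rw [coeff_zero_eq_constantCoeff_apply, h, gen, Matrix.one_apply, apply_ite (freeEmb c N),
      map_one, map_zero]
  | succ n => simp [gen, freeEmb]

theorem freeEmb_genZ (c : Kind) (hc : c = .symplectic → Even N) (i j : Idx N) (r : ℤ) :
    freeEmb c N (genZ i j r) = coeffZ (twistMat c (Tmat N) i j) r := by
  unfold genZ coeffZ
  split_ifs
  · exact map_zero _
  · exact freeEmb_gen c hc i j _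

theorem freeEmb_rel (c : Kind) (hc : c = .symplectic → Even N) {x y : FreeAlg N}
    (h : TwistedRel c N x y) : freeEmb c N x = freeEmb c N y := by
  cases h with
  | quat i j k l r s =>
    simpa only [map_add, map_sub, map_mul, map_zsmul, Ring.lie_def, freeEmb_genZ c hc] using
      quaternaryCoeffs_twistMat c hc rttDefect_Tmat i j k l r s
  | symm i j r =>
    have h := congrArg (fun f => coeffZ f r) (twistMat_symm c hc rttDefect_Tmat i j)
    simpa only [coeffZ_zsmul, coeffZ_evalAt_neg_X, coeffZ_add, coeffZ_C_mul_X_smul, coeffZ_sub,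
      map_add, map_sub, map_zsmul, map_smul, freeEmb_genZ c hc] using h

theorem isEmb_iff (c : Kind) (hc : c = .symplectic → Even N)
    (φ : TwistedYangian c N →ₐ[ℂ] Yangian N) :
    IsEmb φ ↔ φ.comp (RingQuot.mkAlgHom ℂ (TwistedRel c N)) = freeEmb c N := by
  have coeff_map_Smat (i j : Idx N) (r : ℕ) :
      coeff r (PowerSeries.map (φ : TwistedYangian c N →+* Yangian N) (Smat c N i j))
        = φ.comp (RingQuot.mkAlgHom ℂ (TwistedRel c N)) (gen i j r) := by
    rw [coeff_map, Smat, Matrix.of_apply, coeff_mk]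
    rfl
  constructor
  · intro h
    ext ⟨i, j, r⟩
    have hij := congrArg (coeff (r + 1)) (congrFun₂ h i j)
    rw [Matrix.map_apply, coeff_map_Smat] at hij
    exact hij.trans (freeEmb_gen c hc i j (r + 1)).symm
  · intro h
    refine Matrix.ext fun i j => PowerSeries.ext fun r => ?_
    rw [Matrix.map_apply, coeff_map_Smat, h]
    exact freeEmb_gen c hc i j r

theorem existsUnique_isEmb (c : Kind) (N : ℕ) (hc : c = .symplectic → Even N) :
    ∃! φ : TwistedYangian c N →ₐ[ℂ] Yangian N, IsEmb φ := by
  simp only [isEmb_iff c hc]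
  refine ⟨RingQuot.liftAlgHom ℂ ⟨freeEmb c N, fun _ _ h => freeEmb_rel c hc h⟩, ?_, ?_⟩
  · ext x
    simp
  · intro φ h
    apply RingQuot.ringQuot_ext'
    rw [h]
    ext x
    simp

end Embedding

/-! ### The normalizing factor -/

section PartialWord

variable {N m : ℕ} {A : Type*} [Ring A] [Algebra ℂ A]

theorem mul_Rt_apply_of_ne (c : Kind) {a b : Fin m} (hab : a ≠ b)
    (M : Matrix (Fin m → Idx N) (Fin m → Idx N) A⟦X⟧) (x : Fin m → Idx N) {y : Fin m → Idx N}
    (hy : y a ≠ -y b) : (M * Rt c a b : Matrix _ _ A⟦X⟧) x y = M x y := by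
  rw [Rt_eq_one_sub_smul, mul_sub, mul_one, mul_smul_comm, Matrix.sub_apply, Matrix.smul_apply,
    mul_onCopies_qMat_apply c hab, if_neg hy, smul_zero, sub_zero]

theorem mul_prod_Rt_apply_of_ne (c : Kind) {p : Fin m} (x : Fin m → Idx N) {y : Fin m → Idx N}
    (l : List (Fin m)) (hl : ∀ q ∈ l, q ≠ p ∧ y q ≠ -y p)
    (M : Matrix (Fin m → Idx N) (Fin m → Idx N) A⟦X⟧) :
    (M * (l.map fun q => Rt c q p).prod : Matrix _ _ A⟦X⟧) x y = M x y := by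
  induction l generalizing M with
  | nil => simp
  | cons q l ih =>
    rw [List.forall_mem_cons] at hl
    rw [List.map_cons, List.prod_cons, ← mul_assoc, ih hl.2,
      mul_Rt_apply_of_ne c hl.1.1 M x hl.1.2]

/-- The antisymmetrizer times the ordered product of the `R^t_{pq}` with `p < q < k`. -/
def partialWord (c : Kind) (N : ℕ) (A : Type*) [Ring A] [Algebra ℂ A] (k : ℕ) :
    Matrix (Fin N → Idx N) (Fin N → Idx N) A⟦X⟧ :=
  antisym N N A⟦X⟧ * word (Rt c) (fun _ => 1) ((List.finRange N).take k)

theorem mem_take_finRange {k : ℕ} {q : Fin N} : q ∈ (List.finRange N).take k ↔ (q : ℕ) < k := by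
  rw [List.mem_take_iff_getElem]
  constructor
  · rintro ⟨i, hi, rfl⟩
    simp at hi ⊢
    omega
  · intro h
    exact ⟨q, by simp [h], by simp⟩

theorem nodup_take_finRange (k : ℕ) : ((List.finRange N).take k).Nodup :=
  (List.nodup_finRange N).sublist (List.take_sublist _ _)

theorem partialWord_succ (c : Kind) {k : ℕ} (hk : k < N) :
    partialWord c N A (k + 1)
      = partialWord c N A k * (((List.finRange N).take k).map fun q => Rt c q ⟨k, hk⟩).prod := by
  have take_succ : (List.finRange N).take (k + 1) = (List.finRange N).take k ++ [⟨k, hk⟩] := by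
    rw [List.take_add_one, List.getElem?_eq_getElem (by simpa using hk)]
    simp
  rw [partialWord, take_succ, (pairOperators_Rt c).word_concat (take_succ ▸ nodup_take_finRange _),
    partialWord, mul_assoc]

theorem swap_mem_signStabilizer_partialWord_of_ge (c : Kind) {k : ℕ} {a b : Fin N}
    (ha : k ≤ a) (hb : k ≤ b) : Equiv.swap a b ∈ signStabilizer (partialWord c N A k) := by
  have hne : ∀ p ∈ (List.finRange N).take k, p ≠ a ∧ p ≠ b := fun p hp => by
    rw [mem_take_finRange] at hp
    constructor <;> rintro rfl <;> omega
  have hcomm : Commute (permMat N A⟦X⟧ (Equiv.swap a b))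
      (word (Rt c) (fun _ => 1) ((List.finRange N).take k)) := by
    refine commute_word _ (fun _ _ => Commute.one_right _) (fun p hp q hq _ => ?_)
      (nodup_take_finRange k)
    rw [Rt_eq_one_sub_smul]
    exact commute_one_sub_smul (commute_permMat_swap_onCopies (hne p hp).1 (hne p hp).2
      (hne q hq).1 (hne q hq).2 _) _
  change partialWord c N A k * permMat N A⟦X⟧ (Equiv.swap a b) = _
  rw [partialWord, mul_assoc, ← hcomm.eq, ← mul_assoc, antisym_mul_permMat, smul_mul_assoc]

theorem swap_mem_signStabilizer_partialWord_of_adjacent (c : Kind)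
    (hc : c = .symplectic → Even N) {k : ℕ} {a b : Fin N} (hab : (b : ℕ) = a + 1)
    (hb : (b : ℕ) < k) : Equiv.swap a b ∈ signStabilizer (partialWord c N A k) := by
  obtain ⟨l₁, l₂, hl⟩ := exists_take_finRange_eq_append hab hb
  refine swap_mem_signStabilizer (by rintro rfl; omega) ?_
  rw [partialWord, hl]
  exact (exchange_word_one c hc).antisym_mul hab (hl ▸ nodup_take_finRange k)

theorem swap_mem_signStabilizer_partialWord_of_lt (c : Kind) (hc : c = .symplectic → Even N)
    {k : ℕ} {a b : Fin N} (ha : (a : ℕ) < k) (hb : (b : ℕ) < k) :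
    Equiv.swap a b ∈ signStabilizer (partialWord c N A k) := by
  wlog hab : a ≤ b generalizing a b
  · exact Equiv.swap_comm a b ▸ this hb ha (le_of_not_ge hab)
  obtain ⟨d, hd⟩ := Nat.exists_eq_add_of_le (Fin.le_def.1 hab)
  induction d generalizing b with
  | zero =>
    obtain rfl : a = b := Fin.ext hd.symm
    exact Equiv.swap_self a ▸ one_mem _
  | succ d ih =>
    have hlt : (a : ℕ) + d < N := by omega
    refine SubmonoidClass.swap_mem_trans _
      (ih (b := ⟨a + d, hlt⟩) (by simp; omega) (Fin.le_def.2 (by simp)) rfl) ?_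
    exact swap_mem_signStabilizer_partialWord_of_adjacent c hc (by simpa [add_assoc] using hd) hb

end PartialWord

section SymplecticConstant

variable {N : ℕ}

theorem neg_ne_self (hN : Even N) (i : Idx N) : -i ≠ i := by
  intro h
  have hval : -i.1 = i.1 := congrArg Subtype.val h
  have hi := i.2
  simp only [idxSet, Finset.mem_filter] at hi
  have := hi.2 hN
  omega

/-- Sets of indices which are unions of pairs `{i, -i}`. -/
def NegClosed (s : Set (Idx N)) : Prop :=
  ∀ i ∈ s, -i ∈ s

theorem swap_image_of_mem {ι : Type*} [DecidableEq ι] {a b : ι} {s : Set ι} (h : a ∈ s ↔ b ∈ s) :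
    Equiv.swap a b '' s = s := by
  rw [Equiv.image_eq_preimage_symm, Equiv.symm_swap]
  ext i
  rw [Set.mem_preimage, Equiv.swap_apply_def]
  split_ifs with h₁ h₂
  · rw [h₁, h]
  · rw [h₂, h]
  · rfl

theorem eq_smul_antisym_of_comp {K B : Type*} [CommRing K] [Ring B] [Algebra K B]
    {X : Matrix (Fin N → Idx N) (Fin N → Idx N) B} {σ : Equiv.Perm (Fin N)}
    (hσ : σ ∈ signStabilizer X) {x y : Fin N → Idx N} {z : K}
    (h : X x (y ∘ σ) = z • antisym N N B x (y ∘ σ)) : X x y = z • antisym N N B x y := by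
  rw [apply_comp_right hσ, apply_comp_right (antisym_mul_permMat σ), smul_comm] at h
  exact (smul_left_cancel_iff (Equiv.Perm.sign σ)).1 h

theorem update_update_neg_eq_comp_swap {o l : Fin N} (hol : o ≠ l) {y : Fin N → Idx N}
    (hy : y o = -y l) :
    Function.update (Function.update y o (- -y l)) l (-y l) = y ∘ Equiv.swap o l := by
  rw [neg_neg, ← hy, Equiv.comp_swap_eq_update, Function.update_comm hol]

theorem sum_eps_smul_apply_update {K B : Type*} [CommRing K] [Ring B] [Algebra K B]
    [IsAddTorsionFree B] (hN : Even N) {M : Matrix (Fin N → Idx N) (Fin N → Idx N) B}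
    {o l : Fin N} {s : Set (Fin N)} (hol : o ≠ l) (ho : o ∉ s) (hl : l ∉ s)
    (head : ∀ a ∈ s, Equiv.swap o a ∈ signStabilizer M)
    (tail : ∀ a ∉ s, a ≠ o → Equiv.swap l a ∈ signStabilizer M) {x : Fin N → Idx N} {z : K}
    (hM : ∀ y : Fin N → Idx N, Function.Injective y → NegClosed (y '' s) →
      M x y = z • antisym N N B x y)
    {y : Fin N → Idx N} (hy : Function.Injective y) (hyol : y o = -y l)
    (hys : NegClosed (y '' s)) :
    ∑ n, (eps .symplectic n * eps .symplectic (y l)) •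
      M x (Function.update (Function.update y o (-n)) l n) = (2 * z) • antisym N N B x y := by
  have value_swap : M x (y ∘ Equiv.swap o l) = -(z • antisym N N B x y) := by
    rw [hM _ (hy.comp (Equiv.injective _)), apply_comp_right (antisym_mul_permMat _),
      Equiv.Perm.sign_swap hol]
    · simp
    · rwa [Set.image_comp, swap_image_of_mem (by simp [ho, hl])]
  have update_self : Function.update (Function.update y o (-y l)) l (y l) = y := by
    rw [← hyol, Function.update_eq_self, Function.update_eq_self]
  have vanish : ∀ i, i ≠ o → i ≠ l →
      M x (Function.update (Function.update y o (-y i)) l (y i)) = 0 := by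
    intro i hio hil
    by_cases hi : i ∈ s
    · obtain ⟨j, hj, hji⟩ := hys _ (Set.mem_image_of_mem y hi)
      have hjo : j ≠ o := by rintro rfl; exact ho hj
      have hjl : j ≠ l := by rintro rfl; exact hl hj
      exact apply_eq_zero_of_swap_mem_signStabilizer hjo.symm (head j hj) x
        (by simp [hol, hjo, hjl, hji])
    · exact apply_eq_zero_of_swap_mem_signStabilizer hil.symm (tail i hi hio) x
        (by simp [hil, hio])
  have hyl := neg_ne_self hN (y l)
  rw [← sum_subset (subset_univ {y l, -y l}), sum_pair hyl.symm, update_self,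
    update_update_neg_eq_comp_swap hol hyol, value_swap, hM y hy hys, eps_neg, mul_assoc,
    eps_mul_self _ fun _ => hN, two_mul, add_smul]
  · simp [Kind.sgn]
  · intro n _ hn
    simp only [mem_insert, mem_singleton, not_or] at hn
    obtain ⟨σ, rfl⟩ := exists_eq_enum_comp hy
    obtain ⟨i, rfl⟩ := ((enum N).surjective.comp σ.surjective) n
    rw [vanish i (by rintro rfl; exact hn.2 hyol) (by rintro rfl; exact hn.1 rfl), smul_zero]

variable {A : Type*} [Ring A] [Algebra ℂ A]

theorem partialWord_odd_apply (c : Kind) (hc : c = .symplectic → Even N) {k : ℕ} (hk : k < N)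
    {z : ℂ⟦X⟧} {x : Fin N → Idx N}
    (ih : ∀ y : Fin N → Idx N, Function.Injective y → NegClosed (y '' {i | (i : ℕ) < k}) →
      partialWord c N A k x y = z • antisym N N A⟦X⟧ x y)
    {p : Fin N} (hp : (p : ℕ) < k + 1) {y : Fin N → Idx N} (hy : Function.Injective y)
    (hyp : NegClosed (y '' ({i | (i : ℕ) < k + 1} \ {p}))) :
    partialWord c N A (k + 1) x y = z • antisym N N A⟦X⟧ x y := by
  set last : Fin N := ⟨k, hk⟩ with last_def
  have eq_of_closed : ∀ y : Fin N → Idx N, Function.Injective y →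
      NegClosed (y '' {i | (i : ℕ) < k}) →
      partialWord c N A (k + 1) x y = z • antisym N N A⟦X⟧ x y := by
    intro y hy hyk
    rw [partialWord_succ c hk, mul_prod_Rt_apply_of_ne c, ih y hy hyk]
    intro q hq
    rw [mem_take_finRange] at hq
    refine ⟨by rintro rfl; exact lt_irrefl k hq, fun h => ?_⟩
    obtain ⟨j, hj, hjq⟩ := hyk _ (Set.mem_image_of_mem y hq)
    rw [h, neg_neg] at hjq
    obtain rfl := hy hjq
    exact lt_irrefl k hj
  refine eq_smul_antisym_of_comp (swap_mem_signStabilizer_partialWord_of_lt c hc hp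
    (show (last : ℕ) < k + 1 by simp [last_def])) (eq_of_closed _ (hy.comp (Equiv.injective _)) ?_)
  have swap_image : Equiv.swap p last '' {i : Fin N | (i : ℕ) < k}
      = {i : Fin N | (i : ℕ) < k + 1} \ {p} := by
    rw [Equiv.image_eq_preimage_symm, Equiv.symm_swap]
    ext i
    simp only [Set.mem_preimage, Set.mem_ofPred_eq, Equiv.swap_apply_def, Set.mem_sdiff,
      Set.mem_singleton_iff]
    split_ifs <;> simp_all [Fin.ext_iff] <;> omega
  rwa [Set.image_comp, swap_image]

theorem negClosed_image_diff {o l : Fin N} {s : Set (Fin N)} {y : Fin N → Idx N}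
    (hy : Function.Injective y) (hyol : y o = -y l) (hl : l ∉ s)
    (hys : NegClosed (y '' insert l s)) : NegClosed (y '' (s \ {o})) := by
  rintro _ ⟨i, ⟨his, hio⟩, rfl⟩
  obtain ⟨j, hj, hji⟩ := hys _ (Set.mem_image_of_mem y (Set.mem_insert_of_mem l his))
  have hjl : j ≠ l := by
    rintro rfl
    exact hio (hy (by rw [hyol, hji, neg_neg]))
  have hjo : j ≠ o := by
    rintro rfl
    rw [hyol, neg_inj] at hji
    exact hl (hy hji ▸ his)
  exact ⟨j, ⟨Set.mem_of_mem_insert_of_ne hj hjl, hjo⟩, hji⟩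

theorem partialWord_apply_of_eq_neg (c : Kind) {k : ℕ} {o l : Fin N} (ho : (o : ℕ) = 0)
    (hl : (l : ℕ) = k + 1) (x : Fin N → Idx N) {y : Fin N → Idx N} (hy : Function.Injective y)
    (hyol : y o = -y l) :
    partialWord c N A (k + 2) x y = partialWord c N A (k + 1) x y - linInv (-2) (k + 1) •
      ∑ n, (eps c n * eps c (y l)) •
        partialWord c N A (k + 1) x (Function.update (Function.update y o (-n)) l n) := by
  have hol : o ≠ l := by rintro rfl; omega
  have hkN : k + 1 < N := hl ▸ l.2
  obtain rfl : l = ⟨k + 1, hkN⟩ := Fin.ext hl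
  obtain ⟨t, ht⟩ : ∃ t, (List.finRange N).take (k + 1) = o :: t := by
    obtain ⟨n, rfl⟩ : ∃ n, N = n + 1 := ⟨N - 1, by omega⟩
    obtain rfl : o = 0 := Fin.ext ho
    exact ⟨_, by rw [List.finRange_succ, List.take_succ_cons]⟩
  have t_ne : ∀ q ∈ t, q ≠ ⟨k + 1, hkN⟩ ∧ y q ≠ -y ⟨k + 1, hkN⟩ := fun q hq => by
    have hqk : (q : ℕ) < k + 1 := mem_take_finRange.1 (ht ▸ List.mem_cons_of_mem o hq)
    refine ⟨by rintro rfl; exact lt_irrefl _ hqk, fun h => ?_⟩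
    have ho_notMem := (List.nodup_cons.1 (ht ▸ nodup_take_finRange (k + 1))).1
    exact ho_notMem (hy (hyol.trans h.symm) ▸ hq)
  rw [partialWord_succ c hkN, ht, List.map_cons, List.prod_cons, ← mul_assoc,
    mul_prod_Rt_apply_of_ne c x t t_ne, Rt_eq_one_sub_smul, mul_sub, mul_one, mul_smul_comm,
    Matrix.sub_apply, Matrix.smul_apply, mul_onCopies_qMat_apply _ hol, if_pos hyol, ho, hl]
  simp

theorem partialWord_even_apply_of_eq_neg (hN : Even N) {k : ℕ} {o l : Fin N} (ho : (o : ℕ) = 0)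
    (hl : (l : ℕ) = 2 * k + 1) {z : ℂ⟦X⟧} {x : Fin N → Idx N}
    (ih : ∀ y : Fin N → Idx N, Function.Injective y →
      NegClosed (y '' {i | (i : ℕ) < 2 * k}) →
      partialWord .symplectic N A (2 * k) x y = z • antisym N N A⟦X⟧ x y)
    {y : Fin N → Idx N} (hy : Function.Injective y) (hyol : y o = -y l)
    (hyk : NegClosed (y '' {i | (i : ℕ) < 2 * k + 2})) :
    partialWord .symplectic N A (2 * k + 2) x y
      = ((1 - 2 * linInv (-2) (2 * k + 1)) * z) • antisym N N A⟦X⟧ x y := by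
  have : IsAddTorsionFree A⟦X⟧ := .of_isTorsionFree ℂ _
  set s : Set (Fin N) := {i | (i : ℕ) < 2 * k + 1} with s_def
  have hol : o ≠ l := by rintro rfl; omega
  have hls : l ∉ s := by simp [hl, s_def]
  have hos : (o : ℕ) < 2 * k + 1 := by omega
  have insert_s : {i : Fin N | (i : ℕ) < 2 * k + 2} = insert l s := by
    ext i
    simp only [s_def, Set.mem_ofPred_eq, Set.mem_insert_iff, Fin.ext_iff]
    omega
  have hys : NegClosed (y '' (s \ {o})) := negClosed_image_diff hy hyol hls (insert_s ▸ hyk)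
  have odd_apply : ∀ y : Fin N → Idx N, Function.Injective y → NegClosed (y '' (s \ {o})) →
      partialWord .symplectic N A (2 * k + 1) x y = z • antisym N N A⟦X⟧ x y :=
    fun y hy hys =>
      partialWord_odd_apply .symplectic (fun _ => hN) (by omega) ih hos hy hys
  have sum_eq := sum_eps_smul_apply_update (s := s \ {o}) hN hol (by simp) (fun h => hls h.1)
    (fun a ha => swap_mem_signStabilizer_partialWord_of_lt .symplectic (fun _ => hN) hos ha.1)
    (fun a ha hao => swap_mem_signStabilizer_partialWord_of_ge .symplectic hl.ge
      (not_lt.1 fun h => ha ⟨h, hao⟩)) odd_apply hy hyol hys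
  rw [partialWord_apply_of_eq_neg .symplectic ho hl x hy hyol, sum_eq, odd_apply y hy hys,
    smul_smul, ← sub_smul]
  congr 1
  push_cast
  ring

/-- The series `(2u + 1) / (2u - 2k + 1)`. -/
def symplecticFactor (k : ℕ) : ℂ⟦X⟧ :=
  (PowerSeries.C 2 + X) * (PowerSeries.C 2 + PowerSeries.C (1 - 2 * (k : ℂ)) * X)⁻¹

theorem symplecticFactor_mul (k : ℕ) :
    symplecticFactor k * (PowerSeries.C 2 + PowerSeries.C (1 - 2 * (k : ℂ)) * X)
      = PowerSeries.C 2 + X := by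
  rw [symplecticFactor, mul_assoc, PowerSeries.inv_mul_cancel _ (by simp), mul_one]

theorem symplecticFactor_zero : symplecticFactor 0 = 1 := by
  have := symplecticFactor_mul 0
  rw [Nat.cast_zero, mul_zero, sub_zero, map_one, one_mul] at this
  refine mul_right_cancel₀ (fun h => ?_) (this.trans (one_mul _).symm)
  simpa using congrArg constantCoeff h

theorem symplecticFactor_succ (k : ℕ) :
    symplecticFactor (k + 1) = (1 - 2 * linInv (-2) (2 * k + 1)) * symplecticFactor k := by
  have denominator_ne_zero :
      (PowerSeries.C 2 + PowerSeries.C (1 - 2 * ((k + 1 : ℕ) : ℂ)) * X : ℂ⟦X⟧) ≠ 0 := fun h => by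
    simpa using congrArg constantCoeff h
  apply mul_right_cancel₀ denominator_ne_zero
  rw [symplecticFactor_mul, ← symplecticFactor_mul k]
  have linInv_mul := linear_mul_linInv (a := -2) (by norm_num) (2 * k + 1)
  simp only [Nat.cast_add, Nat.cast_one, map_add, map_sub, map_mul, map_neg, map_one, map_ofNat,
    mul_add, mul_one] at linInv_mul ⊢
  linear_combination (-2 * symplecticFactor k) * linInv_mul

theorem partialWord_even_apply (hN : Even N) (k : ℕ) (hk : 2 * k ≤ N) (x : Fin N → Idx N)
    {y : Fin N → Idx N} (hy : Function.Injective y)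
    (hyk : NegClosed (y '' {i | (i : ℕ) < 2 * k})) :
    partialWord .symplectic N A (2 * k) x y = symplecticFactor k • antisym N N A⟦X⟧ x y := by
  induction k generalizing y with
  | zero => simp [partialWord, word, symplecticFactor_zero]
  | succ k ih =>
    have hkN : 2 * k + 1 < N := by omega
    set o : Fin N := ⟨0, by omega⟩ with o_def
    set l : Fin N := ⟨2 * k + 1, hkN⟩ with l_def
    have hl : (l : ℕ) < 2 * (k + 1) := by simp [l_def]; omega
    have ho : (o : ℕ) < 2 * (k + 1) := by simp [o_def]
    obtain ⟨j, hj, hjl⟩ : ∃ j : Fin N, (j : ℕ) < 2 * (k + 1) ∧ y j = -y l :=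
      hyk _ (Set.mem_image_of_mem y hl)
    have hlj : l ≠ j := by
      rintro rfl
      exact neg_ne_self hN _ hjl.symm
    have hol : l ≠ o := by simp [o_def, l_def]
    refine eq_smul_antisym_of_comp
      (swap_mem_signStabilizer_partialWord_of_lt .symplectic (fun _ => hN) ho hj) ?_
    rw [symplecticFactor_succ]
    refine partialWord_even_apply_of_eq_neg hN (o := o) (l := l) rfl rfl
      (fun y hy => ih (by omega) hy) (hy.comp (Equiv.injective _)) ?_ ?_
    · rw [Function.comp_apply, Function.comp_apply, Equiv.swap_apply_left,
        Equiv.swap_apply_of_ne_of_ne hol hlj, hjl]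
    · rw [Set.image_comp, swap_image_of_mem (s := {i : Fin N | (i : ℕ) < 2 * k + 2})
        (iff_of_true ho hj)]
      exact hyk

theorem antisym_mul_word_one_symplectic (hN : Even N) :
    antisym N N A⟦X⟧ * word (Rt .symplectic) (fun _ => 1) (List.finRange N)
      = antisym N N A⟦X⟧
        * Matrix.scalar (Fin N → Idx N) (scalarSeries A (symplecticFactor (N / 2))) := by
  obtain ⟨g, hg, -⟩ := (exchange_word_one (N := N) (m := N) (A := A) .symplectic
    fun _ => hN).exists_det
  have two_mul_half : 2 * (N / 2) = N := Nat.two_mul_div_two_of_even hN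
  have enum_closed : NegClosed (enum N '' {i : Fin N | (i : ℕ) < 2 * (N / 2)}) := by
    rintro _ ⟨i, -, rfl⟩
    exact ⟨i.rev, two_mul_half.symm ▸ i.rev.2, enum_rev N i⟩
  have entry := partialWord_even_apply (A := A) hN (N / 2) two_mul_half.le (enum N)
    (enum N).injective enum_closed
  rw [partialWord, List.take_of_length_le (by simp [two_mul_half]), hg, mul_scalar_apply,
    antisym_apply_enum, one_mul, series_smul_def, mul_one] at entry
  rw [hg, entry]
  rfl

end SymplecticConstant

section OrthogonalConstant

variable {N : ℕ} {A : Type*} [Ring A] [Algebra ℂ A]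

theorem antisym_mul_Rt_orthogonal {m : ℕ} {a b : Fin m} (hab : a ≠ b) :
    antisym N m A⟦X⟧ * Rt .orthogonal a b = antisym N m A⟦X⟧ := by
  have : IsAddTorsionFree (Matrix (Fin m → Idx N) (Fin m → Idx N) A⟦X⟧) := .of_isTorsionFree ℂ _
  have antisym_mul_eq_neg : antisym N m A⟦X⟧ * onCopies a b (qMat .orthogonal N A⟦X⟧)
      = -(antisym N m A⟦X⟧ * onCopies a b (qMat .orthogonal N A⟦X⟧)) := by
    rw [← neg_mul, ← antisym_mul_permMat_swap hab, mul_assoc, permMat_swap hab,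
      ← onCopies_mul hab, flipMat_mul_qMat, Kind.sgn, one_smul]
  rw [Rt_eq_one_sub_smul, mul_sub, mul_one, mul_smul_comm, self_eq_neg.1 antisym_mul_eq_neg,
    smul_zero, sub_zero]

theorem mul_word_one_eq_self {ι M : Type*} [Monoid M] {R : ι → ι → M} {x : M}
    (h : ∀ a b, a ≠ b → x * R a b = x) {l : List ι} (hl : l.Nodup) :
    x * word R (fun _ => 1) l = x := by
  have mul_prod_eq_self : ∀ p (l : List ι), p ∉ l → x * (l.map (R p)).prod = x := fun p l hp => by
    induction l with
    | nil => simp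
    | cons q l ih =>
      rw [List.mem_cons, not_or] at hp
      rw [List.map_cons, List.prod_cons, ← mul_assoc, h p q hp.1, ih hp.2]
  induction l with
  | nil => simp [word]
  | cons p l ih =>
    rw [List.nodup_cons] at hl
    rw [word, one_mul, ← mul_assoc, mul_prod_eq_self p l hl.1, ih hl.2]

theorem antisym_mul_word_one (c : Kind) (hc : c = .symplectic → Even N) :
    antisym N N A⟦X⟧ * word (Rt c) (fun _ => 1) (List.finRange N)
      = antisym N N A⟦X⟧ * Matrix.scalar (Fin N → Idx N) (scalarSeries A (γ N c)) := by
  cases c with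
  | orthogonal =>
    rw [mul_word_one_eq_self (fun _ _ => antisym_mul_Rt_orthogonal) (List.nodup_finRange N), γ,
      map_one, map_one, mul_one]
  | symplectic => exact antisym_mul_word_one_symplectic (hc rfl)

end OrthogonalConstant

/-! ### Transposition and reversal -/

section Transposition

variable {N m : ℕ} {B : Type*} [Ring B]

theorem onCopy_mul_apply (p : Fin m) (M : Matrix (Idx N) (Idx N) B)
    (C : Matrix (Fin m → Idx N) (Fin m → Idx N) B) (x y : Fin m → Idx N) :
    (onCopy p M * C) x y = ∑ i, M (x p) i * C (Function.update x p i) y := by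
  rw [Matrix.mul_apply]
  refine (sum_of_injOn (Function.update x p) (Function.update_injective x p).injOn (by simp)
    (fun z _ hz => ?_) fun i _ => ?_).symm
  · rw [onCopy, Matrix.of_apply, if_neg, zero_mul]
    exact fun h => hz ⟨z p, by simp, (Function.eq_update_iff.2 ⟨rfl, fun d hd =>
      (h d hd).symm⟩).symm⟩
  · rw [onCopy, Matrix.of_apply, if_pos fun d hd => (Function.update_of_ne hd _ _).symm,
      Function.update_self]

theorem prod_onCopy_apply (V : Fin m → Matrix (Idx N) (Idx N) B) {l : List (Fin m)}
    (hl : l.Nodup) (x y : Fin m → Idx N) : (l.map fun a => onCopy a (V a)).prod x y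
      = if ∀ d, d ∉ l → x d = y d then (l.map fun a => V a (x a) (y a)).prod else 0 := by
  induction l generalizing x with
  | nil => simp [Matrix.one_apply, funext_iff]
  | cons p l ih =>
    rw [List.nodup_cons] at hl
    have update_agrees (i : Idx N) : (∀ d, d ∉ l → Function.update x p i d = y d)
        ↔ i = y p ∧ ∀ d, d ∉ p :: l → x d = y d := by
      constructor
      · refine fun h => ⟨by simpa using h p hl.1, fun d hd => ?_⟩
        rw [List.mem_cons, not_or] at hd
        rw [← h d hd.2, Function.update_of_ne hd.1]
      · rintro ⟨rfl, h⟩ d hd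
        rcases eq_or_ne d p with rfl | hdp
        · rw [Function.update_self]
        · rw [Function.update_of_ne hdp, h d (by simp [hdp, hd])]
    have map_update (i : Idx N) : (l.map fun a => V a (Function.update x p i a) (y a))
        = l.map fun a => V a (x a) (y a) :=
      List.map_congr_left fun a ha => by
        rw [Function.update_of_ne (ne_of_mem_of_not_mem ha hl.1)]
    simp only [List.map_cons, List.prod_cons, onCopy_mul_apply, ih hl.2, update_agrees, map_update,
      ite_and, mul_ite, mul_zero, sum_ite_eq', mem_univ, if_true]

theorem prod_finRange_onCopy_apply (V : Fin m → Matrix (Idx N) (Idx N) B) (x y : Fin m → Idx N) :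
    ((List.finRange m).map fun a => onCopy a (V a)).prod x y
      = ((List.finRange m).map fun a => V a (x a) (y a)).prod := by
  rw [prod_onCopy_apply V (List.nodup_finRange m),
    if_pos fun d hd => absurd (List.mem_finRange d) hd]

theorem prod_map_zsmul {ι : Type*} (z : ι → ℤ) (v : ι → B) (l : List ι) :
    (l.map fun a => z a • v a).prod = (l.map z).prod • (l.map v).prod := by
  induction l with
  | nil => simp
  | cons p l ih => simp only [List.map_cons, List.prod_cons, ih, smul_mul_smul_comm]

/-- The sign `ε_{-x_1} ⋯ ε_{-x_m}` relating the matrix entries of a tensor product of matrices to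
those of the tensor product of their transposes. -/
def signProd (c : Kind) (x : Fin m → Idx N) : ℤ := ∏ a, eps c (-x a)

theorem signProd_mul_self (c : Kind) (hc : c = .symplectic → Even N) (x : Fin m → Idx N) :
    signProd c x * signProd c x = 1 := by
  rw [signProd, ← prod_mul_distrib]
  exact prod_eq_one fun a _ => eps_mul_self c hc _

theorem prod_onCopy_twT_apply (c : Kind) (V : Fin m → Matrix (Idx N) (Idx N) B)
    (x y : Fin m → Idx N) : ((List.finRange m).map fun a => onCopy a (twT c (V a))).prod x y
      = (signProd c x * signProd c y) •
        ((List.finRange m).map fun a => onCopy a (V a)).prod (-y) (-x) := by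
  simp only [prod_finRange_onCopy_apply, twT_apply, prod_map_zsmul, List.prod_map_mul, signProd,
    Fin.prod_univ_def, Pi.neg_apply, mul_comm]

theorem signProd_smul_antisym (c : Kind) (x y : Fin m → Idx N) :
    signProd c x • antisym N m B x y = signProd c y • antisym N m B x y := by
  rw [antisym, Matrix.of_apply, smul_sum, smul_sum]
  refine sum_congr rfl fun σ _ => ?_
  split_ifs with h
  · congr 1
    subst h
    exact Equiv.prod_comp σ fun a => eps c (-y a)
  · rw [smul_zero, smul_zero]

theorem antisym_neg_neg (x y : Fin m → Idx N) : antisym N m B (-y) (-x) = antisym N m B x y := by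
  rw [antisym, Matrix.of_apply, Matrix.of_apply, ← Equiv.sum_comp (Equiv.inv _)]
  refine sum_congr rfl fun σ _ => ?_
  have neg_eq_comp_inv_iff : -y = (-x) ∘ (σ⁻¹ : Equiv.Perm (Fin m)) ↔ x = y ∘ σ := by
    rw [Equiv.Perm.inv_def, Equiv.eq_comp_symm, eq_comm]
    exact neg_inj
  simp only [Equiv.inv_apply, Equiv.Perm.sign_inv, neg_eq_comp_inv_iff]

theorem commute_antisym_apply (x y : Fin m → Idx N) (b : B) : Commute (antisym N m B x y) b := by
  rw [antisym, Matrix.of_apply]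
  refine Commute.sum_left _ _ _ fun σ _ => ?_
  split_ifs
  · exact Int.cast_commute _ _
  · exact Commute.zero_left _

theorem commute_antisym_scalar (q : B) :
    Commute (antisym N m B) (Matrix.scalar (Fin m → Idx N) q) := by
  ext x y
  rw [Matrix.scalar_apply, Matrix.mul_diagonal, Matrix.diagonal_mul, commute_antisym_apply]

theorem antisym_mul_prod_twT (c : Kind) (hc : c = .symplectic → Even N)
    {V : Fin m → Matrix (Idx N) (Idx N) B} {q : B}
    (h : ((List.finRange m).map fun a => onCopy a (V a)).prod * antisym N m B
      = antisym N m B * Matrix.scalar (Fin m → Idx N) q) :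
    antisym N m B * ((List.finRange m).map fun a => onCopy a (twT c (V a))).prod
      = antisym N m B * Matrix.scalar (Fin m → Idx N) q := by
  set P := ((List.finRange m).map fun a => onCopy a (V a)).prod
  ext x y
  have summand_eq (z : Fin m → Idx N) : antisym N m B x z
        * ((List.finRange m).map fun a => onCopy a (twT c (V a))).prod z y
      = (signProd c x * signProd c y) • (P (-y) (-z) * antisym N m B (-z) (-x)) := by
    calc antisym N m B x z * ((List.finRange m).map fun a => onCopy a (twT c (V a))).prod z y
        = signProd c y • (P (-y) (-z) * (signProd c z • antisym N m B x z)) := by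
          rw [prod_onCopy_twT_apply, mul_smul_comm, commute_antisym_apply, mul_comm, mul_smul,
            mul_smul_comm]
      _ = (signProd c x * signProd c y) • (P (-y) (-z) * antisym N m B (-z) (-x)) := by
          rw [← signProd_smul_antisym, mul_smul_comm, smul_smul, mul_comm (signProd c y),
            antisym_neg_neg]
  calc (antisym N m B * ((List.finRange m).map fun a => onCopy a (twT c (V a))).prod) x y
      = (signProd c x * signProd c y) • (P * antisym N m B) (-y) (-x) := by
        rw [Matrix.mul_apply, Matrix.mul_apply, sum_congr rfl fun z _ => summand_eq z, ← smul_sum]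
        exact congrArg _ (Equiv.sum_comp (Equiv.neg (Fin m → Idx N))
          fun z => P (-y) z * antisym N m B z (-x))
    _ = signProd c x • signProd c x • (antisym N m B x y * q) := by
        rw [h, mul_scalar_apply, antisym_neg_neg, mul_smul, ← smul_mul_assoc,
          ← signProd_smul_antisym, smul_mul_assoc]
    _ = (antisym N m B * Matrix.scalar (Fin m → Idx N) q) x y := by
        rw [smul_smul, signProd_mul_self c hc, one_smul, mul_scalar_apply]

theorem permMat_mul_prod_onCopy (σ : Equiv.Perm (Fin m)) (V : Fin m → Matrix (Idx N) (Idx N) B)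
    (l : List (Fin m)) : permMat N B σ * (l.map fun a => onCopy (σ a) (V a)).prod
      = (l.map fun a => onCopy a (V a)).prod * permMat N B σ := by
  induction l with
  | nil => simp
  | cons p l ih =>
    rw [List.map_cons, List.prod_cons, ← mul_assoc, permMat_mul_onCopy, mul_assoc, ih, ← mul_assoc,
      List.map_cons, List.prod_cons]

theorem prod_onCopy_mul_antisym_of_perm {σ : Equiv.Perm (Fin m)}
    {V : Fin m → Matrix (Idx N) (Idx N) B} {l : List (Fin m)} {q : B}
    (h : (l.map fun a => onCopy (σ a) (V a)).prod * antisym N m B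
      = antisym N m B * Matrix.scalar (Fin m → Idx N) q) :
    (l.map fun a => onCopy a (V a)).prod * antisym N m B
      = antisym N m B * Matrix.scalar (Fin m → Idx N) q := by
  have smul_eq := congrArg (permMat N B σ * ·) h
  beta_reduce at smul_eq
  rw [← mul_assoc, ← mul_assoc, permMat_mul_prod_onCopy, mul_assoc, permMat_mul_antisym,
    mul_smul_comm, smul_mul_assoc] at smul_eq
  exact (Equiv.Perm.sign σ).isUnit.smul_left_cancel.1 smul_eq

end Transposition

section Reversal

variable {N : ℕ} {A : Type*} [Ring A] [Algebra ℂ A]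

theorem map_evalHom_shifted {m : ℕ} (T : Matrix (Idx N) (Idx N) A⟦X⟧) (s : ℂ) (a : Fin m) :
    (shifted T a).map (evalHom A (constantCoeff_linInv (-1) s))
      = onCopy a (T.map (atLin (-1) (s - a))) := by
  refine (map_onCopy (evalHom A (constantCoeff_linInv (-1) s) : A⟦X⟧ →+* A⟦X⟧) a _).trans
    (congrArg (onCopy a) (Matrix.ext fun i j => ?_))
  refine (atLin_atLin one_ne_zero (by norm_num) (T i j)).trans ?_
  rw [one_mul, one_mul, sub_eq_add_neg, Matrix.map_apply]

/-- Substituting `-u + N - 1` for `u` turns `T_N(u - N + 1) ⋯ T_1(u)` into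
`T_N(-u) ⋯ T_1(-u + N - 1)`, where the copies can then be renumbered. -/
theorem IsQdet.prod_mul_antisym {T : Matrix (Idx N) (Idx N) A⟦X⟧} {q : A⟦X⟧} (h : IsQdet T q) :
    ((List.finRange N).map fun a => onCopy a (T.map (atLin (-1) ((a : ℕ) : ℂ)))).prod
        * antisym N N A⟦X⟧
      = antisym N N A⟦X⟧ * Matrix.scalar (Fin N → Idx N) (atLin (-1) ((N : ℂ) - 1) q) := by
  set f : A⟦X⟧ →+* A⟦X⟧ := (evalHom A (constantCoeff_linInv (-1) ((N : ℂ) - 1)) : A⟦X⟧ →+* A⟦X⟧)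
  have map_shifted_rev (a : Fin N) : (shifted T a.rev).map f
      = onCopy (Fin.revPerm a) (T.map (atLin (-1) ((a : ℕ) : ℂ))) := by
    have cast_rev : (N : ℂ) - 1 - (a.rev : ℕ) = (a : ℕ) := by
      have : ((a.rev : ℕ) : ℂ) + (a : ℕ) + 1 = N := by
        rw [Fin.val_rev]
        exact_mod_cast (by omega : N - (a + 1) + a + 1 = N)
      linear_combination -this
    rw [← cast_rev]
    exact map_evalHom_shifted T _ a.rev
  have map_eq := congrArg (fun M => M.map f) h.2.2
  beta_reduce at map_eq
  rw [map_mul_scalar, Matrix.map_mul, map_antisym, ← RingHom.mapMatrix_apply, map_list_prod,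
    List.finRange_reverse, List.map_map, List.map_map] at map_eq
  refine prod_onCopy_mul_antisym_of_perm (σ := Fin.revPerm) (Eq.trans ?_ map_eq)
  congr 3
  exact funext fun a => (map_shifted_rev a).symm

theorem IsQdet.antisym_mul_prod_twT (c : Kind) (hc : c = .symplectic → Even N)
    {T : Matrix (Idx N) (Idx N) A⟦X⟧} {q : A⟦X⟧} (h : IsQdet T q) :
    antisym N N A⟦X⟧ * ((List.finRange N).map fun a =>
        onCopy a (twT c (T.map (atLin (-1) ((a : ℕ) : ℂ))))).prod
      = antisym N N A⟦X⟧ * Matrix.scalar (Fin N → Idx N) (atLin (-1) ((N : ℂ) - 1) q) :=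
  TwYang.antisym_mul_prod_twT c hc h.prod_mul_antisym

end Reversal

/-! ### The Sklyanin determinant of `T(u) T^t(-u)` -/

section Functoriality

variable {N m : ℕ} {A A' : Type*} [Ring A] [Algebra ℂ A] [Ring A'] [Algebra ℂ A']

theorem map_shifted (φ : A →ₐ[ℂ] A') (S : Matrix (Idx N) (Idx N) A⟦X⟧) (a : Fin m) :
    (shifted S a).map (PowerSeries.map (φ : A →+* A'))
      = shifted (S.map (PowerSeries.map (φ : A →+* A'))) a :=
  (map_onCopy _ a _).trans (congrArg (onCopy a) (Matrix.ext fun i j => map_evalAt φ _ (S i j)))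

theorem map_Rt (φ : A →ₐ[ℂ] A') (c : Kind) (a b : Fin m) :
    (Rt c a b : Matrix (Fin m → Idx N) (Fin m → Idx N) A⟦X⟧).map (PowerSeries.map (φ : A →+* A'))
      = Rt c a b := by
  have map_scalarSeries (f : ℂ⟦X⟧) :
      PowerSeries.map (φ : A →+* A') (scalarSeries A f) = scalarSeries A' f := by
    ext n
    simp [scalarSeries]
  rw [Rt, Matrix.map_sub _ (map_sub _), Matrix.map_one _ (map_zero _) (map_one _), Rt]
  congr 1
  ext x y
  simp only [onCopies, Matrix.map_apply, Matrix.of_apply, map_scalarSeries, map_zero,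
    apply_ite (PowerSeries.map (φ : A →+* A'))]

theorem map_bracket (φ : A →ₐ[ℂ] A') (c : Kind) (S : Matrix (Idx N) (Idx N) A⟦X⟧)
    (l : List (Fin m)) : (bracket c S l).map (PowerSeries.map (φ : A →+* A'))
      = bracket c (S.map (PowerSeries.map (φ : A →+* A'))) l := by
  rw [bracket_eq_word, bracket_eq_word]
  refine (map_word (PowerSeries.map (φ : A →+* A')).mapMatrix.toMonoidHom (Rt c)
    (shifted S) l).trans ?_
  congr 1
  · exact funext₂ fun a b => map_Rt φ c a b
  · exact funext fun a => map_shifted φ S a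

theorem IsSdet.map {c : Kind} {S : Matrix (Idx N) (Idx N) A⟦X⟧} {d : A⟦X⟧} (h : IsSdet c S d)
    (φ : A →ₐ[ℂ] A') : IsSdet c (S.map (PowerSeries.map (φ : A →+* A')))
      (PowerSeries.map (φ : A →+* A') d) := by
  obtain ⟨hconst, hleft, hright⟩ := h
  have map_left := congrArg (fun M => M.map (PowerSeries.map (φ : A →+* A'))) hleft
  have map_right := congrArg (fun M => M.map (PowerSeries.map (φ : A →+* A'))) hright
  beta_reduce at map_left map_right
  rw [map_mul_scalar, Matrix.map_mul, map_antisym, map_bracket] at map_left map_right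
  refine ⟨?_, map_left, map_right⟩
  rw [← coeff_zero_eq_constantCoeff_apply, coeff_map, coeff_zero_eq_constantCoeff_apply, hconst,
    map_one]

end Functoriality

section TwistMatDet

variable {N m : ℕ} {A : Type*} [Ring A] [Algebra ℂ A] {T : Matrix (Idx N) (Idx N) A⟦X⟧}

theorem shifted_twistMat (c : Kind) (a : Fin m) : shifted (twistMat c T) a
    = shifted T a * onCopy a (twT c (T.map (atLin (-1) ((a : ℕ) : ℂ)))) := by
  have h := twistMat_map_evalAt (T := T) c (constantCoeff_linInv 1 (-((a : ℕ) : ℂ)))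
  rw [neg_linInv_one_neg] at h
  exact (congrArg (onCopy a) h).trans (onCopy_mul a _ _)

theorem bracket_twistMat (c : Kind) (hc : c = .symplectic → Even N)
    (hT : ∀ i j k l, rttDefect T i j k l = 0) {l : List (Fin m)} (hl : l.Nodup) :
    bracket c (twistMat c T) l
      = (l.map (shifted T)).prod * word (Rt c) (fun _ => 1) l
        * (l.map fun a => onCopy a (twT c (T.map (atLin (-1) ((a : ℕ) : ℂ))))).prod := by
  rw [bracket_eq_word, funext (shifted_twistMat (m := m) c)]
  refine word_mul (fun p a b ha hb => commute_onCopy_Rt c ha hb _)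
    (fun p a b ha hb => commute_onCopy_Rt c ha hb _) (fun p q hpq => ?_) hl
  rw [Rt_eq_one_sub_smul]
  exact rtt_copies_twT c hc hpq (rtt_of_rttDefect_eq_zero hT (constantCoeff_linInv _ _)
    (constantCoeff_linInv _ _) (linInv_ne_zero (by norm_num) _) (linInv_ne_zero one_ne_zero _)
    (linInv_neg_two_mul_sub _ _))

theorem IsSdet.eq_of_twistMat {c : Kind} (hc : c = .symplectic → Even N)
    (hT : ∀ i j k l, rttDefect T i j k l = 0) {q d : A⟦X⟧} (hd : IsSdet c (twistMat c T) d)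
    (hq : IsQdet T q) : d = scalarSeries A (γ N c) * q * atLin (-1) ((N : ℂ) - 1) q := by
  have semiconj_of_eq {M : Matrix (Fin N → Idx N) (Fin N → Idx N) A⟦X⟧} {f : A⟦X⟧}
      (h : antisym N N A⟦X⟧ * M = antisym N N A⟦X⟧ * Matrix.scalar (Fin N → Idx N) f) :
      SemiconjBy (antisym N N A⟦X⟧) M (Matrix.scalar (Fin N → Idx N) f) :=
    h.trans (commute_antisym_scalar f)
  have bracket_semiconj := ((semiconj_of_eq hq.2.1).mul_right
    (semiconj_of_eq (antisym_mul_word_one c hc))).mul_right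
    (semiconj_of_eq (hq.antisym_mul_prod_twT c hc))
  rw [← bracket_twistMat c hc hT (List.nodup_finRange N), ← map_mul, ← map_mul] at bracket_semiconj
  have γ_comm : q * scalarSeries A (γ N c) = scalarSeries A (γ N c) * q :=
    (Algebra.commutes (γ N c) q).symm
  rw [← γ_comm]
  exact antisym_mul_scalar_injective (hd.2.1.symm.trans
    (bracket_semiconj.eq.trans (commute_antisym_scalar _).eq.symm))

end TwistMatDet

end TwYang

end

theorem mainTheorem9 (N : ℕ) (hN : 0 < N) (c : TwYang.Kind)
    (hc : c = TwYang.Kind.symplectic → Even N) :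
    (∃! φ : TwYang.TwistedYangian c N →ₐ[ℂ] TwYang.Yangian N, TwYang.IsEmb φ) ∧
    (∃! q : PowerSeries (TwYang.Yangian N), TwYang.IsQdet (TwYang.Tmat N) q) ∧
    (∃! d : PowerSeries (TwYang.TwistedYangian c N), TwYang.IsSdet c (TwYang.Smat c N) d) ∧
    ∀ (φ : TwYang.TwistedYangian c N →ₐ[ℂ] TwYang.Yangian N)
      (q : PowerSeries (TwYang.Yangian N)) (d : PowerSeries (TwYang.TwistedYangian c N)),
      TwYang.IsEmb φ → TwYang.IsQdet (TwYang.Tmat N) q → TwYang.IsSdet c (TwYang.Smat c N) d →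
      PowerSeries.map (φ : TwYang.TwistedYangian c N →+* TwYang.Yangian N) d
        = TwYang.scalarSeries (TwYang.Yangian N) (TwYang.γ N c) * q
            * TwYang.atLin (-1) ((N : ℂ) - 1) q := by
  obtain ⟨q, hq⟩ := TwYang.exists_isQdet (TwYang.rttDefect_Tmat (N := N))
    TwYang.map_constantCoeff_Tmat
  obtain ⟨d, hd⟩ := TwYang.exists_isSdet hc (TwYang.quaternaryCoeffs_Smat c)
    (TwYang.map_constantCoeff_Smat c)
  refine ⟨TwYang.existsUnique_isEmb c N hc, ⟨q, hq, fun _ h => TwYang.isQdet_unique h hq⟩,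
    ⟨d, hd, fun _ h => TwYang.isSdet_unique h hd⟩, fun φ q d hφ hq hd => ?_⟩
  have hTT : TwYang.IsSdet c (TwYang.twistMat c (TwYang.Tmat N)) _ := hφ ▸ hd.map φ
  exact hTT.eq_of_twistMat hc TwYang.rttDefect_Tmat hq
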